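/- Let $K,F\colon(0,\infty)^2\to[0,\infty)$ be continuous symmetric functions such that for all $x,y>0$ \[K(x,y)\le K_0(x^{-\alpha}+y^{-\alpha})(x^{\beta}+y^{\beta}),\qquad F(x,y)\le F_0(x^{\gamma}+y^{\gamma}),\] for some constants $K_0,F_0\ge 0$ and $\alpha,\beta,\gamma\in[0,1]$. Let $\mu_{\mathrm{in}}$ be a finite nonnegative Borel measure on $(0,1]$. Let $g\colon[0,\infty)\to L^1(1,\infty)$, $t\mapsto g(t,\cdot)$, be continuous with $g(t,\cdot)\ge 0$ for every $t$, and suppose that \[\sup_{t\ge 0}\int_1^\infty x^{\max\{\beta,\gamma\}}g(t,x)\,dx<\infty.\] For $t\ge 0$, $x,y\in(0,1]$ and $\varphi\colon(0,1]\to\mathbb R$, put \[\mathcal A\varphi(x,y)=\varphi(\min\{x+y,1\})-\varphi(x)-\varphi(y),\] \[\mathcal B\varphi(x)=\tfrac12\int_0^x F(x-y,y)\bigl(\varphi(x)-\varphi(x-y)-\varphi(y)\bigr)\,dy,\] \[\mathcal G_t(x)=\int_1^\infty K(x,y)g(t,y)\,dy,\qquad \mathcal C_t(x)=\int_1^\infty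 F(y-x,x)g(t,y)\,dy.\] Then there exists a map $t\mapsto\mu_t$ from $[0,\infty)$ to the finite nonnegative Borel measures on $(0,1]$, continuous with respect to the total variation norm, such that for every Lipschitz function $\varphi\colon(0,1]\to\mathbb R$ with $\lim_{x\to0^+}\varphi(x)=0$ and every $t\ge 0$ \[\int_{(0,1]}\varphi\,d\mu_t=\int_{(0,1]}\varphi\,d\mu_{\mathrm{in}}+\int_0^t\Bigl(\tfrac12\int_{(0,1]^2}K\,\mathcal A\varphi\;d(\mu_s\otimes\mu_s)-\int_{(0,1]}\bigl(\mathcal G_s\varphi+\mathcal B\varphi\bigr)\,d\mu_s+\int_0^1\mathcal C_s(x)\varphi(x)\,dx\Bigr)\,ds,\] where all the integrals converge absolutely. -/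

import Mathlib

open MeasureTheory Set Filter Topology
open scoped NNReal ENNReal

namespace CoagFrag

noncomputable section

/-- The space `(0, 1]` of cluster sizes, with the topology and the Borel sets induced by `ℝ`. -/
abbrev Size : Type := Ioc (0 : ℝ) 1

/-- Nonnegative symmetric continuous kernels on `(0, ∞)²`.
Only the values at positive arguments are constrained (and used). -/
structure IsContinuousKernel (K : ℝ → ℝ → ℝ) : Prop where
  nonneg : ∀ x y : ℝ, 0 < x → 0 < y → 0 ≤ K x y
  symm : ∀ x y : ℝ, 0 < x → 0 < y → K x y = K y x
  continuousOn : ContinuousOn (fun p : ℝ × ℝ => K p.1 p.2) (Ioi 0 ×ˢ Ioi 0)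

/-- The Banach space `L¹(1, ∞)`. -/
abbrev L1Large : Type := Lp ℝ 1 ((volume : Measure ℝ).restrict (Ioi 1))

/-- A boundary datum: a continuous map from `[0, ∞)` to the nonnegative cone of `L¹(1, ∞)`. -/
structure IsBoundaryDatum (g : ℝ≥0 → L1Large) : Prop where
  nonneg : ∀ t, 0 ≤ g t
  continuous : Continuous g

/-- The moment `∫_1^∞ x ^ r * g(t, x) dx`, as an element of `[0, ∞]`. -/
def boundaryMoment (g : ℝ≥0 → L1Large) (r : ℝ) (t : ℝ≥0) : ℝ≥0∞ :=
  ∫⁻ x in Ioi (1 : ℝ), ENNReal.ofReal (x ^ r * g t x)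

/-- The supremum over all times `t ≥ 0` of the moment of order `r`, in `[0, ∞]`. -/
def boundaryMomentSup (g : ℝ≥0 → L1Large) (r : ℝ) : ℝ≥0∞ :=
  ⨆ t, boundaryMoment g r t

/-- Lipschitz functions on `(0, 1]` that vanish at `0`. A function on `(0, 1]` is represented by a
function on `ℝ`, of which only the values on `(0, 1]` matter. -/
structure IsLipZero (φ : ℝ → ℝ) : Prop where
  lipschitz : ∃ L : ℝ≥0, LipschitzOnWith L φ (Ioc 0 1)
  tendsto_zero : Tendsto φ (𝓝[>] 0) (𝓝 0)

/-- `φ̄(x + y) - φ(x) - φ(y)`, where `φ̄` extends `φ` from `(0, 1]` to `(0, ∞)` by the constant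
`φ(1)`, that is, `φ̄(z) = φ(min z 1)`. -/
def opA (φ : ℝ → ℝ) (x y : ℝ) : ℝ := φ (min (x + y) 1) - φ x - φ y

/-- `½ ∫_0^x F(x - y, y) (φ(x) - φ(x - y) - φ(y)) dy`. -/
def opB (F : ℝ → ℝ → ℝ) (φ : ℝ → ℝ) (x : ℝ) : ℝ :=
  (1 / 2) * ∫ y in (0 : ℝ)..x, F (x - y) y * (φ x - φ (x - y) - φ y)

/-- `𝒢(t, x) = ∫_1^∞ K(x, y) g(t, y) dy`. -/
def lossG (K : ℝ → ℝ → ℝ) (g : ℝ≥0 → L1Large) (t : ℝ≥0) (x : ℝ) : ℝ :=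
  ∫ y in Ioi (1 : ℝ), K x y * g t y

/-- `𝒞(t, x) = ∫_1^∞ F(y - x, x) g(t, y) dy`. -/
def gainC (F : ℝ → ℝ → ℝ) (g : ℝ≥0 → L1Large) (t : ℝ≥0) (x : ℝ) : ℝ :=
  ∫ y in Ioi (1 : ℝ), F (y - x) x * g t y

/-- The right-hand side of the evolution equation at time `t`, for the measure `ν`, tested
against `φ`:
`½ ⟨ν ⊗ ν, K 𝒜φ⟩ - ⟨ν, 𝒢_t φ + ℬφ⟩ + ⟨ℒ, 𝒞_t φ⟩`. -/
def rate (K F : ℝ → ℝ → ℝ) (g : ℝ≥0 → L1Large) (t : ℝ≥0) (ν : FiniteMeasure Size)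
    (φ : ℝ → ℝ) : ℝ :=
  (1 / 2) * (∫ p : Size × Size, K p.1 p.2 * opA φ p.1 p.2
      ∂((ν : Measure Size).prod (ν : Measure Size)))
    - (∫ x : Size, (lossG K g t x * φ x + opB F φ x) ∂(ν : Measure Size))
    + ∫ x in Ioc (0 : ℝ) 1, gainC F g t x * φ x

/-- All the integrals over sizes that occur in `rate K F g t ν φ` converge absolutely. -/
structure RateConverges (K F : ℝ → ℝ → ℝ) (g : ℝ≥0 → L1Large) (t : ℝ≥0)
    (ν : FiniteMeasure Size) (φ : ℝ → ℝ) : Prop where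
  lossG : ∀ x ∈ Ioc (0 : ℝ) 1, IntegrableOn (fun y => K x y * g t y) (Ioi 1)
  gainC : ∀ x ∈ Ioc (0 : ℝ) 1, IntegrableOn (fun y => F (y - x) x * g t y) (Ioi 1)
  opB : ∀ x ∈ Ioc (0 : ℝ) 1,
    IntervalIntegrable (fun y => F (x - y) y * (φ x - φ (x - y) - φ y)) volume 0 x
  coagulation : Integrable (fun p : Size × Size => K p.1 p.2 * opA φ p.1 p.2)
    ((ν : Measure Size).prod (ν : Measure Size))
  loss : Integrable (fun x : Size => CoagFrag.lossG K g t x * φ x + CoagFrag.opB F φ x)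
    (ν : Measure Size)
  gain : IntegrableOn (fun x : ℝ => CoagFrag.gainC F g t x * φ x) (Ioc 0 1)

/-- The distance `‖μ - ν‖ = |μ - ν|((0, 1])` in total variation norm. -/
def tvDist (μ ν : FiniteMeasure Size) : ℝ≥0∞ :=
  ((μ : Measure Size).toSignedMeasure - (ν : Measure Size).toSignedMeasure).totalVariation univ

/-- Continuity of `t ↦ μ_t` on `[0, ∞)` with respect to the total variation norm. -/
def TVContinuous (μ : ℝ≥0 → FiniteMeasure Size) : Prop :=
  ∀ t, Tendsto (fun s => tvDist (μ s) (μ t)) (𝓝 t) (𝓝 0)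

/-- `μ` solves the boundary valued coagulation-fragmentation equation with kernels `K`, `F`,
initial value `μin` and boundary datum `g`. -/
structure IsSolution (K F : ℝ → ℝ → ℝ) (μin : FiniteMeasure Size) (g : ℝ≥0 → L1Large)
    (μ : ℝ≥0 → FiniteMeasure Size) : Prop where
  continuous : TVContinuous μ
  converges : ∀ φ : ℝ → ℝ, IsLipZero φ → ∀ s, RateConverges K F g s (μ s) φ
  intervalIntegrable : ∀ φ : ℝ → ℝ, IsLipZero φ → ∀ t : ℝ≥0,
    IntervalIntegrable (fun s : ℝ => rate K F g s.toNNReal (μ s.toNNReal) φ) volume 0 t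
  equation : ∀ φ : ℝ → ℝ, IsLipZero φ → ∀ t : ℝ≥0,
    ∫ x : Size, φ x ∂(μ t : Measure Size) =
      (∫ x : Size, φ x ∂(μin : Measure Size))
        + ∫ s in (0 : ℝ)..t, rate K F g s.toNNReal (μ s.toNNReal) φ

end

end CoagFrag

/-! ### Kernel bounds and the boundary terms `𝒢` and `𝒞`. -/

namespace CoagFrag

/-! If `φ` is `L`-Lipschitz and vanishes at `0`, then `|𝒜φ(x, y)| ≤ 2 L min(x, y)`, while `K(x, y) ≤
k / min(x, y)` on `(0, 1]²` and `𝒢_t(x) ≤ k M / x`. The zero of the test function cancels the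
singularity of the kernel: every integrand against the unknown measure is bounded and continuous,
and the rate is continuous for weak convergence (`tendsto_rate`). Existence is therefore proved by
approximation and compactness, and continuity in total variation is a regularity statement proved
afterwards.

Approximation: an explicit Euler scheme on measures carried by the grid `{j / (N + 1)}`. The grid is
stable under `(x, y) ↦ min(x + y, 1)`, so coagulation needs no rounding; only fragments and the gain
from large clusters are rounded, with an error of order `1 / (N + 1)` (`abs_rate_roundUp_sub_le`).
On the grid `K ≤ k (N + 1)`, so short time steps keep the weights nonnegative (`le_rate`).
Nonnegative decreasing test functions give coagulation and loss the good sign, which bounds the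
total mass and the mass near `0` uniformly in `N` (`rate_le_of_antitone`).

Compactness: the mass and tail bounds give weak relative compactness at each time, and moments of
order at least `1` identify a measure on `(0, 1]` (`ext_of_moments`). A diagonal extraction over
moments and a dense set of times, together with equicontinuity in time, yields convergence at all
times; the limit is a weak solution (`exists_weakSolution`).

Total variation: the rate bound above grows with `L`. The ramps `min(n x, 1)` are subadditive and
increase to `1`. Testing with them and applying Fatou's lemma shows that `∫ K d(μ_s ⊗ μ_s)` and `∫
𝒢_s dμ_s` are dominated by a locally integrable function of `s` (`lintegral_K_le`,
`lintegral_lossG_le`). So the rate has a locally integrable bound common to all Lipschitz `φ` with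
`φ(0) = 0` and `|φ| ≤ 1` (`enorm_rate_le`), and these `φ` are enough to control the total variation.
-/

/-- The bounds on the kernels and on the boundary datum that the existence proof uses. -/
structure Subordinate (K F : ℝ → ℝ → ℝ) (g : ℝ≥0 → L1Large) (k f ρ M : ℝ) : Prop where
  kernelK : IsContinuousKernel K
  kernelF : IsContinuousKernel F
  datum : IsBoundaryDatum g
  k_nonneg : 0 ≤ k
  f_nonneg : 0 ≤ f
  M_nonneg : 0 ≤ M
  K_le : ∀ x ∈ Ioc (0 : ℝ) 1, ∀ y ∈ Ioc (0 : ℝ) 1, x ≤ y → K x y ≤ k / x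
  K_large_le : ∀ x ∈ Ioc (0 : ℝ) 1, ∀ y ∈ Ioi (1 : ℝ), K x y ≤ k / x * y ^ ρ
  F_le : ∀ x ∈ Ioc (0 : ℝ) 1, ∀ y ∈ Ioc (0 : ℝ) 1, F x y ≤ f
  F_large_le : ∀ x ∈ Ioc (0 : ℝ) 1, ∀ y ∈ Ioi (1 : ℝ), F (y - x) x ≤ f * y ^ ρ
  integrable_moment : ∀ t, IntegrableOn (fun y => y ^ ρ * g t y) (Ioi 1)
  moment_le : ∀ t, ∫ y in Ioi (1 : ℝ), y ^ ρ * g t y ≤ M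

theorem IsBoundaryDatum.ae_nonneg {g : ℝ≥0 → L1Large} (hg : IsBoundaryDatum g) (t : ℝ≥0) :
    ∀ᵐ y ∂(volume : Measure ℝ).restrict (Ioi 1), 0 ≤ g t y := by
  have := (Lp.coeFn_nonneg (g t)).2 (hg.nonneg t)
  exact this

theorem rpow_neg_le_inv {a x : ℝ} (ha : a ∈ Icc (0 : ℝ) 1) (hx : x ∈ Ioc (0 : ℝ) 1) :
    x ^ (-a) ≤ 1 / x := by
  rw [one_div, ← Real.rpow_neg_one]
  exact Real.rpow_le_rpow_of_exponent_ge hx.1 hx.2 (by linarith [ha.2])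

/-- For `x ≤ y ≤ 1` both negative powers are at most `1 / x`, because `α ≤ 1`, and both positive
powers are at most `1`: this gives `4 K₀ / x`. For `y > 1` the positive powers are dominated by `y ^
max β γ`, the weight of the assumed moment. -/
theorem subordinate_of_bounds
    {K F : ℝ → ℝ → ℝ} (hK : IsContinuousKernel K) (hF : IsContinuousKernel F)
    {α β γ K₀ F₀ : ℝ}
    (hα : α ∈ Icc (0 : ℝ) 1) (hβ : β ∈ Icc (0 : ℝ) 1) (hγ : γ ∈ Icc (0 : ℝ) 1)
    (hK₀ : 0 ≤ K₀) (hF₀ : 0 ≤ F₀)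
    (hKbound : ∀ x y : ℝ, 0 < x → 0 < y →
      K x y ≤ K₀ * (x ^ (-α) + y ^ (-α)) * (x ^ β + y ^ β))
    (hFbound : ∀ x y : ℝ, 0 < x → 0 < y → F x y ≤ F₀ * (x ^ γ + y ^ γ))
    {g : ℝ≥0 → L1Large} (hg : IsBoundaryDatum g)
    (hM : boundaryMomentSup g (max β γ) < ⊤) :
    Subordinate K F g (4 * K₀) (2 * F₀) (max β γ) (boundaryMomentSup g (max β γ)).toReal := by
  have hmeas : ∀ t, AEStronglyMeasurable (fun y => y ^ (max β γ) * g t y)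
      ((volume : Measure ℝ).restrict (Ioi 1)) := fun t =>
    (by fun_prop : Measurable fun y : ℝ => y ^ (max β γ)).aestronglyMeasurable.mul
      (Lp.aestronglyMeasurable (g t))
  have hnn : ∀ t, 0 ≤ᵐ[(volume : Measure ℝ).restrict (Ioi 1)]
      fun y => y ^ (max β γ) * g t y := fun t => by
    filter_upwards [hg.ae_nonneg t, ae_restrict_mem measurableSet_Ioi] with y hy h1
    exact mul_nonneg (Real.rpow_nonneg (by linarith [mem_Ioi.1 h1]) _) hy
  have hle : ∀ t, ∫⁻ y in Ioi (1 : ℝ), ENNReal.ofReal (y ^ (max β γ) * g t y)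
      ≤ boundaryMomentSup g (max β γ) := fun t => le_iSup (boundaryMoment g (max β γ)) t
  have hpow : ∀ {a x y : ℝ}, 0 ≤ a → 0 < x → x ≤ y → 1 ≤ y → x ^ a + y ^ a ≤ 2 * y ^ a := by
    intro a x y ha hx hxy _
    have := Real.rpow_le_rpow hx.le hxy ha
    linarith
  refine ⟨hK, hF, hg, by positivity, by positivity, ENNReal.toReal_nonneg, ?_, ?_, ?_, ?_, ?_, ?_⟩
  · intro x hx y hy hxy
    have h1 := rpow_neg_le_inv hα hx
    have h2 : y ^ (-α) ≤ 1 / x :=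
      (rpow_neg_le_inv hα hy).trans (one_div_le_one_div_of_le hx.1 hxy)
    have h3 := Real.rpow_le_one hx.1.le hx.2 hβ.1
    have h4 := Real.rpow_le_one hy.1.le hy.2 hβ.1
    have h5 : 0 ≤ x ^ β + y ^ β :=
      add_nonneg (Real.rpow_nonneg hx.1.le _) (Real.rpow_nonneg hy.1.le _)
    have hx' : 0 ≤ 1 / x := by have := hx.1; positivity
    calc K x y ≤ K₀ * (x ^ (-α) + y ^ (-α)) * (x ^ β + y ^ β) := hKbound x y hx.1 hy.1
      _ ≤ K₀ * (1 / x + 1 / x) * (1 + 1) := by gcongr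
      _ = 4 * K₀ / x := by ring
  · intro x hx y hy
    have hy : 1 < y := hy
    have h1 := rpow_neg_le_inv hα hx
    have h2 : y ^ (-α) ≤ 1 / x := by
      have a1 : y ^ (-α) ≤ 1 := Real.rpow_le_one_of_one_le_of_nonpos hy.le (by linarith [hα.1])
      have a2 : 1 ≤ 1 / x := by rw [le_div_iff₀ hx.1]; linarith [hx.2]
      linarith
    have h3 := hpow hβ.1 hx.1 (hx.2.trans hy.le) hy.le
    have h4 : y ^ β ≤ y ^ (max β γ) := Real.rpow_le_rpow_of_exponent_le hy.le (le_max_left _ _)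
    have h5 : 0 ≤ x ^ β + y ^ β :=
      add_nonneg (Real.rpow_nonneg hx.1.le _) (Real.rpow_nonneg (by linarith) _)
    have hx' : 0 ≤ 1 / x := by have := hx.1; positivity
    calc K x y ≤ K₀ * (x ^ (-α) + y ^ (-α)) * (x ^ β + y ^ β) :=
          hKbound x y hx.1 (by linarith)
      _ ≤ K₀ * (1 / x + 1 / x) * (2 * y ^ (max β γ)) := by gcongr; linarith
      _ = 4 * K₀ / x * y ^ (max β γ) := by ring
  · intro x hx y hy
    have h3 := Real.rpow_le_one hx.1.le hx.2 hγ.1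
    have h4 := Real.rpow_le_one hy.1.le hy.2 hγ.1
    calc F x y ≤ F₀ * (x ^ γ + y ^ γ) := hFbound x y hx.1 hy.1
      _ ≤ F₀ * (1 + 1) := by gcongr
      _ = 2 * F₀ := by ring
  · intro x hx y hy
    have hy : 1 < y := hy
    have h1 : (y - x) ^ γ ≤ y ^ γ :=
      Real.rpow_le_rpow (by linarith [hx.2]) (by linarith [hx.1]) hγ.1
    have h2 : x ^ γ ≤ y ^ γ := Real.rpow_le_rpow hx.1.le (by linarith [hx.2]) hγ.1
    have h4 : y ^ γ ≤ y ^ (max β γ) := Real.rpow_le_rpow_of_exponent_le hy.le (le_max_right _ _)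
    calc F (y - x) x ≤ F₀ * ((y - x) ^ γ + x ^ γ) :=
          hFbound _ _ (by linarith [hx.2]) hx.1
      _ ≤ F₀ * (y ^ (max β γ) + y ^ (max β γ)) := by gcongr <;> linarith
      _ = 2 * F₀ * y ^ (max β γ) := by ring
  · intro t
    refine ⟨hmeas t, ?_⟩
    rw [hasFiniteIntegral_iff_ofReal (hnn t)]
    exact (hle t).trans_lt hM
  · intro t
    rw [integral_eq_lintegral_of_nonneg_ae (hnn t) (hmeas t)]
    exact ENNReal.toReal_mono hM.ne (hle t)

namespace Subordinate

variable {K F : ℝ → ℝ → ℝ} {g : ℝ≥0 → L1Large} {k f ρ M : ℝ}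

theorem integrableOn_mul (H : Subordinate K F g k f ρ M) (t : ℝ≥0) {w : ℝ → ℝ} {c : ℝ}
    (hw : ContinuousOn w (Ioi 1)) (hc : ∀ y ∈ Ioi (1 : ℝ), |w y| ≤ c * y ^ ρ) :
    IntegrableOn (fun y => w y * g t y) (Ioi 1) := by
  refine Integrable.mono' ((H.integrable_moment t).const_mul c)
    ((hw.aestronglyMeasurable measurableSet_Ioi).mul (Lp.aestronglyMeasurable (g t))) ?_
  filter_upwards [H.datum.ae_nonneg t, ae_restrict_mem measurableSet_Ioi] with y hy h1
  rw [Real.norm_eq_abs, abs_mul, abs_of_nonneg hy]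
  calc |w y| * g t y ≤ (c * y ^ ρ) * g t y := by gcongr; exact hc y h1
    _ = c * (y ^ ρ * g t y) := by ring

theorem integral_mul_le (H : Subordinate K F g k f ρ M) (t : ℝ≥0) {w : ℝ → ℝ} {c : ℝ}
    (hc0 : 0 ≤ c)
    (hw : ContinuousOn w (Ioi 1)) (hc : ∀ y ∈ Ioi (1 : ℝ), |w y| ≤ c * y ^ ρ) :
    ∫ y in Ioi (1 : ℝ), w y * g t y ≤ c * M := by
  calc ∫ y in Ioi (1 : ℝ), w y * g t y ≤ ∫ y in Ioi (1 : ℝ), c * (y ^ ρ * g t y) := by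
        refine integral_mono_ae (H.integrableOn_mul t hw hc)
          ((H.integrable_moment t).const_mul c) ?_
        filter_upwards [H.datum.ae_nonneg t, ae_restrict_mem measurableSet_Ioi] with y hy h1
        calc w y * g t y ≤ (c * y ^ ρ) * g t y := by
              gcongr; exact (le_abs_self _).trans (hc y h1)
          _ = c * (y ^ ρ * g t y) := by ring
    _ = c * ∫ y in Ioi (1 : ℝ), y ^ ρ * g t y := integral_const_mul _ _
    _ ≤ c * M := by gcongr; exact H.moment_le t

theorem integral_mul_nonneg (H : Subordinate K F g k f ρ M) (t : ℝ≥0) {w : ℝ → ℝ}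
    (hw : ∀ y ∈ Ioi (1 : ℝ), 0 ≤ w y) : 0 ≤ ∫ y in Ioi (1 : ℝ), w y * g t y := by
  refine integral_nonneg_of_ae ?_
  filter_upwards [H.datum.ae_nonneg t, ae_restrict_mem measurableSet_Ioi] with y hy h1
  exact mul_nonneg (hw y h1) hy

theorem continuousOn_K_right (H : Subordinate K F g k f ρ M) {x : ℝ} (hx : x ∈ Ioc (0 : ℝ) 1) :
    ContinuousOn (fun y => K x y) (Ioi 1) :=
  H.kernelK.continuousOn.comp (f := fun y : ℝ => (x, y)) (by fun_prop)
    fun y hy => ⟨hx.1, mem_Ioi.2 (zero_lt_one.trans (mem_Ioi.1 hy))⟩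

theorem continuousOn_F_sub (H : Subordinate K F g k f ρ M) {x : ℝ} (hx : x ∈ Ioc (0 : ℝ) 1) :
    ContinuousOn (fun y => F (y - x) x) (Ioi 1) :=
  H.kernelF.continuousOn.comp (f := fun y : ℝ => (y - x, x)) (by fun_prop)
    fun y hy => ⟨sub_pos.2 (hx.2.trans_lt hy), hx.1⟩

theorem abs_K_large_le (H : Subordinate K F g k f ρ M) {x y : ℝ} (hx : x ∈ Ioc (0 : ℝ) 1)
    (hy : y ∈ Ioi (1 : ℝ)) : |K x y| ≤ k / x * y ^ ρ := by
  rw [abs_of_nonneg (H.kernelK.nonneg _ _ hx.1 (zero_lt_one.trans hy))]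
  exact H.K_large_le x hx y hy

theorem abs_F_large_le (H : Subordinate K F g k f ρ M) {x y : ℝ} (hx : x ∈ Ioc (0 : ℝ) 1)
    (hy : y ∈ Ioi (1 : ℝ)) : |F (y - x) x| ≤ f * y ^ ρ := by
  rw [abs_of_nonneg (H.kernelF.nonneg _ _ (sub_pos.2 (hx.2.trans_lt hy)) hx.1)]
  exact H.F_large_le x hx y hy

theorem integrableOn_lossG (H : Subordinate K F g k f ρ M) (t : ℝ≥0) {x : ℝ}
    (hx : x ∈ Ioc (0 : ℝ) 1) : IntegrableOn (fun y => K x y * g t y) (Ioi 1) :=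
  H.integrableOn_mul t (H.continuousOn_K_right hx) fun _ hy => H.abs_K_large_le hx hy

theorem integrableOn_gainC (H : Subordinate K F g k f ρ M) (t : ℝ≥0) {x : ℝ}
    (hx : x ∈ Ioc (0 : ℝ) 1) : IntegrableOn (fun y => F (y - x) x * g t y) (Ioi 1) :=
  H.integrableOn_mul t (H.continuousOn_F_sub hx) fun _ hy => H.abs_F_large_le hx hy

theorem lossG_nonneg (H : Subordinate K F g k f ρ M) (t : ℝ≥0) {x : ℝ}
    (hx : x ∈ Ioc (0 : ℝ) 1) : 0 ≤ lossG K g t x :=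
  H.integral_mul_nonneg t fun _ hy => H.kernelK.nonneg _ _ hx.1 (zero_lt_one.trans hy)

theorem lossG_le (H : Subordinate K F g k f ρ M) (t : ℝ≥0) {x : ℝ}
    (hx : x ∈ Ioc (0 : ℝ) 1) : lossG K g t x ≤ k / x * M :=
  H.integral_mul_le t (div_nonneg H.k_nonneg hx.1.le) (H.continuousOn_K_right hx)
    fun _ hy => H.abs_K_large_le hx hy

theorem gainC_nonneg (H : Subordinate K F g k f ρ M) (t : ℝ≥0) {x : ℝ}
    (hx : x ∈ Ioc (0 : ℝ) 1) : 0 ≤ gainC F g t x :=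
  H.integral_mul_nonneg t fun _ hy =>
    H.kernelF.nonneg _ _ (sub_pos.2 (hx.2.trans_lt hy)) hx.1

theorem gainC_le (H : Subordinate K F g k f ρ M) (t : ℝ≥0) {x : ℝ}
    (hx : x ∈ Ioc (0 : ℝ) 1) : gainC F g t x ≤ f * M :=
  H.integral_mul_le t H.f_nonneg (H.continuousOn_F_sub hx) fun _ hy => H.abs_F_large_le hx hy

theorem continuous_lossG (H : Subordinate K F g k f ρ M) (t : ℝ≥0) :
    Continuous fun x : Size => lossG K g t x := by
  refine continuous_iff_continuousAt.2 fun x₀ => ?_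
  have hx₀ := x₀.2.1
  -- Staying above `x₀ / 2` keeps the singular factor `k / x` bounded, which provides the dominating
  -- function.
  have hev : ∀ᶠ x : Size in 𝓝 x₀, (x₀ : ℝ) / 2 < x :=
    (continuous_subtype_val.tendsto x₀).eventually (lt_mem_nhds (by linarith))
  refine continuousAt_of_dominated (bound := fun y => k / ((x₀ : ℝ) / 2) * (y ^ ρ * g t y))
    (Eventually.of_forall fun x => (H.integrableOn_lossG t x.2).aestronglyMeasurable) ?_
    ((H.integrable_moment t).const_mul _) ?_
  · filter_upwards [hev] with x hx
    filter_upwards [H.datum.ae_nonneg t, ae_restrict_mem measurableSet_Ioi] with y hy h1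
    have h2 : k / (x : ℝ) ≤ k / ((x₀ : ℝ) / 2) :=
      div_le_div_of_nonneg_left H.k_nonneg (by linarith) hx.le
    have h3 : (0 : ℝ) ≤ y ^ ρ := Real.rpow_nonneg (by linarith [mem_Ioi.1 h1]) _
    rw [Real.norm_eq_abs, abs_mul, abs_of_nonneg hy, ← mul_assoc]
    gcongr
    exact (H.abs_K_large_le x.2 h1).trans (by gcongr)
  · filter_upwards [ae_restrict_mem measurableSet_Ioi] with y h1
    have hy : (0 : ℝ) < y := zero_lt_one.trans h1
    have : ContinuousOn (fun x : ℝ => K x y) (Ioi 0) :=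
      H.kernelK.continuousOn.comp (f := fun x : ℝ => (x, y)) (by fun_prop) fun x hx => ⟨hx, hy⟩
    exact (((this.continuousAt (Ioi_mem_nhds hx₀)).comp
      (f := fun x : Size => (x : ℝ)) continuous_subtype_val.continuousAt)).mul continuousAt_const

theorem continuous_gainC (H : Subordinate K F g k f ρ M) (t : ℝ≥0) :
    Continuous fun x : Size => gainC F g t x := by
  refine continuous_iff_continuousAt.2 fun x₀ => ?_
  have hx₀ := x₀.2.1
  refine continuousAt_of_dominated (bound := fun y => f * (y ^ ρ * g t y))
    (Eventually.of_forall fun x => (H.integrableOn_gainC t x.2).aestronglyMeasurable)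
    (Eventually.of_forall fun x => ?_) ((H.integrable_moment t).const_mul _) ?_
  · filter_upwards [H.datum.ae_nonneg t, ae_restrict_mem measurableSet_Ioi] with y hy h1
    rw [Real.norm_eq_abs, abs_mul, abs_of_nonneg hy, ← mul_assoc]
    gcongr
    exact H.abs_F_large_le x.2 h1
  · filter_upwards [ae_restrict_mem measurableSet_Ioi] with y h1
    have h1 : (1 : ℝ) < y := h1
    have hopen : IsOpen (Ioi (0 : ℝ) ×ˢ Ioi (0 : ℝ)) := isOpen_Ioi.prod isOpen_Ioi
    have hc : ContinuousAt (fun p : ℝ × ℝ => F p.1 p.2) (y - x₀, (x₀ : ℝ)) :=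
      H.kernelF.continuousOn.continuousAt
        (hopen.mem_nhds ⟨sub_pos.2 (x₀.2.2.trans_lt h1), hx₀⟩)
    exact (hc.comp (f := fun x : Size => (y - (x : ℝ), (x : ℝ)))
      (by fun_prop)).mul continuousAt_const

end Subordinate
end CoagFrag

/-! ### Lipschitz test functions; bounds, continuity and measurability of the operators. -/

namespace CoagFrag

/-- Globally `L`-Lipschitz functions vanishing at `0`. -/
structure LipAtZero (L : ℝ) (φ : ℝ → ℝ) : Prop where
  lip : ∀ x y, |φ x - φ y| ≤ L * |x - y|
  zero : φ 0 = 0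

namespace LipAtZero

variable {L : ℝ} {φ : ℝ → ℝ}

theorem nonneg (h : LipAtZero L φ) : 0 ≤ L := by
  have := (abs_nonneg _).trans (h.lip 1 0)
  simpa using this

theorem continuous (h : LipAtZero L φ) : Continuous φ :=
  (LipschitzWith.of_dist_le_mul (K := ⟨L, h.nonneg⟩) fun x y => by
    rw [Real.dist_eq, Real.dist_eq]; exact h.lip x y).continuous

theorem abs_apply_le (h : LipAtZero L φ) {x : ℝ} (hx : 0 ≤ x) : |φ x| ≤ L * x := by
  simpa [h.zero, abs_of_nonneg hx] using h.lip x 0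

theorem abs_le_one (h : LipAtZero L φ) {x : ℝ} (hx : x ∈ Ioc (0 : ℝ) 1) : |φ x| ≤ L :=
  (h.abs_apply_le hx.1.le).trans (mul_le_of_le_one_right h.nonneg hx.2)

/-- `φ x` is `O(x)` by itself, and the other two terms are values of `φ` at points at distance at
most `x`. By symmetry of `opA` the bound also holds with `y`, hence with the minimum. -/
theorem abs_opA_le (h : LipAtZero L φ) {x y : ℝ} (hx : x ∈ Ioc (0 : ℝ) 1)
    (hy : y ∈ Ioc (0 : ℝ) 1) : |opA φ x y| ≤ 2 * L * x := by
  have h1 := h.abs_apply_le hx.1.le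
  have h2 := h.lip (min (x + y) 1) y
  have h3 : |min (x + y) 1 - y| ≤ x := by
    rw [abs_of_nonneg (sub_nonneg.2 (le_min (by linarith [hx.1]) hy.2))]
    linarith [min_le_left (x + y) 1]
  have h4 : L * |min (x + y) 1 - y| ≤ L * x := mul_le_mul_of_nonneg_left h3 h.nonneg
  have h5 := abs_le.1 h1
  have h6 := abs_le.1 (h2.trans h4)
  unfold opA
  rw [abs_le]
  constructor <;> linarith [h5.1, h5.2, h6.1, h6.2]

end LipAtZero

theorem opA_comm (φ : ℝ → ℝ) (x y : ℝ) : opA φ x y = opA φ y x := by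
  unfold opA; rw [add_comm]; ring

theorem min_mem_Ioc {x y : ℝ} (hx : x ∈ Ioc (0 : ℝ) 1) (hy : y ∈ Ioc (0 : ℝ) 1) :
    min (x + y) 1 ∈ Ioc (0 : ℝ) 1 :=
  ⟨lt_min (add_pos hx.1 hy.1) one_pos, min_le_right _ _⟩

namespace Subordinate

variable {K F : ℝ → ℝ → ℝ} {g : ℝ≥0 → L1Large} {k f ρ M : ℝ}

/-- The cancellation behind the weak formulation: `k / min x y` against `2 L min x y`. -/
theorem abs_K_mul_opA_le (H : Subordinate K F g k f ρ M) {L : ℝ} {φ : ℝ → ℝ}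
    (hφ : LipAtZero L φ) {x y : ℝ} (hx : x ∈ Ioc (0 : ℝ) 1) (hy : y ∈ Ioc (0 : ℝ) 1) :
    |K x y * opA φ x y| ≤ 2 * k * L := by
  have key : ∀ x ∈ Ioc (0 : ℝ) 1, ∀ y ∈ Ioc (0 : ℝ) 1, x ≤ y →
      |K x y * opA φ x y| ≤ 2 * k * L := by
    intro x hx y hy hxy
    have hx0 := hx.1
    rw [abs_mul, abs_of_nonneg (H.kernelK.nonneg _ _ hx.1 hy.1)]
    calc K x y * |opA φ x y| ≤ k / x * (2 * L * x) := by
          gcongr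
          · exact div_nonneg H.k_nonneg hx.1.le
          · exact H.K_le x hx y hy hxy
          · exact hφ.abs_opA_le hx hy
      _ = 2 * k * L := by field_simp
  rcases le_total x y with h | h
  · exact key x hx y hy h
  · rw [H.kernelK.symm _ _ hx.1 hy.1, opA_comm]
    exact key y hy x hx h

theorem K_le_of_le (H : Subordinate K F g k f ρ M) {δ x y : ℝ} (hδ : 0 < δ)
    (hx : x ∈ Ioc (0 : ℝ) 1) (hy : y ∈ Ioc (0 : ℝ) 1) (hδx : δ ≤ x) (hδy : δ ≤ y) :
    K x y ≤ k / δ := by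
  rcases le_total x y with h | h
  · exact (H.K_le x hx y hy h).trans (div_le_div_of_nonneg_left H.k_nonneg hδ hδx)
  · rw [H.kernelK.symm _ _ hx.1 hy.1]
    exact (H.K_le y hy x hx h).trans (div_le_div_of_nonneg_left H.k_nonneg hδ hδy)

theorem continuous_K (H : Subordinate K F g k f ρ M) :
    Continuous fun p : Size × Size => K p.1 p.2 :=
  H.kernelK.continuousOn.comp_continuous
    (f := fun p : Size × Size => ((p.1 : ℝ), (p.2 : ℝ))) (by fun_prop)
    fun p => ⟨p.1.2.1, p.2.2.1⟩

theorem continuousOn_F_antidiagonal (H : Subordinate K F g k f ρ M) (x : ℝ) :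
    ContinuousOn (fun y => F (x - y) y) (Ioo 0 x) :=
  H.kernelF.continuousOn.comp (f := fun y : ℝ => (x - y, y)) (by fun_prop)
    fun y hy => ⟨sub_pos.2 hy.2, mem_Ioi.2 hy.1⟩

theorem F_antidiagonal_mem (H : Subordinate K F g k f ρ M) {x y : ℝ} (hx : x ∈ Ioc (0 : ℝ) 1)
    (hy : y ∈ Ioo 0 x) : F (x - y) y ∈ Icc 0 f :=
  ⟨H.kernelF.nonneg _ _ (sub_pos.2 hy.2) hy.1,
    H.F_le _ ⟨sub_pos.2 hy.2, by linarith [hy.1, hx.2]⟩ _ ⟨hy.1, hy.2.le.trans hx.2⟩⟩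

/-- Integrability of `F(x - y, y) * w(y)` on `(0, x)` for bounded measurable `w`. -/
theorem integrableOn_F_mul (H : Subordinate K F g k f ρ M) {x : ℝ} (hx : x ∈ Ioc (0 : ℝ) 1)
    {w : ℝ → ℝ} (hw : Measurable w) {B : ℝ} (hB : ∀ y ∈ Ioo 0 x, |w y| ≤ B) :
    IntegrableOn (fun y => F (x - y) y * w y) (Ioo 0 x) := by
  refine Integrable.mono' (g := fun _ => f * B) (integrable_const _)
    (((H.continuousOn_F_antidiagonal x).aestronglyMeasurable measurableSet_Ioo).mul
      hw.aestronglyMeasurable) ?_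
  filter_upwards [ae_restrict_mem measurableSet_Ioo] with y hy
  have h1 := H.F_antidiagonal_mem hx hy
  rw [Real.norm_eq_abs, abs_mul, abs_of_nonneg h1.1]
  exact mul_le_mul h1.2 (hB y hy) (abs_nonneg _) H.f_nonneg

theorem opB_eq (F : ℝ → ℝ → ℝ) (φ : ℝ → ℝ) {x : ℝ} (hx : 0 < x) :
    opB F φ x = (1 / 2) * ∫ y in Ioo 0 x, F (x - y) y * (φ x - φ (x - y) - φ y) := by
  rw [opB, intervalIntegral.integral_of_le hx.le, integral_Ioc_eq_integral_Ioo]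

theorem opB_le (H : Subordinate K F g k f ρ M) {φ : ℝ → ℝ} (hφ : Measurable φ) {S : ℝ}
    (hS : ∀ x ∈ Ioc (0 : ℝ) 1, |φ x| ≤ S) {x : ℝ} (hx : x ∈ Ioc (0 : ℝ) 1) {w : ℝ → ℝ}
    (hw : IntegrableOn w (Ioo 0 x))
    (hle : ∀ y ∈ Ioo 0 x, F (x - y) y * (φ x - φ (x - y) - φ y) ≤ w y) :
    opB F φ x ≤ (1 / 2) * ∫ y in Ioo 0 x, w y := by
  rw [opB_eq F φ hx.1]
  refine mul_le_mul_of_nonneg_left (setIntegral_mono_on ?_ hw measurableSet_Ioo hle) (by norm_num)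
  refine H.integrableOn_F_mul hx (B := S + S + S) (by fun_prop) fun y hy => ?_
  have h1 := abs_le.1 (hS x hx)
  have h2 := abs_le.1 (hS (x - y) ⟨sub_pos.2 hy.2, by linarith [hy.1, hx.2]⟩)
  have h3 := abs_le.1 (hS y ⟨hy.1, hy.2.le.trans hx.2⟩)
  rw [abs_le]; constructor <;> linarith [h1.1, h1.2, h2.1, h2.2, h3.1, h3.2]

theorem abs_opB_le (H : Subordinate K F g k f ρ M) {φ : ℝ → ℝ} {x B : ℝ}
    (hx : x ∈ Ioc (0 : ℝ) 1) (hB : ∀ y ∈ Ioo 0 x, |φ x - φ (x - y) - φ y| ≤ B) :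
    |opB F φ x| ≤ (1 / 2) * (f * B) := by
  rw [opB_eq F φ hx.1, abs_mul, abs_of_pos (by norm_num : (0 : ℝ) < 1 / 2)]
  gcongr
  have hB0 : 0 ≤ B := (abs_nonneg _).trans (hB (x / 2) ⟨by linarith [hx.1], by linarith [hx.1]⟩)
  have : ‖∫ y in Ioo 0 x, F (x - y) y * (φ x - φ (x - y) - φ y)‖
      ≤ (f * B) * volume.real (Ioo 0 x) := by
    refine norm_setIntegral_le_of_norm_le_const (by simp) fun y hy => ?_
    have h1 := H.F_antidiagonal_mem hx hy
    rw [Real.norm_eq_abs, abs_mul, abs_of_nonneg h1.1]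
    exact mul_le_mul h1.2 (hB y hy) (abs_nonneg _) H.f_nonneg
  refine this.trans (mul_le_of_le_one_right (mul_nonneg H.f_nonneg hB0) ?_)
  simp [Measure.real, hx.1.le, hx.2]

theorem abs_opB_le_of_bound (H : Subordinate K F g k f ρ M) {φ : ℝ → ℝ} {S : ℝ}
    (hS : ∀ x ∈ Ioc (0 : ℝ) 1, |φ x| ≤ S) {x : ℝ} (hx : x ∈ Ioc (0 : ℝ) 1) :
    |opB F φ x| ≤ (1 / 2) * (f * (3 * S)) := by
  refine H.abs_opB_le hx fun y hy => ?_
  have h1 := abs_le.1 (hS x hx)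
  have h2 := abs_le.1 (hS (x - y) ⟨sub_pos.2 hy.2, by linarith [hy.1, hx.2]⟩)
  have h3 := abs_le.1 (hS y ⟨hy.1, hy.2.le.trans hx.2⟩)
  rw [abs_le]; constructor <;> linarith [h1.1, h1.2, h2.1, h2.2, h3.1, h3.2]

theorem continuous_opB (H : Subordinate K F g k f ρ M) {φ : ℝ → ℝ} (hφ : Continuous φ) {S : ℝ}
    (hS : ∀ x ∈ Ioc (0 : ℝ) 1, |φ x| ≤ S) : Continuous fun x : Size => opB F φ x := by
  -- The substitution `y = x z` makes the domain of integration independent of `x`, so that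
  -- dominated convergence applies.
  have heq : (fun x : Size => opB F φ x) = fun x : Size => (1 / 2) * ((x : ℝ) *
      ∫ z in Ioo (0 : ℝ) 1, F (x - x * z) (x * z) * (φ x - φ (x - x * z) - φ (x * z))) := by
    funext x
    have hx := x.2.1
    have := intervalIntegral.integral_comp_mul_left (a := 0) (b := 1)
      (fun y => F (x - y) y * (φ x - φ (x - y) - φ y)) hx.ne'
    rw [← integral_Ioc_eq_integral_Ioo, ← intervalIntegral.integral_of_le zero_le_one, this, opB]
    simp only [mul_zero, mul_one, smul_eq_mul]
    field_simp
  rw [heq]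
  refine continuous_const.mul (continuous_subtype_val.mul
    (continuous_iff_continuousAt.2 fun x₀ => ?_))
  have hmem : ∀ x : Size, ∀ z ∈ Ioo (0 : ℝ) 1, (x : ℝ) * z ∈ Ioo 0 (x : ℝ) := fun x z hz =>
    ⟨mul_pos x.2.1 hz.1, by nlinarith [x.2.1, hz.2]⟩
  refine continuousAt_of_dominated (bound := fun _ => f * (3 * S))
    (Eventually.of_forall fun x => ?_) (Eventually.of_forall fun x => ?_) (integrable_const _) ?_
  · refine ContinuousOn.aestronglyMeasurable ?_ measurableSet_Ioo
    refine ContinuousOn.mul ?_ (by fun_prop)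
    exact (H.continuousOn_F_antidiagonal x).comp (f := fun z => (x : ℝ) * z) (by fun_prop)
      (hmem x)
  · filter_upwards [ae_restrict_mem measurableSet_Ioo] with z hz
    have h0 := hmem x z hz
    have h1 := H.F_antidiagonal_mem x.2 h0
    rw [Real.norm_eq_abs, abs_mul, abs_of_nonneg h1.1]
    refine mul_le_mul h1.2 ?_ (abs_nonneg _) H.f_nonneg
    have e1 := abs_le.1 (hS x x.2)
    have e2 := abs_le.1 (hS (x - x * z) ⟨sub_pos.2 h0.2, by linarith [h0.1, x.2.2]⟩)
    have e3 := abs_le.1 (hS (x * z) ⟨h0.1, h0.2.le.trans x.2.2⟩)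
    rw [abs_le]; constructor <;> linarith [e1.1, e1.2, e2.1, e2.2, e3.1, e3.2]
  · filter_upwards [ae_restrict_mem measurableSet_Ioo] with z hz
    have h0 := hmem x₀ z hz
    have hopen : IsOpen (Ioi (0 : ℝ) ×ˢ Ioi (0 : ℝ)) := isOpen_Ioi.prod isOpen_Ioi
    have hc : ContinuousAt (fun p : ℝ × ℝ => F p.1 p.2) (x₀ - x₀ * z, (x₀ : ℝ) * z) :=
      H.kernelF.continuousOn.continuousAt (hopen.mem_nhds ⟨sub_pos.2 h0.2, h0.1⟩)
    refine ContinuousAt.mul (hc.comp (f := fun x : Size => ((x : ℝ) - x * z, (x : ℝ) * z))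
      (by fun_prop)) ?_
    fun_prop

theorem continuous_integral_mul_of_bounded (hg : IsBoundaryDatum g) {w : ℝ → ℝ}
    (hw : AEStronglyMeasurable w ((volume : Measure ℝ).restrict (Ioi 1))) {B : ℝ}
    (hB : ∀ y, |w y| ≤ B) : Continuous fun t : ℝ≥0 => ∫ y in Ioi (1 : ℝ), w y * g t y := by
  have hB0 : 0 ≤ B := (abs_nonneg _).trans (hB 0)
  have hint : ∀ h : L1Large, IntegrableOn (fun y => w y * h y) (Ioi 1) := fun h =>
    (L1.integrable_coeFn h).bdd_mul hw (Eventually.of_forall hB)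
  have : LipschitzWith ⟨B, hB0⟩ fun h : L1Large => ∫ y in Ioi (1 : ℝ), w y * h y := by
    refine LipschitzWith.of_dist_le_mul fun h h' => ?_
    rw [Real.dist_eq, dist_eq_norm, L1.norm_eq_integral_norm, ← integral_sub (hint h) (hint h')]
    calc |∫ y in Ioi (1 : ℝ), (w y * h y - w y * h' y)|
        ≤ ∫ y in Ioi (1 : ℝ), B * ‖(h - h') y‖ := by
          rw [← Real.norm_eq_abs]
          refine norm_integral_le_of_norm_le ((L1.integrable_coeFn (h - h')).norm.const_mul B) ?_
          filter_upwards [Lp.coeFn_sub h h'] with y hy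
          rw [hy, ← mul_sub, norm_mul]
          exact mul_le_mul_of_nonneg_right (hB y) (norm_nonneg _)
      _ = B * ∫ y in Ioi (1 : ℝ), ‖(h - h') y‖ := integral_const_mul _ _
  exact this.continuous.comp hg.continuous

/-- `g` is continuous into the unweighted `L¹`, which handles bounded weights only. Truncating `w`
at `±n` exhibits the function as a pointwise limit of continuous functions of time, and
measurability is all that is needed. -/
theorem measurable_integral_mul (H : Subordinate K F g k f ρ M) {w : ℝ → ℝ} {c : ℝ}
    (hw : ContinuousOn w (Ioi 1)) (hc : ∀ y ∈ Ioi (1 : ℝ), |w y| ≤ c * y ^ ρ) :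
    Measurable fun t : ℝ≥0 => ∫ y in Ioi (1 : ℝ), w y * g t y := by
  have htr : ∀ n : ℕ, ContinuousOn (fun y => max (-(n : ℝ)) (min n (w y))) (Ioi 1) := fun n =>
    continuousOn_const.sup (continuousOn_const.inf hw)
  have hn : ∀ n : ℕ, (0 : ℝ) ≤ n := fun n => n.cast_nonneg
  have habs : ∀ (n : ℕ) y, |max (-(n : ℝ)) (min n (w y))| ≤ |w y| := by
    intro n y
    have := hn n
    rw [abs_le]
    grind
  refine measurable_of_tendsto_metrizable
    (f := fun (n : ℕ) (t : ℝ≥0) => ∫ y in Ioi (1 : ℝ), max (-(n : ℝ)) (min n (w y)) * g t y)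
    (fun n => (continuous_integral_mul_of_bounded (B := n) H.datum
      ((htr n).aestronglyMeasurable measurableSet_Ioi) fun y => ?_).measurable)
    (tendsto_pi_nhds.2 fun t => ?_)
  · rw [abs_le]
    exact ⟨le_max_left _ _, max_le (by linarith [hn n]) (min_le_left _ _)⟩
  · refine tendsto_integral_of_dominated_convergence (fun y => |w y * g t y|)
      (fun n => (H.integrableOn_mul t (htr n)
        fun y hy => (habs n y).trans (hc y hy)).aestronglyMeasurable)
      (H.integrableOn_mul t hw hc).abs (fun n => Eventually.of_forall fun y => ?_)
      (Eventually.of_forall fun y => ?_)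
    · rw [Real.norm_eq_abs, abs_mul, abs_mul]
      exact mul_le_mul_of_nonneg_right (habs n y) (abs_nonneg _)
    · refine Tendsto.mul_const _ (tendsto_const_nhds.congr' ?_)
      filter_upwards [eventually_ge_atTop ⌈|w y|⌉₊] with n hn
      have h1 : |w y| ≤ n := (Nat.le_ceil _).trans (by exact_mod_cast hn)
      rw [abs_le] at h1
      rw [min_eq_right h1.2, max_eq_right h1.1]

/-- A Carathéodory function, continuous in the size and measurable in time, is jointly measurable.
-/
theorem measurable_lossG (H : Subordinate K F g k f ρ M) :
    Measurable fun p : Size × ℝ≥0 => lossG K g p.2 p.1 :=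
  measurable_uncurry_of_continuous_of_measurable (u := fun (x : Size) t => lossG K g t x)
    (fun t => H.continuous_lossG t) fun x =>
      H.measurable_integral_mul (H.continuousOn_K_right x.2) fun _ hy => H.abs_K_large_le x.2 hy

theorem measurable_gainC (H : Subordinate K F g k f ρ M) :
    Measurable fun p : Size × ℝ≥0 => gainC F g p.2 p.1 :=
  measurable_uncurry_of_continuous_of_measurable (u := fun (x : Size) t => gainC F g t x)
    (fun t => H.continuous_gainC t) fun x =>
      H.measurable_integral_mul (H.continuousOn_F_sub x.2) fun _ hy => H.abs_F_large_le x.2 hy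

end Subordinate
end CoagFrag

/-! ### The rate: dependence on the test function, convergence, time integrability, linearity. -/

namespace CoagFrag

theorem opA_congr {φ ψ : ℝ → ℝ} (h : EqOn φ ψ (Ioc 0 1)) {x y : ℝ} (hx : x ∈ Ioc (0 : ℝ) 1)
    (hy : y ∈ Ioc (0 : ℝ) 1) : opA φ x y = opA ψ x y := by
  rw [opA, opA, h hx, h hy, h (min_mem_Ioc hx hy)]

theorem opB_integrand_congr (F : ℝ → ℝ → ℝ) {φ ψ : ℝ → ℝ} (h : EqOn φ ψ (Ioc 0 1)) {x : ℝ}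
    (hx : x ∈ Ioc (0 : ℝ) 1) :
    EqOn (fun y => F (x - y) y * (φ x - φ (x - y) - φ y))
      (fun y => F (x - y) y * (ψ x - ψ (x - y) - ψ y)) (Ioo 0 x) := by
  intro y hy
  simp only
  rw [h hx, h ⟨hy.1, hy.2.le.trans hx.2⟩, h ⟨sub_pos.2 hy.2, by linarith [hy.1, hx.2]⟩]

theorem opB_congr (F : ℝ → ℝ → ℝ) {φ ψ : ℝ → ℝ} (h : EqOn φ ψ (Ioc 0 1)) {x : ℝ}
    (hx : x ∈ Ioc (0 : ℝ) 1) : opB F φ x = opB F ψ x := by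
  rw [Subordinate.opB_eq F φ hx.1, Subordinate.opB_eq F ψ hx.1,
    setIntegral_congr_fun measurableSet_Ioo (opB_integrand_congr F h hx)]

theorem rate_congr (K F : ℝ → ℝ → ℝ) (g : ℝ≥0 → L1Large) (t : ℝ≥0) (ν : FiniteMeasure Size)
    {φ ψ : ℝ → ℝ} (h : EqOn φ ψ (Ioc 0 1)) : rate K F g t ν φ = rate K F g t ν ψ := by
  unfold rate
  congr 1
  · congr 1
    · congr 1
      refine integral_congr_ae (Eventually.of_forall fun p => ?_)
      simp only [opA_congr h p.1.2 p.2.2]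
    · refine integral_congr_ae (Eventually.of_forall fun x => ?_)
      simp only [h x.2, opB_congr F h x.2]
  · refine setIntegral_congr_fun measurableSet_Ioc fun x hx => ?_
    simp only [h hx]

theorem RateConverges.congr {K F : ℝ → ℝ → ℝ} {g : ℝ≥0 → L1Large} {t : ℝ≥0}
    {ν : FiniteMeasure Size} {φ ψ : ℝ → ℝ} (h : EqOn φ ψ (Ioc 0 1))
    (hφ : RateConverges K F g t ν φ) : RateConverges K F g t ν ψ where
  lossG := hφ.lossG
  gainC := hφ.gainC
  opB x hx := by
    have := hφ.opB x hx
    rw [intervalIntegrable_iff_integrableOn_Ioo_of_le hx.1.le] at this ⊢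
    exact this.congr_fun (opB_integrand_congr F h hx) measurableSet_Ioo
  coagulation := hφ.coagulation.congr (Eventually.of_forall fun p => by
    simp only [opA_congr h p.1.2 p.2.2])
  loss := hφ.loss.congr (Eventually.of_forall fun x => by
    simp only [h x.2, opB_congr F h x.2])
  gain := hφ.gain.congr_fun (fun x hx => by simp only [h hx]) measurableSet_Ioc

/-- A sufficient condition for the convergence of all the integrals in `rate K F g t ν φ`, at all
times `t`. -/
structure Testable (K F : ℝ → ℝ → ℝ) (ν : FiniteMeasure Size) (φ : ℝ → ℝ) : Prop where
  meas : Measurable φ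
  bdd : ∃ S, ∀ x ∈ Ioc (0 : ℝ) 1, |φ x| ≤ S
  coagulation : Integrable (fun p : Size × Size => K p.1 p.2 * opA φ p.1 p.2)
    ((ν : Measure Size).prod (ν : Measure Size))
  loss : Integrable (fun x : Size => φ x / x) (ν : Measure Size)
  fragmentation : Integrable (fun x : Size => opB F φ x) (ν : Measure Size)

namespace Subordinate

variable {K F : ℝ → ℝ → ℝ} {g : ℝ≥0 → L1Large} {k f ρ M : ℝ} {ν : FiniteMeasure Size}
  {φ ψ : ℝ → ℝ}

theorem intervalIntegrable_opB (H : Subordinate K F g k f ρ M) (hφ : Measurable φ) {S : ℝ}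
    (hS : ∀ x ∈ Ioc (0 : ℝ) 1, |φ x| ≤ S) {x : ℝ} (hx : x ∈ Ioc (0 : ℝ) 1) :
    IntervalIntegrable (fun y => F (x - y) y * (φ x - φ (x - y) - φ y)) volume 0 x := by
  rw [intervalIntegrable_iff_integrableOn_Ioo_of_le hx.1.le]
  refine H.integrableOn_F_mul hx (B := S + S + S) (by fun_prop) fun y hy => ?_
  have h1 := abs_le.1 (hS x hx)
  have h2 := abs_le.1 (hS (x - y) ⟨sub_pos.2 hy.2, by linarith [hy.1, hx.2]⟩)
  have h3 := abs_le.1 (hS y ⟨hy.1, hy.2.le.trans hx.2⟩)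
  rw [abs_le]; constructor <;> linarith [h1.1, h1.2, h2.1, h2.2, h3.1, h3.2]

/-- The reason for the condition on `φ x / x` in `Testable`: it does not involve time, yet it
controls the loss term at all times. -/
theorem abs_lossG_mul_le (H : Subordinate K F g k f ρ M) (t : ℝ≥0) (φ : ℝ → ℝ) (x : Size) :
    |lossG K g t x * φ x| ≤ k * M * |φ x / x| := by
  have hx := x.2.1
  rw [abs_mul, abs_of_nonneg (H.lossG_nonneg t x.2), abs_div, abs_of_pos hx]
  calc lossG K g t x * |φ x| ≤ k / x * M * |φ x| := by gcongr; exact H.lossG_le t x.2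
    _ = k * M * (|φ x| / x) := by ring

theorem integrable_lossG_mul (H : Subordinate K F g k f ρ M) (hφ : Testable K F ν φ) (t : ℝ≥0) :
    Integrable (fun x : Size => lossG K g t x * φ x) (ν : Measure Size) :=
  Integrable.mono' (hφ.loss.abs.const_mul (k * M))
    ((H.continuous_lossG t).aestronglyMeasurable.mul
      (hφ.meas.comp measurable_subtype_coe).aestronglyMeasurable)
    (Eventually.of_forall fun x => H.abs_lossG_mul_le t φ x)

theorem integrableOn_gainC_mul (H : Subordinate K F g k f ρ M) (hφ : Measurable φ) {S : ℝ}
    (hS : ∀ x ∈ Ioc (0 : ℝ) 1, |φ x| ≤ S) (t : ℝ≥0) :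
    IntegrableOn (fun x => gainC F g t x * φ x) (Ioc 0 1) := by
  refine Integrable.mono' (g := fun _ => f * M * S) (integrable_const _)
    (((continuousOn_iff_continuous_domRestrict.2 (H.continuous_gainC t)).aestronglyMeasurable
      measurableSet_Ioc).mul hφ.aestronglyMeasurable) ?_
  filter_upwards [ae_restrict_mem measurableSet_Ioc] with x hx
  rw [Real.norm_eq_abs, abs_mul, abs_of_nonneg (H.gainC_nonneg t hx)]
  exact mul_le_mul (H.gainC_le t hx) (hS x hx) (abs_nonneg _) (mul_nonneg H.f_nonneg H.M_nonneg)

theorem abs_integral_gainC_mul_le (H : Subordinate K F g k f ρ M) {S : ℝ}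
    (hS : ∀ x ∈ Ioc (0 : ℝ) 1, |φ x| ≤ S) (t : ℝ≥0) :
    |∫ x in Ioc (0 : ℝ) 1, gainC F g t x * φ x| ≤ f * M * S := by
  have := norm_setIntegral_le_of_norm_le_const (μ := volume) (s := Ioc (0 : ℝ) 1)
    (f := fun x => gainC F g t x * φ x) (C := f * M * S) (by simp) fun x hx => by
      rw [Real.norm_eq_abs, abs_mul, abs_of_nonneg (H.gainC_nonneg t hx)]
      exact mul_le_mul (H.gainC_le t hx) (hS x hx) (abs_nonneg _)
        (mul_nonneg H.f_nonneg H.M_nonneg)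
  simpa [Measure.real] using this

theorem rateConverges (H : Subordinate K F g k f ρ M) (hφ : Testable K F ν φ) (t : ℝ≥0) :
    RateConverges K F g t ν φ := by
  obtain ⟨S, hS⟩ := hφ.bdd
  exact ⟨fun x hx => H.integrableOn_lossG t hx, fun x hx => H.integrableOn_gainC t hx,
    fun x hx => H.intervalIntegrable_opB hφ.meas hS hx, hφ.coagulation,
    (H.integrable_lossG_mul hφ t).add hφ.fragmentation, H.integrableOn_gainC_mul hφ.meas hS t⟩

theorem rate_eq (H : Subordinate K F g k f ρ M) (hφ : Testable K F ν φ) (t : ℝ≥0) :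
    rate K F g t ν φ = (1 / 2) * (∫ p : Size × Size, K p.1 p.2 * opA φ p.1 p.2
      ∂((ν : Measure Size).prod (ν : Measure Size)))
    - (∫ x : Size, lossG K g t x * φ x ∂(ν : Measure Size))
    - (∫ x : Size, opB F φ x ∂(ν : Measure Size))
    + ∫ x in Ioc (0 : ℝ) 1, gainC F g t x * φ x := by
  rw [rate, integral_add (H.integrable_lossG_mul hφ t) hφ.fragmentation]
  ring

theorem exists_abs_rate_le (H : Subordinate K F g k f ρ M) (hφ : Testable K F ν φ) :
    ∃ C, ∀ t, |rate K F g t ν φ| ≤ C := by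
  obtain ⟨S, hS⟩ := hφ.bdd
  refine ⟨|(1 / 2) * (∫ p : Size × Size, K p.1 p.2 * opA φ p.1 p.2
      ∂((ν : Measure Size).prod (ν : Measure Size)))| +
      (∫ x : Size, k * M * |φ x / x| ∂(ν : Measure Size)) +
      |∫ x : Size, opB F φ x ∂(ν : Measure Size)| + f * M * S, fun t => ?_⟩
  rw [H.rate_eq hφ]
  have h1 := H.abs_integral_gainC_mul_le hS t
  have h2 : |∫ x : Size, lossG K g t x * φ x ∂(ν : Measure Size)| ≤
      ∫ x : Size, k * M * |φ x / x| ∂(ν : Measure Size) := by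
    rw [← Real.norm_eq_abs]
    exact norm_integral_le_of_norm_le (hφ.loss.abs.const_mul (k * M))
      (Eventually.of_forall fun x => H.abs_lossG_mul_le t φ x)
  refine (abs_add_le _ _).trans (add_le_add ((abs_sub _ _).trans (add_le_add ((abs_sub _ _).trans
    (add_le_add le_rfl h2)) le_rfl)) h1)

theorem measurable_rate (H : Subordinate K F g k f ρ M) (hφ : Testable K F ν φ) :
    Measurable fun t => rate K F g t ν φ := by
  have hφ' : Measurable fun x : Size => φ x := hφ.meas.comp measurable_subtype_coe
  have h1 : Measurable fun t => ∫ x : Size, lossG K g t x * φ x ∂(ν : Measure Size) :=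
    (StronglyMeasurable.integral_prod_right (f := fun (t : ℝ≥0) (x : Size) => lossG K g t x * φ x)
      ((H.measurable_lossG.comp measurable_swap).mul
        (hφ'.comp measurable_snd)).stronglyMeasurable).measurable
  -- Joint measurability of `gainC` is known on `Size × ℝ≥0`, so the integral over `(0, 1]` is moved
  -- to the subtype.
  have : IsFiniteMeasure (Measure.comap (Subtype.val : Size → ℝ) volume) := ⟨by
    rw [(MeasurableEmbedding.subtype_coe measurableSet_Ioc).comap_apply, image_univ,
      Subtype.range_coe]
    exact measure_Ioc_lt_top⟩
  have h2 : Measurable fun t => ∫ x : Size, gainC F g t x * φ x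
      ∂(Measure.comap Subtype.val (volume : Measure ℝ)) :=
    (StronglyMeasurable.integral_prod_right (f := fun (t : ℝ≥0) (x : Size) => gainC F g t x * φ x)
      ((H.measurable_gainC.comp measurable_swap).mul
        (hφ'.comp measurable_snd)).stronglyMeasurable).measurable
  have h3 : (fun t => ∫ x in Ioc (0 : ℝ) 1, gainC F g t x * φ x) =
      fun t => ∫ x : Size, gainC F g t x * φ x
        ∂(Measure.comap Subtype.val (volume : Measure ℝ)) := by
    funext t
    exact (integral_subtype_comap measurableSet_Ioc fun x => gainC F g t x * φ x).symm
  have h4 : (fun t => rate K F g t ν φ) = _ := funext fun t => H.rate_eq hφ t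
  rw [h4]
  rw [← h3] at h2
  fun_prop

theorem intervalIntegrable_rate (H : Subordinate K F g k f ρ M) (hφ : Testable K F ν φ)
    (a b : ℝ) : IntervalIntegrable (fun s : ℝ => rate K F g s.toNNReal ν φ) volume a b := by
  obtain ⟨C, hC⟩ := H.exists_abs_rate_le hφ
  exact (intervalIntegrable_const (c := C)).mono_fun
    ((H.measurable_rate hφ).comp measurable_real_toNNReal).aestronglyMeasurable
    (Eventually.of_forall fun s => (hC _).trans (le_abs_self C))

end Subordinate

namespace Testable

variable {K F : ℝ → ℝ → ℝ} {g : ℝ≥0 → L1Large} {k f ρ M : ℝ} {ν : FiniteMeasure Size}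
  {φ ψ : ℝ → ℝ}

theorem opA_add (φ ψ : ℝ → ℝ) (x y : ℝ) :
    opA (fun z => φ z + ψ z) x y = opA φ x y + opA ψ x y := by
  simp only [opA]; ring

theorem opA_const_mul (c : ℝ) (φ : ℝ → ℝ) (x y : ℝ) :
    opA (fun z => c * φ z) x y = c * opA φ x y := by
  simp only [opA]; ring

theorem opB_add (H : Subordinate K F g k f ρ M) (hφ : Testable K F ν φ) (hψ : Testable K F ν ψ)
    {x : ℝ} (hx : x ∈ Ioc (0 : ℝ) 1) :
    opB F (fun z => φ z + ψ z) x = opB F φ x + opB F ψ x := by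
  obtain ⟨S, hS⟩ := hφ.bdd
  obtain ⟨S', hS'⟩ := hψ.bdd
  simp only [opB]
  rw [← mul_add, ← intervalIntegral.integral_add (H.intervalIntegrable_opB hφ.meas hS hx)
    (H.intervalIntegrable_opB hψ.meas hS' hx)]
  congr 2
  funext y
  ring

theorem opB_const_mul (F : ℝ → ℝ → ℝ) (c : ℝ) (φ : ℝ → ℝ) (x : ℝ) :
    opB F (fun z => c * φ z) x = c * opB F φ x := by
  simp only [opB]
  rw [mul_left_comm]
  congr 1
  rw [← intervalIntegral.integral_const_mul]
  congr 1
  funext y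
  ring

protected theorem add (H : Subordinate K F g k f ρ M) (hφ : Testable K F ν φ)
    (hψ : Testable K F ν ψ) : Testable K F ν fun z => φ z + ψ z := by
  obtain ⟨S, hS⟩ := hφ.bdd
  obtain ⟨S', hS'⟩ := hψ.bdd
  refine ⟨hφ.meas.add hψ.meas,
    ⟨S + S', fun x hx => (abs_add_le _ _).trans (add_le_add (hS x hx) (hS' x hx))⟩, ?_, ?_, ?_⟩
  · simp only [opA_add, mul_add]
    exact hφ.coagulation.add hψ.coagulation
  · simp only [add_div]
    exact hφ.loss.add hψ.loss
  · exact (hφ.fragmentation.add hψ.fragmentation).congr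
      (Eventually.of_forall fun x => (opB_add H hφ hψ x.2).symm)

protected theorem const_mul (c : ℝ) (hφ : Testable K F ν φ) :
    Testable K F ν fun z => c * φ z := by
  obtain ⟨S, hS⟩ := hφ.bdd
  refine ⟨hφ.meas.const_mul c, ⟨|c| * S, fun x hx => ?_⟩, ?_, ?_, ?_⟩
  · rw [abs_mul]; exact mul_le_mul_of_nonneg_left (hS x hx) (abs_nonneg _)
  · simpa only [opA_const_mul, mul_left_comm] using hφ.coagulation.const_mul c
  · simpa only [mul_div_assoc] using hφ.loss.const_mul c
  · simpa only [opB_const_mul] using hφ.fragmentation.const_mul c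

protected theorem zero (K F : ℝ → ℝ → ℝ) (ν : FiniteMeasure Size) :
    Testable K F ν fun _ => 0 := by
  refine ⟨measurable_const, ⟨0, by simp⟩, ?_, ?_, ?_⟩ <;> simp [opA, opB]

theorem rate_add (H : Subordinate K F g k f ρ M) (hφ : Testable K F ν φ)
    (hψ : Testable K F ν ψ) (t : ℝ≥0) :
    rate K F g t ν (fun z => φ z + ψ z) = rate K F g t ν φ + rate K F g t ν ψ := by
  obtain ⟨S, hS⟩ := hφ.bdd
  obtain ⟨S', hS'⟩ := hψ.bdd
  rw [H.rate_eq hφ, H.rate_eq hψ, H.rate_eq (Testable.add H hφ hψ)]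
  simp only [opA_add, mul_add]
  rw [integral_add hφ.coagulation hψ.coagulation,
    integral_add (H.integrable_lossG_mul hφ t) (H.integrable_lossG_mul hψ t),
    integral_add (H.integrableOn_gainC_mul hφ.meas hS t) (H.integrableOn_gainC_mul hψ.meas hS' t),
    integral_congr_ae (Eventually.of_forall fun x : Size => opB_add H hφ hψ x.2),
    integral_add hφ.fragmentation hψ.fragmentation]
  ring

theorem rate_const_mul (K F : ℝ → ℝ → ℝ) (g : ℝ≥0 → L1Large) (t : ℝ≥0) (ν : FiniteMeasure Size)
    (c : ℝ) (φ : ℝ → ℝ) :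
    rate K F g t ν (fun z => c * φ z) = c * rate K F g t ν φ := by
  simp only [rate, opA_const_mul, opB_const_mul, mul_left_comm _ c, ← mul_add, integral_const_mul]
  ring

/-- Together with `comp_roundUp_eq_sum` this computes the rate of a rounded test function from the
rates of the cell indicators. -/
theorem sum (H : Subordinate K F g k f ρ M) {ι : Type*} (s : Finset ι) (c : ι → ℝ)
    {e : ι → ℝ → ℝ} (he : ∀ i, Testable K F ν (e i)) :
    Testable K F ν (fun z => ∑ i ∈ s, c i * e i z) ∧
      ∀ t, rate K F g t ν (fun z => ∑ i ∈ s, c i * e i z) = ∑ i ∈ s, c i * rate K F g t ν (e i) := by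
  classical
  induction s using Finset.induction_on with
  | empty =>
    refine ⟨by simpa using Testable.zero K F ν, fun t => ?_⟩
    simpa using rate_const_mul K F g t ν 0 fun _ => 0
  | insert i s hi ih =>
    simp only [Finset.sum_insert hi]
    refine ⟨Testable.add H ((he i).const_mul _) ih.1, fun t => ?_⟩
    rw [rate_add H ((he i).const_mul _) ih.1, ih.2, rate_const_mul]

end Testable
end CoagFrag

/-! ### A priori estimates of the rate. -/

namespace CoagFrag

namespace Subordinate

variable {K F : ℝ → ℝ → ℝ} {g : ℝ≥0 → L1Large} {k f ρ M : ℝ} {ν : FiniteMeasure Size}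
  {φ : ℝ → ℝ} {L : ℝ}

theorem continuous_coagulation (H : Subordinate K F g k f ρ M) (hφ : Continuous φ) :
    Continuous fun p : Size × Size => K p.1 p.2 * opA φ p.1 p.2 := by
  refine H.continuous_K.mul ?_
  unfold opA
  fun_prop

theorem continuous_loss (H : Subordinate K F g k f ρ M) (hφ : Continuous φ) (t : ℝ≥0) :
    Continuous fun x : Size => lossG K g t x * φ x :=
  (H.continuous_lossG t).mul (by fun_prop)

theorem abs_div_le (hφ : LipAtZero L φ) (x : Size) : |φ x / x| ≤ L := by
  rw [abs_div, abs_of_pos x.2.1, div_le_iff₀ x.2.1]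
  exact hφ.abs_apply_le x.2.1.le

theorem abs_lossG_mul_le_of_lip (H : Subordinate K F g k f ρ M) (hφ : LipAtZero L φ) (t : ℝ≥0)
    (x : Size) : |lossG K g t x * φ x| ≤ k * M * L :=
  (H.abs_lossG_mul_le t φ x).trans
    (mul_le_mul_of_nonneg_left (abs_div_le hφ x) (mul_nonneg H.k_nonneg H.M_nonneg))

theorem testable_of_lip (H : Subordinate K F g k f ρ M) (ν : FiniteMeasure Size)
    (hφ : LipAtZero L φ) : Testable K F ν φ where
  meas := hφ.continuous.measurable
  bdd := ⟨L, fun _ => hφ.abs_le_one⟩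
  coagulation := Integrable.mono' (integrable_const (2 * k * L))
    (H.continuous_coagulation hφ.continuous).aestronglyMeasurable
    (Eventually.of_forall fun p => H.abs_K_mul_opA_le hφ p.1.2 p.2.2)
  loss := Integrable.mono' (integrable_const L)
    (Continuous.aestronglyMeasurable (by
      have := hφ.continuous
      exact (by fun_prop : Continuous fun x : Size => φ x).div continuous_subtype_val
        fun x => x.2.1.ne'))
    (Eventually.of_forall fun x => abs_div_le hφ x)
  fragmentation := Integrable.mono' (integrable_const ((1 / 2) * (f * (3 * L))))
    (H.continuous_opB hφ.continuous fun _ => hφ.abs_le_one).aestronglyMeasurable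
    (Eventually.of_forall fun x => H.abs_opB_le_of_bound (fun _ => hφ.abs_le_one) x.2)

/-- The fragmentation and gain parts of the rate are controlled by the supremum of `φ`. -/
theorem abs_fragmentation_le (H : Subordinate K F g k f ρ M) (ν : FiniteMeasure Size) {S D : ℝ}
    (hS : ∀ x ∈ Ioc (0 : ℝ) 1, |φ x| ≤ S) (hD : (ν : Measure Size).real univ + M ≤ D) (t : ℝ≥0) :
    |-(∫ x : Size, opB F φ x ∂(ν : Measure Size)) + ∫ x in Ioc (0 : ℝ) 1, gainC F g t x * φ x|
      ≤ 2 * f * D * S := by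
  have hS0 : 0 ≤ S := (abs_nonneg _).trans (hS 1 (by simp))
  have h1 : |∫ x : Size, opB F φ x ∂(ν : Measure Size)| ≤
      (1 / 2) * (f * (3 * S)) * (ν : Measure Size).real univ := by
    rw [← Real.norm_eq_abs]
    exact norm_integral_le_of_norm_le_const
      (Eventually.of_forall fun x => H.abs_opB_le_of_bound hS x.2)
  have h2 := H.abs_integral_gainC_mul_le hS t
  have h3 : 0 ≤ f * S := mul_nonneg H.f_nonneg hS0
  -- With `m` the mass of `ν`, the two bounds add up to `f S (3 m / 2 + M)`, at most `2 f S (m +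
  -- M)`.
  have h4 : f * S * ((ν : Measure Size).real univ + M) ≤ f * S * D :=
    mul_le_mul_of_nonneg_left hD h3
  have h5 : 0 ≤ f * S * (ν : Measure Size).real univ := mul_nonneg h3 measureReal_nonneg
  have h6 : 0 ≤ f * S * M := mul_nonneg h3 H.M_nonneg
  rw [abs_le] at *
  constructor <;> nlinarith [h1.1, h1.2, h2.1, h2.2]

/-- With `m` the mass of `ν`, coagulation contributes `k L m²` and loss `k L m M`, together at most
`k L D²`; the rest is `abs_fragmentation_le` with `S = L`. -/
theorem abs_rate_le_of_lip (H : Subordinate K F g k f ρ M) (hφ : LipAtZero L φ) {D : ℝ}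
    (hD : (ν : Measure Size).real univ + M ≤ D) (t : ℝ≥0) :
    |rate K F g t ν φ| ≤ (k * D ^ 2 + 2 * f * D) * L := by
  have hL := hφ.nonneg
  have hm : 0 ≤ (ν : Measure Size).real univ := measureReal_nonneg
  set m := (ν : Measure Size).real univ with hm_def
  have h1 : |∫ p : Size × Size, K p.1 p.2 * opA φ p.1 p.2
      ∂((ν : Measure Size).prod (ν : Measure Size))| ≤ (2 * k * L) * (m * m) := by
    have := norm_integral_le_of_norm_le_const (μ := (ν : Measure Size).prod (ν : Measure Size))
      (f := fun p : Size × Size => K p.1 p.2 * opA φ p.1 p.2) (C := 2 * k * L)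
      (Eventually.of_forall fun p : Size × Size => H.abs_K_mul_opA_le hφ p.1.2 p.2.2)
    rwa [← univ_prod_univ, measureReal_prod_prod] at this
  have h2 : |∫ x : Size, lossG K g t x * φ x ∂(ν : Measure Size)| ≤ (k * M * L) * m := by
    rw [← Real.norm_eq_abs]
    exact norm_integral_le_of_norm_le_const
      (Eventually.of_forall fun x => H.abs_lossG_mul_le_of_lip hφ t x)
  have h3 := H.abs_fragmentation_le ν (fun _ => hφ.abs_le_one) hD t
  have h4 : m * (m + M) ≤ D * D := by
    have := H.M_nonneg
    exact mul_le_mul (by linarith) hD (by linarith) (by linarith)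
  have h5 : k * L * (m * (m + M)) ≤ k * L * (D * D) :=
    mul_le_mul_of_nonneg_left h4 (mul_nonneg H.k_nonneg hL)
  rw [H.rate_eq (H.testable_of_lip ν hφ)]
  rw [abs_le] at *
  constructor <;> nlinarith [h1.1, h1.2, h2.1, h2.2, h3.1, h3.2]

/-- Coagulation and loss can only decrease `∫ φ dν`, because `φ (min (x + y) 1) ≤ φ x` and `φ y ≥
0`. Fragmentation and gain create clusters with density at most `f (m + M)` in size, `m` being the
mass of `ν`, whence the factor `∫ φ`. Taking `φ = 1` bounds the mass; a rounded indicator of `(0,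
ε]` bounds the mass near `0`. -/
theorem rate_le_of_antitone (H : Subordinate K F g k f ρ M) (hT : Testable K F ν φ)
    (hφ : AntitoneOn φ (Ioc 0 1)) (h0 : ∀ x ∈ Ioc (0 : ℝ) 1, 0 ≤ φ x) (t : ℝ≥0) :
    rate K F g t ν φ ≤ f * ((ν : Measure Size).real univ + M) * ∫ x in Ioc (0 : ℝ) 1, φ x := by
  obtain ⟨S, hS⟩ := hT.bdd
  have hint : IntegrableOn φ (Ioc 0 1) :=
    Integrable.mono' (integrable_const S) hT.meas.aestronglyMeasurable
      ((ae_restrict_mem measurableSet_Ioc).mono hS)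
  set I := ∫ x in Ioc (0 : ℝ) 1, φ x
  have h1 : ∫ p : Size × Size, K p.1 p.2 * opA φ p.1 p.2
      ∂((ν : Measure Size).prod (ν : Measure Size)) ≤ 0 := by
    refine integral_nonpos fun p => ?_
    refine mul_nonpos_of_nonneg_of_nonpos (H.kernelK.nonneg _ _ p.1.2.1 p.2.2.1) ?_
    have ha := hφ p.1.2 (min_mem_Ioc p.1.2 p.2.2)
      (le_min (by linarith [p.2.2.1]) p.1.2.2)
    have hb := h0 p.2 p.2.2
    unfold opA
    linarith
  have h2 : 0 ≤ ∫ x : Size, lossG K g t x * φ x ∂(ν : Measure Size) :=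
    integral_nonneg fun x => mul_nonneg (H.lossG_nonneg t x.2) (h0 x x.2)
  have h3 : -(f * I) * (ν : Measure Size).real univ ≤ ∫ x : Size, opB F φ x ∂(ν : Measure Size) := by
    have hle : ∀ x : Size, -(f * I) ≤ opB F φ x := by
      intro x
      have hx := x.2
      have hsub : ∀ y ∈ Ioo 0 (x : ℝ), (x : ℝ) - y ∈ Ioc (0 : ℝ) 1 := fun y hy =>
        ⟨sub_pos.2 hy.2, by linarith [hy.1, hx.2]⟩
      have hI1 : IntegrableOn φ (Ioo 0 (x : ℝ)) :=
        hint.mono_set fun y hy => ⟨hy.1, hy.2.le.trans hx.2⟩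
      have hI2 : IntegrableOn (fun y => φ (x - y)) (Ioo 0 (x : ℝ)) :=
        Integrable.mono' (integrable_const S)
          (hT.meas.comp (measurable_const.sub measurable_id)).aestronglyMeasurable
          ((ae_restrict_mem measurableSet_Ioo).mono fun y hy => hS _ (hsub y hy))
      have e1 : ∫ y in Ioo 0 (x : ℝ), φ (x - y) = ∫ y in Ioo 0 (x : ℝ), φ y := by
        rw [← integral_Ioc_eq_integral_Ioo, ← integral_Ioc_eq_integral_Ioo,
          ← intervalIntegral.integral_of_le hx.1.le, ← intervalIntegral.integral_of_le hx.1.le,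
          intervalIntegral.integral_comp_sub_left]
        simp
      have e2 : ∫ y in Ioo 0 (x : ℝ), φ y ≤ I :=
        setIntegral_mono_set hint ((ae_restrict_mem measurableSet_Ioc).mono h0)
          (Eventually.of_forall fun y hy => ⟨hy.1, hy.2.le.trans hx.2⟩)
      -- `opB_le` is an upper bound, so it is applied to `-φ`. The term in `φ x` is dropped, and the
      -- reflection `y ↦ x - y` (`e1`) makes the two fragments contribute equally.
      have e3 := H.opB_le (φ := fun z => -1 * φ z) (hT.meas.const_mul (-1)) (S := S)
        (by simpa using hS) hx ((hI2.add hI1).const_mul f) fun y hy => by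
          have a1 := H.F_antidiagonal_mem hx hy
          have a2 := h0 _ hx
          have a3 := h0 _ (hsub y hy)
          have a4 := h0 y ⟨hy.1, hy.2.le.trans hx.2⟩
          simp only [Pi.add_apply]
          calc F (x - y) y * (-1 * φ x - -1 * φ (x - y) - -1 * φ y)
              ≤ F (x - y) y * (φ (x - y) + φ y) :=
                mul_le_mul_of_nonneg_left (by linarith) a1.1
            _ ≤ f * (φ (x - y) + φ y) := mul_le_mul_of_nonneg_right a1.2 (by linarith)
      rw [Testable.opB_const_mul, integral_const_mul, integral_add' hI2 hI1, e1] at e3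
      have := mul_le_mul_of_nonneg_left e2 H.f_nonneg
      linarith
    calc -(f * I) * (ν : Measure Size).real univ
        = ∫ _ : Size, -(f * I) ∂(ν : Measure Size) := by simp [mul_comm]
      _ ≤ _ := integral_mono (integrable_const _) hT.fragmentation hle
  have h4 : ∫ x in Ioc (0 : ℝ) 1, gainC F g t x * φ x ≤ f * M * I := by
    rw [← integral_const_mul]
    refine setIntegral_mono_on (H.integrableOn_gainC_mul hT.meas hS t) (hint.const_mul _)
      measurableSet_Ioc fun x hx => mul_le_mul_of_nonneg_right (H.gainC_le t hx) (h0 x hx)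
  rw [H.rate_eq hT]
  linarith

end Subordinate

/-! ### Rounding to a grid, and the rate of grid measures. -/

/-- The grid of mesh `1 / (N + 1)` in `(0, 1]`. -/
def gridSet (N : ℕ) : Set Size := {x | ∃ j : ℕ, (x : ℝ) = j / (N + 1)}

/-- Rounding up to the grid of mesh `1 / (N + 1)`. -/
noncomputable def roundUp (N : ℕ) (x : ℝ) : ℝ := ⌈x * (N + 1)⌉₊ / (N + 1)

theorem roundUp_natCast_div (N j : ℕ) : roundUp N (j / (N + 1)) = j / (N + 1) := by
  have : (N : ℝ) + 1 ≠ 0 := by positivity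
  rw [roundUp, div_mul_cancel₀ _ this, Nat.ceil_natCast]

theorem roundUp_of_mem_gridSet {N : ℕ} {x : Size} (hx : x ∈ gridSet N) :
    roundUp N x = x := by
  obtain ⟨j, hj⟩ := hx
  rw [hj, roundUp_natCast_div]

theorem le_roundUp (N : ℕ) (x : ℝ) : x ≤ roundUp N x := by
  have : (0 : ℝ) < N + 1 := by positivity
  rw [roundUp, le_div_iff₀ this]
  exact Nat.le_ceil _

theorem roundUp_le (N : ℕ) {x : ℝ} (hx : 0 ≤ x) : roundUp N x ≤ x + 1 / (N + 1) := by
  have : (0 : ℝ) < N + 1 := by positivity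
  rw [roundUp, div_le_iff₀ this, add_mul, one_div, inv_mul_cancel₀ this.ne']
  exact (Nat.ceil_lt_add_one (by positivity)).le

theorem monotone_roundUp (N : ℕ) : Monotone (roundUp N) := fun x y h => by
  unfold roundUp
  gcongr

theorem measurable_roundUp (N : ℕ) : Measurable (roundUp N) := (monotone_roundUp N).measurable

theorem roundUp_mem {N : ℕ} {x : ℝ} (hx : x ∈ Ioc (0 : ℝ) 1) : roundUp N x ∈ Ioc (0 : ℝ) 1 := by
  refine ⟨hx.1.trans_le (le_roundUp N x), (monotone_roundUp N hx.2).trans ?_⟩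
  have := roundUp_natCast_div N (N + 1)
  rw [Nat.cast_add, Nat.cast_one, div_self (by positivity)] at this
  exact this.le

theorem inv_le_of_mem_gridSet {N : ℕ} {x : Size} (hx : x ∈ gridSet N) :
    1 / ((N : ℝ) + 1) ≤ x := by
  obtain ⟨j, hj⟩ := hx
  have h0 := x.2.1
  rw [hj] at h0 ⊢
  have hj0 : j ≠ 0 := by rintro rfl; simp at h0
  gcongr
  exact_mod_cast Nat.one_le_iff_ne_zero.2 hj0

theorem finite_gridSet (N : ℕ) : (gridSet N).Finite := by
  refine Set.Finite.of_finite_image (f := ((↑) : Size → ℝ)) ?_ Subtype.val_injective.injOn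
  refine ((Finset.range (N + 2)).finite_toSet.image fun j : ℕ => (j : ℝ) / (N + 1)).subset ?_
  rintro _ ⟨x, ⟨j, hj⟩, rfl⟩
  refine ⟨j, ?_, hj.symm⟩
  have h1 := x.2.2
  rw [hj, div_le_one (by positivity)] at h1
  have : j ≤ N + 1 := by exact_mod_cast h1
  simpa using by omega

/-- Measures carried by the grid of mesh `1 / (N + 1)`. -/
def IsGrid (N : ℕ) (ν : FiniteMeasure Size) : Prop := ∀ᵐ x ∂(ν : Measure Size), x ∈ gridSet N

namespace IsGrid

variable {N : ℕ} {ν : FiniteMeasure Size}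

theorem integrable (h : IsGrid N ν) (w : Size → ℝ) : Integrable w (ν : Measure Size) := by
  have := IntegrableOn.of_finite (μ := (ν : Measure Size)) (finite_gridSet N) (f := w)
  rwa [IntegrableOn, Measure.restrict_eq_self_of_ae_mem h] at this

theorem ae_prod (h : IsGrid N ν) : ∀ᵐ p ∂(ν : Measure Size).prod (ν : Measure Size),
    p.1 ∈ gridSet N ∧ p.2 ∈ gridSet N :=
  (Measure.quasiMeasurePreserving_fst.ae h).and (Measure.quasiMeasurePreserving_snd.ae h)

theorem integrable_prod (h : IsGrid N ν) (w : Size × Size → ℝ) :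
    Integrable w ((ν : Measure Size).prod (ν : Measure Size)) := by
  have := IntegrableOn.of_finite (μ := (ν : Measure Size).prod (ν : Measure Size))
    ((finite_gridSet N).prod (finite_gridSet N)) (f := w)
  rwa [IntegrableOn, Measure.restrict_eq_self_of_ae_mem (s := gridSet N ×ˢ gridSet N)
    h.ae_prod] at this

/-- A grid measure is carried by a finite set, so every function is integrable against it.
Discontinuous test functions, such as cell indicators, become admissible. -/
theorem testable (h : IsGrid N ν) (K F : ℝ → ℝ → ℝ) {φ : ℝ → ℝ} (hφ : Measurable φ) {S : ℝ}
    (hS : ∀ x ∈ Ioc (0 : ℝ) 1, |φ x| ≤ S) : Testable K F ν φ :=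
  ⟨hφ, ⟨S, hS⟩, h.integrable_prod _, h.integrable _, h.integrable _⟩

variable {K F : ℝ → ℝ → ℝ} {g : ℝ≥0 → L1Large} {k f ρ M : ℝ} {φ : ℝ → ℝ}

/-- A bound on how fast the weights can decrease. On the grid `K ≤ k (N + 1)` and `𝒢 ≤ k (N + 1) M`,
so everything that is lost is at most a multiple of `∫ φ`. The multiple dictates the time step of
the Euler scheme. -/
theorem le_rate (h : IsGrid N ν) (H : Subordinate K F g k f ρ M) (hφ : Measurable φ) {S : ℝ}
    (hS : ∀ x ∈ Ioc (0 : ℝ) 1, |φ x| ≤ S) (h0 : ∀ x ∈ Ioc (0 : ℝ) 1, 0 ≤ φ x) (t : ℝ≥0) :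
    -((k * (N + 1) * ((ν : Measure Size).real univ + M) + f / 2) *
      ∫ x : Size, φ x ∂(ν : Measure Size)) ≤ rate K F g t ν φ := by
  have hN : (0 : ℝ) < N + 1 := by positivity
  have hT := h.testable K F hφ hS
  set I := ∫ x : Size, φ x ∂(ν : Measure Size)
  have hdiv : ∀ c : ℝ, c / (1 / ((N : ℝ) + 1)) = c * (N + 1) := fun c => by field_simp
  have h1 : -(k * (N + 1)) * (2 * (ν : Measure Size).real univ * I) ≤
      ∫ p : Size × Size, K p.1 p.2 * opA φ p.1 p.2
        ∂((ν : Measure Size).prod (ν : Measure Size)) := by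
    have e : ∫ p : Size × Size, -(k * (N + 1)) * (φ p.1 + φ p.2)
        ∂((ν : Measure Size).prod (ν : Measure Size)) =
          -(k * (N + 1)) * (2 * (ν : Measure Size).real univ * I) := by
      rw [integral_const_mul, integral_add (h.integrable_prod _) (h.integrable_prod _),
        integral_fun_fst (fun x : Size => φ x), integral_fun_snd (fun x : Size => φ x)]
      simp only [smul_eq_mul]
      ring
    rw [← e]
    refine integral_mono_ae (h.integrable_prod _) (h.integrable_prod _) ?_
    filter_upwards [h.ae_prod] with p hp
    have a1 := h0 _ p.1.2
    have a2 := h0 _ p.2.2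
    have a3 := h0 _ (min_mem_Ioc p.1.2 p.2.2)
    have a4 := H.K_le_of_le (by positivity) p.1.2 p.2.2 (inv_le_of_mem_gridSet hp.1)
      (inv_le_of_mem_gridSet hp.2)
    have a5 := H.kernelK.nonneg _ _ p.1.2.1 p.2.2.1
    rw [hdiv] at a4
    unfold opA
    nlinarith [mul_nonneg a5 a3]
  have h2 : ∫ x : Size, lossG K g t x * φ x ∂(ν : Measure Size) ≤ k * (N + 1) * M * I := by
    rw [← integral_const_mul]
    refine integral_mono_ae (h.integrable _) (h.integrable _) ?_
    filter_upwards [h] with x hx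
    refine mul_le_mul_of_nonneg_right ((H.lossG_le t x.2).trans ?_) (h0 _ x.2)
    refine mul_le_mul_of_nonneg_right ?_ H.M_nonneg
    rw [← hdiv]
    exact div_le_div_of_nonneg_left H.k_nonneg (by positivity) (inv_le_of_mem_gridSet hx)
  have h3 : ∫ x : Size, opB F φ x ∂(ν : Measure Size) ≤ f / 2 * I := by
    rw [← integral_const_mul]
    refine integral_mono (h.integrable _) (h.integrable _) fun x => ?_
    have hx := x.2
    have := H.opB_le hφ hS hx (w := fun _ => f * φ x) (integrableOn_const (by simp)) fun y hy => by
      have a1 := H.F_antidiagonal_mem hx hy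
      have a2 := h0 _ hx
      have a3 := h0 (x - y) ⟨sub_pos.2 hy.2, by linarith [hy.1, hx.2]⟩
      have a4 := h0 y ⟨hy.1, hy.2.le.trans hx.2⟩
      exact (mul_le_mul_of_nonneg_left (by linarith) a1.1).trans
        (mul_le_mul_of_nonneg_right a1.2 a2)
    have e : ∫ _ in Ioo 0 (x : ℝ), f * φ x = x * (f * φ x) := by
      simp [Measure.real, hx.1.le]
    rw [e] at this
    have h5 : (x : ℝ) * (f * φ x) ≤ f * φ x :=
      mul_le_of_le_one_left (mul_nonneg H.f_nonneg (h0 _ hx)) hx.2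
    linarith
  have h4 : 0 ≤ ∫ x in Ioc (0 : ℝ) 1, gainC F g t x * φ x :=
    setIntegral_nonneg measurableSet_Ioc fun x hx =>
      mul_nonneg (H.gainC_nonneg t hx) (h0 x hx)
  rw [H.rate_eq hT]
  linarith

/-- The grid is stable under `(x, y) ↦ min (x + y) 1`, so the coagulation and loss integrands vanish
almost everywhere. These are the terms with the singular kernel; the others are controlled by the
supremum of `φ`. -/
theorem abs_rate_le_of_vanish (h : IsGrid N ν) (H : Subordinate K F g k f ρ M)
    (hφ : Measurable φ) {S D : ℝ} (hS : ∀ x ∈ Ioc (0 : ℝ) 1, |φ x| ≤ S)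
    (h0 : ∀ x ∈ gridSet N, φ x = 0) (hD : (ν : Measure Size).real univ + M ≤ D) (t : ℝ≥0) :
    |rate K F g t ν φ| ≤ 2 * f * D * S := by
  have hmin : ∀ x ∈ gridSet N, ∀ y ∈ gridSet N, φ (min ((x : ℝ) + y) 1) = 0 := by
    rintro x ⟨i, hi⟩ y ⟨j, hj⟩
    refine h0 ⟨min ((x : ℝ) + y) 1, min_mem_Ioc x.2 y.2⟩ ?_
    rcases min_choice ((x : ℝ) + y) 1 with h | h
    · exact ⟨i + j, by change min ((x : ℝ) + y) 1 = _; rw [h, hi, hj]; push_cast; ring⟩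
    · exact ⟨N + 1, by simp only [h]; push_cast; rw [div_self (by positivity)]⟩
  have h1 : ∫ p : Size × Size, K p.1 p.2 * opA φ p.1 p.2
      ∂((ν : Measure Size).prod (ν : Measure Size)) = 0 := by
    refine integral_eq_zero_of_ae ?_
    filter_upwards [h.ae_prod] with p hp
    simp [opA, hmin _ hp.1 _ hp.2, h0 _ hp.1, h0 _ hp.2]
  have h2 : ∫ x : Size, lossG K g t x * φ x ∂(ν : Measure Size) = 0 := by
    refine integral_eq_zero_of_ae ?_
    filter_upwards [h] with x hx
    simp [h0 _ hx]
  rw [H.rate_eq (h.testable K F hφ hS), h1, h2]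
  simpa using H.abs_fragmentation_le ν hS hD t

/-- The difference of the two test functions vanishes on the grid and is at most `L / (N + 1)` on
`(0, 1]`. The large bound `k (N + 1)` for the kernel on the grid therefore never enters the
consistency error. -/
theorem abs_rate_roundUp_sub_le (h : IsGrid N ν) (H : Subordinate K F g k f ρ M) {L D : ℝ}
    (hφ : LipAtZero L φ) (hD : (ν : Measure Size).real univ + M ≤ D) (t : ℝ≥0) :
    |rate K F g t ν (fun x => φ (roundUp N x)) - rate K F g t ν φ| ≤
      2 * f * D * (L * (1 / (N + 1))) := by
  have hm : Measurable fun x => φ (roundUp N x) :=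
    hφ.continuous.measurable.comp (measurable_roundUp N)
  have hT1 : Testable K F ν fun x => φ (roundUp N x) :=
    h.testable K F hm fun x hx => hφ.abs_le_one (roundUp_mem hx)
  have hT2 := H.testable_of_lip ν hφ
  have e : rate K F g t ν (fun x => φ (roundUp N x)) - rate K F g t ν φ =
      rate K F g t ν fun x => φ (roundUp N x) + -1 * φ x := by
    rw [Testable.rate_add H hT1 (hT2.const_mul (-1)), Testable.rate_const_mul]
    ring
  rw [e]
  refine h.abs_rate_le_of_vanish H (hm.add (hφ.continuous.measurable.const_mul _))
    (fun x hx => ?_) (fun x hx => ?_) hD t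
  · have h1 := hφ.lip (roundUp N x) x
    have h2 : |roundUp N x - x| ≤ 1 / (N + 1) := by
      rw [abs_of_nonneg (sub_nonneg.2 (le_roundUp N x))]
      linarith [roundUp_le N hx.1.le]
    change |φ (roundUp N x) + -1 * φ x| ≤ _
    rw [show φ (roundUp N x) + -1 * φ x = φ (roundUp N x) - φ x by ring]
    exact h1.trans (mul_le_mul_of_nonneg_left h2 hφ.nonneg)
  · change φ (roundUp N x) + -1 * φ x = 0
    rw [roundUp_of_mem_gridSet hx]; ring

end IsGrid
end CoagFrag

/-! ### The Euler scheme on grid measures. -/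

namespace CoagFrag

/-- The indicator of the set of points that are rounded up to `(l + 1) / (N + 1)`. -/
noncomputable def cellFn (N l : ℕ) (x : ℝ) : ℝ :=
  if roundUp N x = (l + 1) / (N + 1) then 1 else 0

theorem measurable_cellFn (N l : ℕ) : Measurable (cellFn N l) :=
  Measurable.ite (measurable_roundUp N (measurableSet_singleton _)) measurable_const
    measurable_const

theorem cellFn_nonneg (N l : ℕ) (x : ℝ) : 0 ≤ cellFn N l x := by
  unfold cellFn; split_ifs <;> norm_num

theorem abs_cellFn_le (N l : ℕ) (x : ℝ) : |cellFn N l x| ≤ 1 := by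
  unfold cellFn; split_ifs <;> norm_num

theorem comp_roundUp_eq_sum (N : ℕ) (φ : ℝ → ℝ) {x : ℝ} (hx : x ∈ Ioc (0 : ℝ) 1) :
    φ (roundUp N x) =
      ∑ l ∈ Finset.range (N + 1), φ (((l : ℝ) + 1) / (N + 1)) * cellFn N l x := by
  have hN : (0 : ℝ) < N + 1 := by positivity
  have h := roundUp_mem (N := N) hx
  obtain ⟨j, hj⟩ : ∃ j : ℕ, roundUp N x = j / (N + 1) := ⟨_, rfl⟩
  rw [hj] at h
  have hj1 : j ≠ 0 := by rintro rfl; simp at h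
  have hj2 : j ≤ N + 1 := by
    have := (div_le_one hN).1 h.2
    exact_mod_cast this
  obtain ⟨i, rfl⟩ := Nat.exists_eq_succ_of_ne_zero hj1
  rw [Finset.sum_eq_single i]
  · simp [cellFn, hj]
  · intro l _ hl
    have : (i : ℝ) + 1 ≠ l + 1 := fun h => hl (by exact_mod_cast (add_right_cancel h).symm)
    rw [cellFn, if_neg, mul_zero]
    rw [hj, div_left_inj' hN.ne']
    exact_mod_cast this
  · intro hi
    exact absurd (Finset.mem_range.2 (by omega)) hi

/-- The grid points, as elements of `(0, 1]`. -/
noncomputable def gridPoint (N l : ℕ) : Size :=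
  -- The minimum only makes the definition total: it has no effect for `l ≤ N`. Indices are shifted
  -- by one because `0` is not a size.
  ⟨min (((l : ℝ) + 1) / (N + 1)) 1, lt_min (by positivity) one_pos, min_le_right _ _⟩

theorem coe_gridPoint {N l : ℕ} (hl : l ∈ Finset.range (N + 1)) :
    (gridPoint N l : ℝ) = ((l : ℝ) + 1) / (N + 1) := by
  refine min_eq_left ((div_le_one (by positivity)).2 ?_)
  have := Finset.mem_range.1 hl
  have : (l : ℝ) ≤ N := by exact_mod_cast Nat.lt_succ_iff.1 this
  linarith

/-- The measure with weight `c l` at the grid point `(l + 1) / (N + 1)`. -/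
noncomputable def gridMeasure (N : ℕ) (c : ℕ → ℝ) : FiniteMeasure Size :=
  ∑ l ∈ Finset.range (N + 1),
    -- A negative weight would be replaced by `0`; `integral_gridMeasure` assumes that there is
    -- none.
    (c l).toNNReal • (diracProba (gridPoint N l)).toFiniteMeasure

theorem coe_gridMeasure (N : ℕ) (c : ℕ → ℝ) : (gridMeasure N c : Measure Size) =
    ∑ l ∈ Finset.range (N + 1), (c l).toNNReal • Measure.dirac (gridPoint N l) := by
  simp [gridMeasure, FiniteMeasure.toMeasure_sum, FiniteMeasure.toMeasure_smul, diracProba]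
  rfl

theorem isGrid_gridMeasure (N : ℕ) (c : ℕ → ℝ) : IsGrid N (gridMeasure N c) := by
  rw [IsGrid, coe_gridMeasure, ae_finsetSum_measure_iff]
  intro l hl
  refine Measure.ae_smul_measure ?_ _
  rw [ae_dirac_eq]
  exact ⟨l + 1, by rw [coe_gridPoint hl]; push_cast; rfl⟩

theorem integral_gridMeasure {N : ℕ} {c : ℕ → ℝ} (hc : ∀ l, 0 ≤ c l) (w : ℝ → ℝ) :
    ∫ x : Size, w x ∂(gridMeasure N c : Measure Size) =
      ∑ l ∈ Finset.range (N + 1), c l * w (((l : ℝ) + 1) / (N + 1)) := by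
  rw [coe_gridMeasure, integral_finsetSum_measure]
  · refine Finset.sum_congr rfl fun l hl => ?_
    rw [integral_smul_nnreal_measure, integral_dirac, coe_gridPoint hl, NNReal.smul_def,
      Real.coe_toNNReal _ (hc l), smul_eq_mul]
  · intro l _
    exact (integrable_dirac (by simp)).smul_measure_nnreal

variable {K F : ℝ → ℝ → ℝ} {g : ℝ≥0 → L1Large} {k f ρ M : ℝ}

/-- One step of the Euler scheme on the grid of mesh `1 / (N + 1)`, with the boundary datum
averaged over the time interval `[a, b]`. -/
noncomputable def eulerStep (K F : ℝ → ℝ → ℝ) (g : ℝ≥0 → L1Large) (N : ℕ) (a b : ℝ)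
    (ν : FiniteMeasure Size) : FiniteMeasure Size :=
  gridMeasure N fun l => (∫ x : Size, cellFn N l x ∂(ν : Measure Size)) +
    ∫ s in a..b, rate K F g s.toNNReal ν (cellFn N l)

theorem integrable_cellFn (ν : FiniteMeasure Size) (N l : ℕ) :
    Integrable (fun x : Size => cellFn N l x) (ν : Measure Size) :=
  Integrable.mono' (integrable_const 1)
    ((measurable_cellFn N l).comp measurable_subtype_coe).aestronglyMeasurable
    (Eventually.of_forall fun _ => abs_cellFn_le N l _)

theorem integral_comp_roundUp (ν : FiniteMeasure Size) (N : ℕ) (φ : ℝ → ℝ) :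
    ∫ x : Size, φ (roundUp N x) ∂(ν : Measure Size) = ∑ l ∈ Finset.range (N + 1),
      φ (((l : ℝ) + 1) / (N + 1)) * ∫ x : Size, cellFn N l x ∂(ν : Measure Size) := by
  simp only [← integral_const_mul]
  rw [← integral_finsetSum _ fun l _ => (integrable_cellFn ν N l).const_mul _]
  exact integral_congr_ae (Eventually.of_forall fun x => comp_roundUp_eq_sum N φ x.2)

theorem IsGrid.integral_comp_roundUp {N : ℕ} {ν : FiniteMeasure Size} (h : IsGrid N ν)
    (φ : ℝ → ℝ) : ∫ x : Size, φ (roundUp N x) ∂(ν : Measure Size) =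
      ∫ x : Size, φ x ∂(ν : Measure Size) := by
  refine integral_congr_ae ?_
  filter_upwards [h] with x hx
  rw [roundUp_of_mem_gridSet hx]

/-- `φ ∘ roundUp` is a combination of cell indicators and the rate is linear, so the weights add up
to the right-hand side once they are known to be nonnegative, which is where `hstep` enters. The
rate is integrated exactly in time with only `ν` frozen, so no modulus of continuity of `g` enters
the error. -/
theorem integral_eulerStep (H : Subordinate K F g k f ρ M) {N : ℕ} {ν : FiniteMeasure Size}
    (hν : IsGrid N ν) {a b D : ℝ} (hab : a ≤ b) (hD : (ν : Measure Size).real univ + M ≤ D)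
    (hstep : (b - a) * (k * (N + 1) * D + f / 2) ≤ 1) (φ : ℝ → ℝ) :
    ∫ x : Size, φ x ∂(eulerStep K F g N a b ν : Measure Size) =
      (∫ x : Size, φ x ∂(ν : Measure Size)) +
        ∫ s in a..b, rate K F g s.toNNReal ν fun x => φ (roundUp N x) := by
  have hT : ∀ l, Testable K F ν (cellFn N l) := fun l =>
    hν.testable K F (measurable_cellFn N l) fun x _ => abs_cellFn_le N l x
  have hsum := Testable.sum (g := g) H (Finset.range (N + 1))
    (fun l => φ (((l : ℝ) + 1) / (N + 1))) hT
  have hrate : ∀ t, rate K F g t ν (fun x => φ (roundUp N x)) =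
      ∑ l ∈ Finset.range (N + 1),
        φ (((l : ℝ) + 1) / (N + 1)) * rate K F g t ν (cellFn N l) := fun t => by
    rw [← hsum.2 t]
    exact rate_congr K F g t ν fun x hx => comp_roundUp_eq_sum N φ hx
  rw [eulerStep, integral_gridMeasure, ← hν.integral_comp_roundUp φ,
    CoagFrag.integral_comp_roundUp ν N φ]
  · simp only [hrate]
    rw [intervalIntegral.integral_finsetSum fun l _ =>
      (H.intervalIntegrable_rate (hT l) a b).const_mul _, ← Finset.sum_add_distrib]
    refine Finset.sum_congr rfl fun l _ => ?_
    rw [intervalIntegral.integral_const_mul]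
    ring
  · intro l
    set I := ∫ x : Size, cellFn N l x ∂(ν : Measure Size)
    have hI : 0 ≤ I := integral_nonneg fun x => cellFn_nonneg N l x
    have h1 : ∫ _ in a..b, -((k * (N + 1) * D + f / 2) * I) ≤
        ∫ s in a..b, rate K F g s.toNNReal ν (cellFn N l) := by
      refine intervalIntegral.integral_mono_on hab intervalIntegrable_const
        (H.intervalIntegrable_rate (hT l) a b) fun s _ => ?_
      refine le_trans (neg_le_neg ?_) (hν.le_rate H (measurable_cellFn N l)
        (fun x _ => abs_cellFn_le N l x) (fun x _ => cellFn_nonneg N l x) _)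
      have := H.k_nonneg
      gcongr
    -- The new weight is at least `(1 - (b - a) (k (N + 1) D + f / 2)) I`, which is nonnegative by
    -- `hstep`.
    rw [intervalIntegral.integral_const, smul_eq_mul] at h1
    nlinarith

/-- The Euler scheme with time step `h`. -/
noncomputable def eulerSeq (K F : ℝ → ℝ → ℝ) (g : ℝ≥0 → L1Large) (N : ℕ) (h : ℝ)
    (μin : FiniteMeasure Size) : ℕ → FiniteMeasure Size
  | 0 => gridMeasure N fun l => ∫ x : Size, cellFn N l x ∂(μin : Measure Size)
  | j + 1 => eulerStep K F g N (j * h) ((j + 1) * h) (eulerSeq K F g N h μin j)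

theorem isGrid_eulerSeq (K F : ℝ → ℝ → ℝ) (g : ℝ≥0 → L1Large) (N : ℕ) (h : ℝ)
    (μin : FiniteMeasure Size) (j : ℕ) : IsGrid N (eulerSeq K F g N h μin j) := by
  cases j with
  | zero => exact isGrid_gridMeasure N _
  | succ j => exact isGrid_gridMeasure N _

theorem integral_eulerSeq_zero (K F : ℝ → ℝ → ℝ) (g : ℝ≥0 → L1Large) (N : ℕ) (h : ℝ)
    (μin : FiniteMeasure Size) (φ : ℝ → ℝ) :
    ∫ x : Size, φ x ∂(eulerSeq K F g N h μin 0 : Measure Size) =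
      ∫ x : Size, φ (roundUp N x) ∂(μin : Measure Size) := by
  rw [eulerSeq, integral_gridMeasure fun l => integral_nonneg fun x : Size => cellFn_nonneg N l x,
    integral_comp_roundUp]
  simp only [mul_comm]

/-- The bound on the total mass at time `t`. -/
noncomputable def massBound (f M : ℝ) (μin : FiniteMeasure Size) (t : ℝ) : ℝ :=
  Real.exp (f * t) * ((μin : Measure Size).real univ + M)

namespace Subordinate

theorem massBound_mono (H : Subordinate K F g k f ρ M) (μin : FiniteMeasure Size) :
    Monotone (massBound f M μin) := fun s t hst => by
  have h1 : (0 : ℝ) ≤ (μin : Measure Size).real univ := measureReal_nonneg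
  have h2 := H.M_nonneg
  have h3 := H.f_nonneg
  unfold massBound
  gcongr

theorem massBound_nonneg (H : Subordinate K F g k f ρ M) (μin : FiniteMeasure Size) (t : ℝ) :
    0 ≤ massBound f M μin t :=
  mul_nonneg (Real.exp_nonneg _) (add_nonneg measureReal_nonneg H.M_nonneg)

end Subordinate

section Scheme

variable {N : ℕ} {h : ℝ} {μin : FiniteMeasure Size}

theorem real_univ_eq_integral (ν : FiniteMeasure Size) :
    (ν : Measure Size).real univ = ∫ _ : Size, (1 : ℝ) ∂(ν : Measure Size) := by simp

/-- A discrete Grönwall argument with the test function `1`: each step multiplies mass plus `M` by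
at most `1 + f h ≤ exp (f h)`. Adding `M` to the mass absorbs the source term. The bound at step `j`
is also what makes `integral_eulerStep` applicable to the next step. -/
theorem real_univ_eulerSeq_le (H : Subordinate K F g k f ρ M) (hh : 0 ≤ h)
    (hstep : h * (k * (N + 1) * massBound f M μin N + f / 2) ≤ 1) {j : ℕ} (hj : j * h ≤ N) :
    (eulerSeq K F g N h μin j : Measure Size).real univ + M ≤ massBound f M μin (j * h) := by
  induction j with
  | zero =>
    rw [real_univ_eq_integral, integral_eulerSeq_zero K F g N h μin fun _ => 1,
      ← real_univ_eq_integral]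
    simp [massBound]
  | succ j ih =>
    have hj' : (j : ℝ) * h ≤ N := by push_cast at hj; linarith
    specialize ih hj'
    set ν := eulerSeq K F g N h μin j with hν_def
    have hν : IsGrid N ν := isGrid_eulerSeq K F g N h μin j
    have hT : Testable K F ν fun _ => 1 :=
      hν.testable K F measurable_const (S := 1) (by simp)
    have h1 := integral_eulerStep H hν (a := j * h) (b := (j + 1) * h) (by linarith)
      (ih.trans (H.massBound_mono μin hj')) (by linarith) fun _ => 1
    have h2 : ∫ s in (j * h)..((j + 1) * h), rate K F g s.toNNReal ν (fun _ => 1) ≤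
        ∫ _ in (j * h)..((j + 1) * h), f * ((ν : Measure Size).real univ + M) := by
      refine intervalIntegral.integral_mono_on (by linarith) (H.intervalIntegrable_rate hT _ _)
        intervalIntegrable_const fun s _ => ?_
      have := H.rate_le_of_antitone hT antitoneOn_const (fun _ _ => zero_le_one) s.toNNReal
      simpa using this
    rw [intervalIntegral.integral_const, smul_eq_mul] at h2
    rw [real_univ_eq_integral, eulerSeq, ← hν_def, h1, ← real_univ_eq_integral]
    have h3 : 1 + f * h ≤ Real.exp (f * h) := by
      linarith [Real.add_one_le_exp (f * h)]
    have h4 : (0 : ℝ) ≤ (ν : Measure Size).real univ + M :=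
      add_nonneg measureReal_nonneg H.M_nonneg
    calc (ν : Measure Size).real univ +
          (∫ s in (j * h)..((j + 1) * h), rate K F g s.toNNReal ν fun _ => 1) + M
        ≤ (1 + f * h) * ((ν : Measure Size).real univ + M) := by linarith
      _ ≤ Real.exp (f * h) * massBound f M μin (j * h) := by gcongr
      _ = massBound f M μin ((j + 1 : ℕ) * h) := by
        rw [massBound, massBound, ← mul_assoc, ← Real.exp_add]
        push_cast
        ring_nf

theorem floor_div_eq {s : ℝ} {j : ℕ} (hh : 0 < h) (hs : s ∈ Ioo (j * h) ((j + 1) * h)) :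
    ⌊s / h⌋₊ = j := by
  have hs0 : 0 ≤ s / h := div_nonneg ((by positivity : (0 : ℝ) ≤ j * h).trans hs.1.le) hh.le
  rw [Nat.floor_eq_iff hs0, le_div_iff₀ hh, div_lt_iff₀ hh]
  exact ⟨hs.1.le, hs.2⟩

theorem intervalIntegrable_rate_floor (H : Subordinate K F g k f ρ M) (hh : 0 < h)
    {ν : ℕ → FiniteMeasure Size} {φ : ℝ → ℝ} (hT : ∀ j, Testable K F (ν j) φ) (j : ℕ) :
    IntervalIntegrable (fun s : ℝ => rate K F g s.toNNReal (ν ⌊s / h⌋₊) φ) volume 0 (j * h) := by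
  induction j with
  | zero => simp
  | succ j ih =>
    refine ih.trans ?_
    have h1 := H.intervalIntegrable_rate (hT j) (j * h) ((j + 1) * h)
    rw [intervalIntegrable_iff_integrableOn_Ioo_of_le (by linarith)] at h1
    push_cast
    rw [intervalIntegrable_iff_integrableOn_Ioo_of_le (by linarith)]
    exact h1.congr_fun (fun s hs => by simp only [floor_div_eq hh hs]) measurableSet_Ioo

theorem integral_rate_floor (hh : 0 < h) (ν : ℕ → FiniteMeasure Size) (φ : ℝ → ℝ) (j : ℕ) :
    ∫ s in (j * h)..((j + 1) * h), rate K F g s.toNNReal (ν ⌊s / h⌋₊) φ =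
      ∫ s in (j * h)..((j + 1) * h), rate K F g s.toNNReal (ν j) φ := by
  rw [intervalIntegral.integral_of_le (by linarith), intervalIntegral.integral_of_le (by linarith),
    integral_Ioc_eq_integral_Ioo, integral_Ioc_eq_integral_Ioo]
  exact setIntegral_congr_fun measurableSet_Ioo fun s hs => by simp only [floor_div_eq hh hs]

/-- The steps telescope, the state being frozen on each interval `(j h, (j + 1) h)`. -/
theorem integral_eulerSeq (H : Subordinate K F g k f ρ M) (hh : 0 < h)
    (hstep : h * (k * (N + 1) * massBound f M μin N + f / 2) ≤ 1) {φ : ℝ → ℝ}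
    (hφ : Measurable φ) {S : ℝ} (hS : ∀ x ∈ Ioc (0 : ℝ) 1, |φ x| ≤ S) {j : ℕ}
    (hj : j * h ≤ N) :
    ∫ x : Size, φ x ∂(eulerSeq K F g N h μin j : Measure Size) =
      (∫ x : Size, φ (roundUp N x) ∂(μin : Measure Size)) +
      ∫ s in (0 : ℝ)..(j * h), rate K F g s.toNNReal (eulerSeq K F g N h μin ⌊s / h⌋₊)
        fun x => φ (roundUp N x) := by
  have hT : ∀ j, Testable K F (eulerSeq K F g N h μin j) fun x => φ (roundUp N x) := fun j =>
    (isGrid_eulerSeq K F g N h μin j).testable K F (hφ.comp (measurable_roundUp N))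
      fun x hx => hS _ (roundUp_mem hx)
  induction j with
  | zero => simp [integral_eulerSeq_zero]
  | succ j ih =>
    have hj' : (j : ℝ) * h ≤ N := by push_cast at hj; linarith
    have h1 := intervalIntegrable_rate_floor H hh hT j
    have h2 := intervalIntegrable_rate_floor H hh hT (j + 1)
    push_cast at h2 ⊢
    rw [← intervalIntegral.integral_add_adjacent_intervals h1 (h1.symm.trans h2),
      integral_rate_floor hh, eulerSeq, integral_eulerStep H (isGrid_eulerSeq K F g N h μin j)
        (by linarith) ((real_univ_eulerSeq_le H hh.le hstep hj').trans
          (H.massBound_mono μin hj')) (by linarith), ih hj', add_assoc]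

end Scheme
end CoagFrag

/-! ### Approximate solutions. -/

namespace CoagFrag

/-- A bound on the rates at time `t`, for `1`-Lipschitz functions vanishing at `0`. -/
noncomputable def rateBound (k f M : ℝ) (μin : FiniteMeasure Size) (t : ℝ) : ℝ :=
  k * massBound f M μin t ^ 2 + 2 * f * massBound f M μin t

/-- Approximate solutions with error of order `1 / (N + 1)` up to time `N`. -/
structure IsApproxSolution (K F : ℝ → ℝ → ℝ) (g : ℝ≥0 → L1Large) (k f M : ℝ)
    (μin : FiniteMeasure Size) (N : ℕ) (μ : ℝ≥0 → FiniteMeasure Size) : Prop where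
  mass_le : ∀ t : ℝ≥0, t ≤ N → (μ t : Measure Size).real univ + M ≤ massBound f M μin t
  tail_le : ∀ t : ℝ≥0, t ≤ N → ∀ ε : ℝ, 0 ≤ ε → (μ t : Measure Size).real {x | (x : ℝ) ≤ ε} ≤
    (μin : Measure Size).real {x | (x : ℝ) ≤ ε} + t * (f * massBound f M μin t) * ε
  intervalIntegrable : ∀ (t : ℝ≥0) (L : ℝ) (φ : ℝ → ℝ), LipAtZero L φ →
    IntervalIntegrable (fun s : ℝ => rate K F g s.toNNReal (μ s.toNNReal) φ) volume 0 t
  equation : ∀ t : ℝ≥0, t ≤ N → ∀ (L : ℝ) (φ : ℝ → ℝ), LipAtZero L φ →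
    |(∫ x : Size, φ x ∂(μ t : Measure Size)) - (∫ x : Size, φ x ∂(μin : Measure Size)) -
      ∫ s in (0 : ℝ)..t, rate K F g s.toNNReal (μ s.toNNReal) φ| ≤
    (massBound f M μin t + t * (2 * f * massBound f M μin t) + rateBound k f M μin t) *
      (L * (1 / (N + 1)))

namespace Subordinate

variable {K F : ℝ → ℝ → ℝ} {g : ℝ≥0 → L1Large} {k f ρ M : ℝ}

theorem rateBound_mono (H : Subordinate K F g k f ρ M) (μin : FiniteMeasure Size) :
    Monotone (rateBound k f M μin) := fun s t hst => by
  have h1 := H.massBound_mono μin hst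
  have h2 := H.massBound_nonneg μin s
  have h3 := H.f_nonneg
  have h4 := H.k_nonneg
  unfold rateBound
  gcongr

theorem rateBound_nonneg (H : Subordinate K F g k f ρ M) (μin : FiniteMeasure Size) (t : ℝ) :
    0 ≤ rateBound k f M μin t := by
  have h2 := H.massBound_nonneg μin t
  have h3 := H.f_nonneg
  have h4 := H.k_nonneg
  unfold rateBound
  positivity

theorem abs_integral_roundUp_sub_le (ν : FiniteMeasure Size) (N : ℕ) {L : ℝ} {φ : ℝ → ℝ}
    (hφ : LipAtZero L φ) : |(∫ x : Size, φ (roundUp N x) ∂(ν : Measure Size)) -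
      ∫ x : Size, φ x ∂(ν : Measure Size)| ≤
        L * (1 / (N + 1)) * (ν : Measure Size).real univ := by
  have hb : ∀ w : Size → ℝ, Measurable w → (∀ x, w x ∈ Ioc (0 : ℝ) 1) →
      Integrable (fun x => φ (w x)) (ν : Measure Size) := fun w hw hw1 =>
    Integrable.mono' (integrable_const L) (hφ.continuous.measurable.comp hw).aestronglyMeasurable
      (Eventually.of_forall fun x => hφ.abs_le_one (hw1 x))
  rw [← integral_sub (hb (fun x => roundUp N x)
    ((measurable_roundUp N).comp measurable_subtype_coe) fun x => roundUp_mem x.2)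
    (hb (fun x => x) measurable_subtype_coe fun x => x.2), ← Real.norm_eq_abs]
  refine norm_integral_le_of_norm_le_const (Eventually.of_forall fun x => ?_)
  have h2 : |roundUp N x - x| ≤ 1 / (N + 1) := by
    rw [abs_of_nonneg (sub_nonneg.2 (le_roundUp N x))]
    linarith [roundUp_le N x.2.1.le]
  exact (hφ.lip _ _).trans (mul_le_mul_of_nonneg_left h2 hφ.nonneg)

/-- The Euler sequence, held constant between steps. The three terms of the error come from rounding
`μin`, from rounding `φ` inside the rate, and from the time between the last step `τ` and `t`, which
is at most `h ≤ 1 / (N + 1)`. -/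
theorem exists_isApproxSolution (H : Subordinate K F g k f ρ M) (μin : FiniteMeasure Size)
    (N : ℕ) : ∃ μ, IsApproxSolution K F g k f M μin N μ := by
  have hk := H.k_nonneg
  have hf := H.f_nonneg
  have hDN := H.massBound_nonneg μin N
  set A := k * (N + 1) * massBound f M μin N + f / 2 with hA
  have hA0 : 0 ≤ A := by positivity
  obtain ⟨h, hh, hN, hstep⟩ : ∃ h : ℝ, 0 < h ∧ h ≤ 1 / (N + 1) ∧ h * A ≤ 1 := by
    -- The denominator dominates both `N + 1` (accuracy) and `A` (nonnegativity of the weights).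
    refine ⟨1 / (N + 1 + A), by positivity, ?_, ?_⟩
    · exact one_div_le_one_div_of_le (by positivity) (by linarith)
    · rw [div_mul_eq_mul_div, div_le_one (by positivity)]
      have : (0 : ℝ) ≤ N := N.cast_nonneg
      linarith
  set ν := eulerSeq K F g N h μin with hν
  set μ : ℝ≥0 → FiniteMeasure Size := fun t => ν ⌊(t : ℝ) / h⌋₊ with hμ
  have hgrid : ∀ j, IsGrid N (ν j) := isGrid_eulerSeq K F g N h μin
  have hfl : ∀ t : ℝ≥0, ⌊(t : ℝ) / h⌋₊ * h ≤ (t : ℝ) := fun t => by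
    have := Nat.floor_le (div_nonneg t.2 hh.le)
    rwa [le_div_iff₀ hh] at this
  have hfl' : ∀ t : ℝ≥0, (t : ℝ) ≤ ⌊(t : ℝ) / h⌋₊ * h + h := fun t => by
    have := (Nat.lt_floor_add_one ((t : ℝ) / h)).le
    rw [div_le_iff₀ hh] at this
    linarith
  have hmass : ∀ t : ℝ≥0, t ≤ N →
      (μ t : Measure Size).real univ + M ≤ massBound f M μin t := fun t ht =>
    (real_univ_eulerSeq_le H hh.le hstep
      ((hfl t).trans (by exact_mod_cast ht))).trans (H.massBound_mono μin (hfl t))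
  have hμs : ∀ s : ℝ, 0 ≤ s → μ s.toNNReal = ν ⌊s / h⌋₊ := fun s hs => by
    simp only [hμ, Real.coe_toNNReal s hs]
  have hcongr : ∀ (φ : ℝ → ℝ) (a b : ℝ), 0 ≤ a → 0 ≤ b →
      EqOn (fun s : ℝ => rate K F g s.toNNReal (ν ⌊s / h⌋₊) φ)
        (fun s : ℝ => rate K F g s.toNNReal (μ s.toNNReal) φ) (uIoc a b) := by
    intro φ a b ha hb s hs
    simp only
    rw [hμs s ((le_min ha hb).trans hs.1.le)]
  have hint : ∀ (φ : ℝ → ℝ), (∀ j, Testable K F (ν j) φ) → ∀ t : ℝ≥0,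
      IntervalIntegrable (fun s : ℝ => rate K F g s.toNNReal (μ s.toNNReal) φ) volume 0 t := by
    intro φ hφ t
    have h1 := intervalIntegrable_rate_floor H hh hφ (⌊(t : ℝ) / h⌋₊ + 1)
    have h2 : (t : ℝ) ≤ (⌊(t : ℝ) / h⌋₊ + 1 : ℕ) * h := by
      push_cast
      linarith [hfl' t]
    refine (h1.mono_set ?_).congr (hcongr φ 0 t le_rfl t.2)
    rw [uIcc_of_le t.coe_nonneg, uIcc_of_le (t.coe_nonneg.trans h2)]
    exact Icc_subset_Icc le_rfl h2
  have heq : ∀ t : ℝ≥0, t ≤ N → ∀ (φ : ℝ → ℝ), Measurable φ →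
      (∃ S, ∀ x ∈ Ioc (0 : ℝ) 1, |φ x| ≤ S) →
      ∫ x : Size, φ x ∂(μ t : Measure Size) =
      (∫ x : Size, φ (roundUp N x) ∂(μin : Measure Size)) +
      ∫ s in (0 : ℝ)..(⌊(t : ℝ) / h⌋₊ * h), rate K F g s.toNNReal (μ s.toNNReal)
        fun x => φ (roundUp N x) := by
    rintro t ht φ hφ ⟨S, hS⟩
    have := integral_eulerSeq H (μin := μin) hh hstep hφ hS (j := ⌊(t : ℝ) / h⌋₊)
      ((hfl t).trans (by exact_mod_cast ht))
    rw [show μ t = ν ⌊(t : ℝ) / h⌋₊ from rfl, this]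
    congr 1
    exact intervalIntegral.integral_congr_ae
      (Eventually.of_forall fun s hs => hcongr _ _ _ le_rfl (by positivity) hs)
  have hle : ∀ s t : ℝ, 0 ≤ s → s ≤ t → t ≤ N →
      (μ s.toNNReal : Measure Size).real univ + M ≤ massBound f M μin t := by
    intro s t hs hst ht
    have := hmass s.toNNReal (by
      rw [Real.toNNReal_le_iff_le_coe]; simpa using hst.trans ht)
    rw [Real.coe_toNNReal s hs] at this
    exact this.trans (H.massBound_mono μin hst)
  have hround : ∀ (φ : ℝ → ℝ), Measurable φ → (∃ S, ∀ x ∈ Ioc (0 : ℝ) 1, |φ x| ≤ S) →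
      ∀ j, Testable K F (ν j) fun x => φ (roundUp N x) := by
    rintro φ hφ ⟨S, hS⟩ j
    exact (hgrid j).testable K F (hφ.comp (measurable_roundUp N)) fun x hx => hS _ (roundUp_mem hx)
  refine ⟨μ, hmass, ?_, fun t L φ hφ => hint φ (fun j => H.testable_of_lip _ hφ) t, ?_⟩
  · intro t ht ε hε
    set φ : ℝ → ℝ := indicator (Iic ε) 1 with hφ_def
    have hφanti : Antitone φ := fun x y hxy => by
      simp only [hφ_def, indicator_apply, mem_Iic, Pi.one_apply]
      split_ifs <;> linarith
    have hφm : Measurable φ := measurable_one.indicator measurableSet_Iic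
    have hφ0 : ∀ x, 0 ≤ φ x := fun x => indicator_nonneg (fun _ _ => zero_le_one) x
    have hφ1 : ∀ x, φ x ≤ 1 := fun x => indicator_le_self' (fun _ _ => zero_le_one) x
    have hφb : ∃ S, ∀ x ∈ Ioc (0 : ℝ) 1, |φ x| ≤ S :=
      ⟨1, fun x _ => by rw [abs_of_nonneg (hφ0 x)]; exact hφ1 x⟩
    have hset : MeasurableSet {x : Size | (x : ℝ) ≤ ε} :=
      measurableSet_le measurable_subtype_coe measurable_const
    have hφint : ∀ κ : FiniteMeasure Size, ∫ x : Size, φ x ∂(κ : Measure Size) =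
        (κ : Measure Size).real {x | (x : ℝ) ≤ ε} := fun κ => by
      rw [← integral_indicator_one hset]
      rfl
    -- The reason for rounding up: mass is moved away from `0`, so the tail near `0` is not
    -- increased by rounding.
    have hcomp : ∀ x, φ (roundUp N x) ≤ φ x := fun x => hφanti (le_roundUp N x)
    have hin : ∫ x : Size, φ (roundUp N x) ∂(μin : Measure Size) ≤
        ∫ x : Size, φ x ∂(μin : Measure Size) :=
      integral_mono
        (Integrable.mono' (integrable_const 1)
          (hφm.comp ((measurable_roundUp N).comp measurable_subtype_coe)).aestronglyMeasurable
          (Eventually.of_forall fun x => by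
            rw [Real.norm_eq_abs, abs_of_nonneg (hφ0 _)]; exact hφ1 _))
        (Integrable.mono' (integrable_const 1)
          (hφm.comp measurable_subtype_coe).aestronglyMeasurable
          (Eventually.of_forall fun x => by
            rw [Real.norm_eq_abs, abs_of_nonneg (hφ0 _)]; exact hφ1 _))
        fun x => hcomp x
    have hvol : ∫ x in Ioc (0 : ℝ) 1, φ (roundUp N x) ≤ ε := by
      have h1 : ∫ x in Ioc (0 : ℝ) 1, φ (roundUp N x) ≤ ∫ x in Ioc (0 : ℝ) 1, φ x := by
        refine setIntegral_mono ?_ ?_ hcomp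
        · exact Integrable.mono' (integrable_const 1)
            (hφm.comp (measurable_roundUp N)).aestronglyMeasurable
            (Eventually.of_forall fun x => by
              rw [Real.norm_eq_abs, abs_of_nonneg (hφ0 _)]; exact hφ1 _)
        · exact Integrable.mono' (integrable_const 1) hφm.aestronglyMeasurable
            (Eventually.of_forall fun x => by
              rw [Real.norm_eq_abs, abs_of_nonneg (hφ0 _)]; exact hφ1 _)
      refine h1.trans ?_
      rw [hφ_def, integral_indicator_one measurableSet_Iic, measureReal_restrict_apply
        measurableSet_Iic]
      have : volume.real (Iic ε ∩ Ioc 0 1) ≤ volume.real (Ioc 0 ε) :=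
        measureReal_mono (fun x hx => ⟨hx.2.1, hx.1⟩) (by simp)
      simpa [Measure.real, hε] using this
    have hrate : ∫ s in (0 : ℝ)..(⌊(t : ℝ) / h⌋₊ * h), rate K F g s.toNNReal (μ s.toNNReal)
        (fun x => φ (roundUp N x)) ≤
        ∫ _ in (0 : ℝ)..(⌊(t : ℝ) / h⌋₊ * h), f * massBound f M μin t * ε := by
      refine intervalIntegral.integral_mono_on (by positivity)
        ((hint _ (hround φ hφm hφb) ⟨⌊(t : ℝ) / h⌋₊ * h, by positivity⟩))
        intervalIntegrable_const fun s hs => ?_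
      refine (H.rate_le_of_antitone (hround φ hφm hφb _)
        (fun x _ y _ hxy => hφanti (monotone_roundUp N hxy)) (fun x _ => hφ0 _) _).trans ?_
      have h1 := hle s t hs.1 (hs.2.trans (hfl t)) (by exact_mod_cast ht)
      have h2 : (0 : ℝ) ≤ (μ s.toNNReal : Measure Size).real univ + M :=
        add_nonneg measureReal_nonneg H.M_nonneg
      exact mul_le_mul (mul_le_mul_of_nonneg_left h1 hf) hvol
        (integral_nonneg fun x => hφ0 _) (mul_nonneg hf (H.massBound_nonneg μin _))
    rw [intervalIntegral.integral_const, smul_eq_mul, sub_zero] at hrate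
    have h5 : 0 ≤ f * massBound f M μin t * ε :=
      mul_nonneg (mul_nonneg hf (H.massBound_nonneg μin t)) hε
    have h6 := mul_le_mul_of_nonneg_right (hfl t) h5
    rw [← hφint, ← hφint, heq t ht φ hφm hφb]
    linarith
  · intro t ht L φ hφ
    have hφb : ∃ S, ∀ x ∈ Ioc (0 : ℝ) 1, |φ x| ≤ S := ⟨L, fun _ => hφ.abs_le_one⟩
    have htN : (t : ℝ) ≤ N := by exact_mod_cast ht
    set τ : ℝ := ⌊(t : ℝ) / h⌋₊ * h with hτ
    have hτ0 : 0 ≤ τ := by positivity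
    have hτt : τ ≤ t := hfl t
    set D := massBound f M μin t with hD
    have hD0 : 0 ≤ D := H.massBound_nonneg μin t
    have hL := hφ.nonneg
    have hTφ : ∀ j, Testable K F (ν j) φ := fun j => H.testable_of_lip _ hφ
    have hTr := hround φ hφ.continuous.measurable hφb
    have i1 : IntervalIntegrable (fun s : ℝ => rate K F g s.toNNReal (μ s.toNNReal) φ)
        volume 0 τ := hint φ hTφ ⟨τ, hτ0⟩
    have i2 : IntervalIntegrable (fun s : ℝ => rate K F g s.toNNReal (μ s.toNNReal) φ)
        volume 0 t := hint φ hTφ t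
    have i3 : IntervalIntegrable (fun s : ℝ => rate K F g s.toNNReal (μ s.toNNReal)
        fun x => φ (roundUp N x)) volume 0 τ := hint _ hTr ⟨τ, hτ0⟩
    have e1 := abs_integral_roundUp_sub_le μin N hφ
    have e2 : |(∫ s in (0 : ℝ)..τ, rate K F g s.toNNReal (μ s.toNNReal)
        fun x => φ (roundUp N x)) -
        ∫ s in (0 : ℝ)..τ, rate K F g s.toNNReal (μ s.toNNReal) φ| ≤
        2 * f * D * (L * (1 / (N + 1))) * |τ - 0| := by
      rw [← intervalIntegral.integral_sub i3 i1, ← Real.norm_eq_abs]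
      refine intervalIntegral.norm_integral_le_of_norm_le_const fun s hs => ?_
      rw [uIoc_of_le hτ0] at hs
      exact (hgrid _).abs_rate_roundUp_sub_le H hφ
        (hle s t hs.1.le (hs.2.trans hτt) htN) _
    have e3 : |∫ s in τ..t, rate K F g s.toNNReal (μ s.toNNReal) φ| ≤
        rateBound k f M μin t * L * |t - τ| := by
      rw [← Real.norm_eq_abs]
      refine intervalIntegral.norm_integral_le_of_norm_le_const fun s hs => ?_
      rw [uIoc_of_le hτt] at hs
      exact H.abs_rate_le_of_lip hφ (hle s t (hτ0.trans hs.1.le) hs.2 htN) _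
    have e4 : (∫ s in (0 : ℝ)..τ, rate K F g s.toNNReal (μ s.toNNReal) φ) +
        ∫ s in τ..t, rate K F g s.toNNReal (μ s.toNNReal) φ =
        ∫ s in (0 : ℝ)..t, rate K F g s.toNNReal (μ s.toNNReal) φ :=
      intervalIntegral.integral_add_adjacent_intervals i1 (i1.symm.trans i2)
    have hδ : (0 : ℝ) ≤ 1 / (N + 1) := by positivity
    have b1 : L * (1 / (N + 1)) * (μin : Measure Size).real univ ≤ D * (L * (1 / (N + 1))) := by
      rw [mul_comm]
      refine mul_le_mul_of_nonneg_right ?_ (mul_nonneg hL hδ)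
      have h1 := H.massBound_mono μin t.2
      have h2 : (μin : Measure Size).real univ + M = massBound f M μin 0 := by simp [massBound]
      have h3 := H.M_nonneg
      change massBound f M μin 0 ≤ D at h1
      linarith
    have b2 : 2 * f * D * (L * (1 / (N + 1))) * |τ - 0| ≤
        t * (2 * f * D) * (L * (1 / (N + 1))) := by
      rw [sub_zero, abs_of_nonneg hτ0]
      have := mul_le_mul_of_nonneg_left hτt
        (mul_nonneg (mul_nonneg (mul_nonneg zero_le_two hf) hD0) (mul_nonneg hL hδ))
      linarith
    have b3 : rateBound k f M μin t * L * |t - τ| ≤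
        rateBound k f M μin t * (L * (1 / (N + 1))) := by
      rw [abs_of_nonneg (sub_nonneg.2 hτt), mul_assoc]
      refine mul_le_mul_of_nonneg_left (mul_le_mul_of_nonneg_left ?_ hL)
        (H.rateBound_nonneg μin t)
      linarith [hfl' t]
    rw [heq t ht φ hφ.continuous.measurable hφb, ← e4]
    have a1 := abs_le.1 (e1.trans b1)
    have a2 := abs_le.1 (e2.trans b2)
    have a3 := abs_le.1 (e3.trans b3)
    rw [abs_le]
    constructor <;> linarith [a1.1, a1.2, a2.1, a2.2, a3.1, a3.2]

end Subordinate
end CoagFrag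

/-! ### Weak compactness of measures on `(0, 1]`, moments, product measures. -/

namespace CoagFrag

theorem integrable_of_continuous_of_bound (ν : FiniteMeasure Size) {w : Size → ℝ}
    (hw : Continuous w) {C : ℝ} (hC : ∀ x, |w x| ≤ C) : Integrable w (ν : Measure Size) :=
  Integrable.mono' (integrable_const C) hw.aestronglyMeasurable (Eventually.of_forall hC)

theorem integral_polynomial_eq_of_moments {μ ν : FiniteMeasure Size}
    (h : ∀ m : ℕ, ∫ x : Size, (x : ℝ) ^ (m + 1) ∂(μ : Measure Size) =
      ∫ x : Size, (x : ℝ) ^ (m + 1) ∂(ν : Measure Size)) (p : Polynomial ℝ) :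
    ∫ x : Size, x * p.eval (x : ℝ) ∂(μ : Measure Size) =
      ∫ x : Size, x * p.eval (x : ℝ) ∂(ν : Measure Size) := by
  have hint : ∀ (κ : FiniteMeasure Size) (i : ℕ),
      Integrable (fun x : Size => p.coeff i * (x : ℝ) ^ (i + 1)) (κ : Measure Size) := fun κ i =>
    (integrable_of_continuous_of_bound κ (C := 1) (by fun_prop) fun x => by
      rw [abs_of_nonneg (pow_nonneg x.2.1.le _)]
      exact pow_le_one₀ x.2.1.le x.2.2).const_mul _
  have e : ∀ x : Size, x * p.eval (x : ℝ) =
      ∑ i ∈ Finset.range (p.natDegree + 1), p.coeff i * (x : ℝ) ^ (i + 1) := fun x => by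
    rw [Polynomial.eval_eq_sum_range, Finset.mul_sum]
    exact Finset.sum_congr rfl fun i _ => by ring
  simp only [e]
  rw [integral_finsetSum _ fun i _ => hint μ i, integral_finsetSum _ fun i _ => hint ν i]
  simp only [integral_const_mul, h]

/-- Weierstrass approximation of `w` on `[0, 1]`: the factor `x` turns polynomials into combinations
of moments of order at least `1`. -/
theorem integral_mul_eq_of_moments {μ ν : FiniteMeasure Size}
    (h : ∀ m : ℕ, ∫ x : Size, (x : ℝ) ^ (m + 1) ∂(μ : Measure Size) =
      ∫ x : Size, (x : ℝ) ^ (m + 1) ∂(ν : Measure Size)) {w : ℝ → ℝ} (hw : Continuous w) :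
    ∫ x : Size, x * w x ∂(μ : Measure Size) = ∫ x : Size, x * w x ∂(ν : Measure Size) := by
  have key : ∀ (κ : FiniteMeasure Size) (ε : ℝ) (p : Polynomial ℝ),
      (∀ x ∈ Icc (0 : ℝ) 1, |p.eval x - w x| < ε) →
      |(∫ x : Size, x * p.eval (x : ℝ) ∂(κ : Measure Size)) -
        ∫ x : Size, x * w x ∂(κ : Measure Size)| ≤ ε * (κ : Measure Size).real univ := by
    intro κ ε p hp
    have hb : ∀ v : ℝ → ℝ, Continuous v →
        Integrable (fun x : Size => x * v x) (κ : Measure Size) := by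
      intro v hv
      obtain ⟨C, hC⟩ := isCompact_Icc.exists_bound_of_continuousOn (s := Icc (0 : ℝ) 1)
        (f := fun x => x * v x) (by fun_prop)
      exact integrable_of_continuous_of_bound κ (by fun_prop) fun x => hC x ⟨x.2.1.le, x.2.2⟩
    rw [← integral_sub (hb _ p.continuous) (hb _ hw), ← Real.norm_eq_abs]
    refine norm_integral_le_of_norm_le_const (Eventually.of_forall fun x => ?_)
    rw [← mul_sub, norm_mul, Real.norm_eq_abs, Real.norm_eq_abs, abs_of_pos x.2.1]
    have := (hp x ⟨x.2.1.le, x.2.2⟩).le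
    exact (mul_le_of_le_one_left (abs_nonneg _) x.2.2).trans this
  set A := (μ : Measure Size).real univ + (ν : Measure Size).real univ with hA
  have hA0 : 0 ≤ A := add_nonneg measureReal_nonneg measureReal_nonneg
  refine eq_of_abs_sub_le_all fun ε hε => ?_
  obtain ⟨p, hp⟩ := exists_polynomial_near_of_continuousOn 0 1 w hw.continuousOn
    (ε / (A + 1)) (by positivity)
  have h1 := abs_le.1 (key μ _ p hp)
  have h2 := abs_le.1 (key ν _ p hp)
  rw [integral_polynomial_eq_of_moments h] at h1
  have h3 : ε / (A + 1) * A ≤ ε := by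
    rw [div_mul_eq_mul_div, div_le_iff₀ (by positivity)]
    nlinarith
  rw [hA, mul_add] at h3
  rw [abs_le]
  constructor <;> linarith [h1.1, h1.2, h2.1, h2.2]

/-- Projection of the real line onto `[1 / (n + 1), 1]`. -/
noncomputable def clampSize (n : ℕ) (x : ℝ) : Size :=
  ⟨max (1 / ((n : ℝ) + 1)) (min x 1), lt_max_of_lt_left (by positivity),
    max_le ((div_le_one (by positivity)).2 (by linarith [n.cast_nonneg (α := ℝ)]))
      (min_le_right _ _)⟩

theorem continuous_clampSize (n : ℕ) : Continuous (clampSize n) := by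
  unfold clampSize
  fun_prop

theorem eventually_clampSize_eq (x : Size) : ∀ᶠ n in atTop, clampSize n x = x := by
  have h := (tendsto_one_div_add_atTop_nhds_zero_nat (𝕜 := ℝ)).eventually (gt_mem_nhds x.2.1)
  filter_upwards [h] with n hn
  exact Subtype.ext (by simp only [clampSize, min_eq_left x.2.2, max_eq_right hn.le])

/-- The moment of order `0` is dispensable because `0` is not in the space. A bounded continuous `v`
is the pointwise limit of `x * (v (c x) / c x)`, with `c` the projection onto `[1 / (n + 1), 1]`.
These functions have the form `x * w x` with `w` continuous, and `x ≤ c x` makes them bounded by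
`‖v‖`. -/
theorem ext_of_moments {μ ν : FiniteMeasure Size}
    (h : ∀ m : ℕ, ∫ x : Size, (x : ℝ) ^ (m + 1) ∂(μ : Measure Size) =
      ∫ x : Size, (x : ℝ) ^ (m + 1) ∂(ν : Measure Size)) : μ = ν := by
  refine Subtype.ext (ext_of_forall_integral_eq_of_IsFiniteMeasure
    (μ := (μ : Measure Size)) (ν := (ν : Measure Size)) fun v => ?_)
  have hcont : ∀ n : ℕ, Continuous fun x : ℝ => v (clampSize n x) / (clampSize n x : ℝ) :=
    fun n => (v.continuous.comp (continuous_clampSize n)).div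
      (continuous_subtype_val.comp (continuous_clampSize n)) fun x => (clampSize n x).2.1.ne'
  have key : ∀ κ : FiniteMeasure Size, Tendsto (fun n : ℕ => ∫ x : Size,
      x * (v (clampSize n x) / (clampSize n x : ℝ)) ∂(κ : Measure Size)) atTop
      (𝓝 (∫ x : Size, v x ∂(κ : Measure Size))) := by
    intro κ
    refine tendsto_integral_of_dominated_convergence (fun _ => ‖v‖)
      (fun n => (continuous_subtype_val.mul
        ((hcont n).comp continuous_subtype_val)).aestronglyMeasurable) (integrable_const _)
      (fun n => Eventually.of_forall fun x => ?_) (Eventually.of_forall fun x => ?_)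
    · have hx := x.2
      have hc := (clampSize n x).2.1
      have h1 : (x : ℝ) ≤ clampSize n x := le_max_of_le_right (le_min le_rfl hx.2)
      rw [norm_mul, norm_div, Real.norm_eq_abs, Real.norm_eq_abs (clampSize n x : ℝ),
        abs_of_pos hx.1, abs_of_pos hc, mul_div_assoc', div_le_iff₀ hc, mul_comm ‖v‖]
      exact mul_le_mul h1 (v.norm_coe_le_norm _) (norm_nonneg _) hc.le
    · refine tendsto_const_nhds.congr' ?_
      filter_upwards [eventually_clampSize_eq x] with n hn
      rw [hn, mul_div_cancel₀ _ x.2.1.ne']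
  refine tendsto_nhds_unique (key μ) ((key ν).congr fun n => ?_)
  exact (integral_mul_eq_of_moments h (hcont n)).symm

theorem tendsto_real_tail (μ : FiniteMeasure Size) :
    Tendsto (fun n : ℕ => (μ : Measure Size).real {x | (x : ℝ) ≤ 1 / ((n : ℝ) + 1)}) atTop
      (𝓝 0) := by
  have h1 : Tendsto (fun n : ℕ => (μ : Measure Size) {x | (x : ℝ) ≤ 1 / ((n : ℝ) + 1)}) atTop
      (𝓝 ((μ : Measure Size) (⋂ n : ℕ, {x : Size | (x : ℝ) ≤ 1 / ((n : ℝ) + 1)}))) := by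
    refine tendsto_measure_iInter_atTop (fun n => (measurableSet_le measurable_subtype_coe
      measurable_const).nullMeasurableSet) (fun m n hmn x hx => ?_) ⟨0, measure_ne_top _ _⟩
    exact le_trans (show (x : ℝ) ≤ 1 / ((n : ℝ) + 1) from hx) (Nat.one_div_le_one_div hmn)
  have h2 : (⋂ n : ℕ, {x : Size | (x : ℝ) ≤ 1 / ((n : ℝ) + 1)}) = ∅ := by
    refine eq_empty_of_forall_notMem fun x hx => ?_
    obtain ⟨n, hn⟩ := exists_nat_one_div_lt x.2.1
    exact absurd (mem_iInter.1 hx n) (not_le.2 hn)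
  rw [h2, measure_empty] at h1
  exact (ENNReal.tendsto_toReal ENNReal.zero_ne_top).comp h1

/-- Bounded families of measures on `(0, 1]` whose mass near `0` is uniformly small are
relatively compact, and moments identify the limits. -/
theorem exists_tendsto_of_moments (μin : FiniteMeasure Size) (C c : ℝ)
    {ν : ℕ → FiniteMeasure Size}
    (hC : ∀ᶠ n in atTop, (ν n : Measure Size).real univ ≤ C)
    (hc : ∀ᶠ n in atTop, ∀ ε : ℝ, 0 ≤ ε → (ν n : Measure Size).real {x | (x : ℝ) ≤ ε} ≤
      (μin : Measure Size).real {x | (x : ℝ) ≤ ε} + c * ε)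
    (hm : ∀ m : ℕ, ∃ a, Tendsto (fun n => ∫ x : Size, (x : ℝ) ^ (m + 1) ∂(ν n : Measure Size))
      atTop (𝓝 a)) : ∃ μ, Tendsto ν atTop (𝓝 μ) := by
  choose a ha using hm
  set u : ℕ → ℝ≥0 := fun n => ((μin : Measure Size).real {x | (x : ℝ) ≤ 1 / ((n : ℝ) + 1)} +
    c * (1 / ((n : ℝ) + 1))).toNNReal with hu
  set Q : ℕ → Set Size := fun n => {x | 1 / ((n : ℝ) + 1) ≤ (x : ℝ)} with hQ
  have hu0 : Tendsto u atTop (𝓝 0) := by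
    have h1 := (tendsto_real_tail μin).add
      ((tendsto_one_div_add_atTop_nhds_zero_nat (𝕜 := ℝ)).const_mul c)
    have h2 := (continuous_real_toNNReal.tendsto _).comp h1
    rwa [mul_zero, add_zero, Real.toNNReal_zero] at h2
  have hQc : ∀ n, IsCompact (Q n) := by
    intro n
    rw [Subtype.isCompact_iff]
    have : ((↑) '' Q n : Set ℝ) = Icc (1 / ((n : ℝ) + 1)) 1 := by
      ext x
      constructor
      · rintro ⟨y, hy, rfl⟩
        exact ⟨hy, y.2.2⟩
      · intro hx
        exact ⟨⟨x, lt_of_lt_of_le (by positivity) hx.1, hx.2⟩, hx.1, rfl⟩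
    rw [this]
    exact isCompact_Icc
  have hQm : Monotone Q := fun m n hmn x hx =>
    le_trans (Nat.one_div_le_one_div hmn) (show 1 / ((m : ℝ) + 1) ≤ (x : ℝ) from hx)
  -- Prokhorov's theorem: the compact sets `Q n` exhaust `(0, 1]`, and `u n`, the tail bound at `ε =
  -- 1 / (n + 1)`, tends to `0`.
  have hS := isCompact_setOfPred_finiteMeasure_mass_le_compl_isCompact_le (E := Size) C.toNNReal
    hu0 hQc (Or.inr hQm)
  have hmem : ∀ᶠ n in atTop, ν n ∈ {μ : FiniteMeasure Size | μ.mass ≤ C.toNNReal ∧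
      ∀ n, μ (Q n)ᶜ ≤ u n} := by
    filter_upwards [hC, hc] with n h1 h2
    refine ⟨?_, fun i => ?_⟩
    · exact NNReal.le_toNNReal_of_coe_le h1
    · refine NNReal.le_toNNReal_of_coe_le (le_trans ?_ (h2 _ (by positivity)))
      exact measureReal_mono fun x hx => (not_le.1 (show ¬ 1 / ((i : ℝ) + 1) ≤ (x : ℝ) from hx)).le
  -- Moments are weakly continuous, so all cluster points have the moments `a` and coincide; in a
  -- compact set this forces convergence.
  have hcl : ∀ κ : FiniteMeasure Size, MapClusterPt κ atTop ν → ∀ m : ℕ,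
      ∫ x : Size, (x : ℝ) ^ (m + 1) ∂(κ : Measure Size) = a m := by
    intro κ hκ m
    have hcont : Continuous fun κ : FiniteMeasure Size =>
        ∫ x : Size, (x : ℝ) ^ (m + 1) ∂(κ : Measure Size) := by
      let b : BoundedContinuousFunction Size ℝ := BoundedContinuousFunction.ofNormedAddCommGroup
        (fun x : Size => (x : ℝ) ^ (m + 1)) (by fun_prop) 1 fun x => by
          rw [Real.norm_eq_abs, abs_of_nonneg (pow_nonneg x.2.1.le _)]
          exact pow_le_one₀ x.2.1.le x.2.2
      refine continuous_iff_continuousAt.2 fun κ => ?_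
      exact (FiniteMeasure.tendsto_iff_forall_integral_tendsto.1 tendsto_id) b
    have h1 := hκ.continuousAt_comp hcont.continuousAt
    exact eq_of_nhds_neBot (h1.clusterPt.neBot.mono (inf_le_inf_left _ (ha m)))
  obtain ⟨μ, -, hμ⟩ := hS.exists_mapClusterPt_of_frequently hmem.frequently
  refine ⟨μ, hS.tendsto_nhds_of_unique_mapClusterPt hmem fun κ _ hκ => ext_of_moments fun m => ?_⟩
  rw [hcl κ hκ m, hcl μ hμ m]

/-- Reduces weak convergence of `ν ⊗ ν` to that of products of probability measures. -/
theorem integral_prod_eq_normalize (ν : FiniteMeasure Size) (w : Size × Size → ℝ) :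
    ∫ p, w p ∂((ν : Measure Size).prod (ν : Measure Size)) = (ν.mass : ℝ) * ((ν.mass : ℝ) *
      ∫ p, w p ∂((ν.normalize : Measure Size).prod (ν.normalize : Measure Size))) := by
  have h : (ν : Measure Size) = ν.mass • (ν.normalize : Measure Size) := by
    conv_lhs => rw [ν.self_eq_mass_smul_normalize]
    rfl
  conv_lhs => rw [h]
  rw [Measure.prod_smul_left, Measure.prod_smul_right, integral_smul_nnreal_measure,
    integral_smul_nnreal_measure]
  rfl

theorem tendsto_integral_prod {ν : ℕ → FiniteMeasure Size} {μ : FiniteMeasure Size}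
    (h : Tendsto ν atTop (𝓝 μ)) {w : Size × Size → ℝ} (hw : Continuous w) {C : ℝ}
    (hC : ∀ p, |w p| ≤ C) :
    Tendsto (fun n => ∫ p, w p ∂((ν n : Measure Size).prod (ν n : Measure Size))) atTop
      (𝓝 (∫ p, w p ∂((μ : Measure Size).prod (μ : Measure Size)))) := by
  have hmass : Tendsto (fun n => ((ν n).mass : ℝ)) atTop (𝓝 (μ.mass : ℝ)) :=
    (NNReal.continuous_coe.tendsto _).comp (FiniteMeasure.continuous_mass.tendsto μ |>.comp h)
  simp only [integral_prod_eq_normalize]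
  let b : BoundedContinuousFunction (Size × Size) ℝ :=
    BoundedContinuousFunction.ofNormedAddCommGroup w hw C hC
  have hb : ∀ κ : FiniteMeasure Size,
      |∫ p, w p ∂((κ.normalize : Measure Size).prod (κ.normalize : Measure Size))| ≤ C :=
    fun κ => by
      have := norm_integral_le_of_norm_le_const
        (μ := (κ.normalize : Measure Size).prod (κ.normalize : Measure Size)) (f := w)
        (Eventually.of_forall hC)
      simpa using this
  -- Normalization is not continuous at the zero measure, but there the integrals are bounded by `C`
  -- times the square of a mass tending to `0`.
  by_cases hμ : μ = 0
  · have h0 : (μ.mass : ℝ) = 0 := by simp [hμ]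
    rw [h0] at hmass ⊢
    rw [zero_mul]
    refine squeeze_zero_norm (fun n => ?_) (a := fun n => ((ν n).mass : ℝ) *
      (((ν n).mass : ℝ) * C)) ?_
    · rw [norm_mul, norm_mul, Real.norm_of_nonneg (NNReal.coe_nonneg _)]
      gcongr
      exact hb _
    · simpa using hmass.mul (hmass.mul_const C)
  · refine hmass.mul (hmass.mul ?_)
    have h1 := FiniteMeasure.tendsto_normalize_of_tendsto h hμ
    have h2 := (ProbabilityMeasure.continuous_prod.tendsto (μ.normalize, μ.normalize)).comp
      (h1.prodMk_nhds h1)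
    exact (ProbabilityMeasure.tendsto_iff_forall_integral_tendsto.1 h2) b

end CoagFrag

/-! ### Passage to the limit: existence of a weak solution. -/

namespace CoagFrag

/-- `x ↦ x ^ (m + 1)` on `[0, 1]`, extended to a Lipschitz function on the real line. -/
def clampPow (m : ℕ) (x : ℝ) : ℝ := (max 0 (min x 1)) ^ (m + 1)

theorem clampPow_eq (m : ℕ) (x : Size) : clampPow m x = (x : ℝ) ^ (m + 1) := by
  rw [clampPow, min_eq_left x.2.2, max_eq_right x.2.1.le]

theorem lipAtZero_clampPow (m : ℕ) : LipAtZero ((m : ℝ) + 1) (clampPow m) where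
  zero := by simp [clampPow]
  lip x y := by
    have h1 : ∀ z : ℝ, |max 0 (min z 1)| ≤ 1 := fun z => by
      rw [abs_of_nonneg (le_max_left _ _)]
      exact max_le zero_le_one (min_le_right _ _)
    have h2 : |max 0 (min x 1) - max 0 (min y 1)| ≤ |x - y| :=
      by
      have h3 := abs_max_sub_max_le_max 0 (min x 1) 0 (min y 1)
      have h4 := abs_min_sub_min_le_max x 1 y 1
      rw [sub_self, abs_zero] at h3 h4
      rw [max_eq_right (abs_nonneg (min x 1 - min y 1))] at h3
      rw [max_eq_left (abs_nonneg (x - y))] at h4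
      exact h3.trans h4
    calc |clampPow m x - clampPow m y|
        ≤ |max 0 (min x 1) - max 0 (min y 1)| * ((m + 1 : ℕ) : ℝ) *
          max |max 0 (min x 1)| |max 0 (min y 1)| ^ (m + 1 - 1) := abs_pow_sub_pow_le ..
      _ ≤ |x - y| * ((m + 1 : ℕ) : ℝ) * 1 := by
          gcongr
          exact pow_le_one₀ (le_max_of_le_left (abs_nonneg _)) (max_le (h1 x) (h1 y))
      _ = ((m : ℝ) + 1) * |x - y| := by push_cast; ring

/-- The constant in the error of the approximate solutions, up to time `t`. -/
noncomputable def errorBound (k f M : ℝ) (μin : FiniteMeasure Size) (t : ℝ) : ℝ :=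
  massBound f M μin t + t * (2 * f * massBound f M μin t) + rateBound k f M μin t

variable {K F : ℝ → ℝ → ℝ} {g : ℝ≥0 → L1Large} {k f ρ M : ℝ} {μin : FiniteMeasure Size}

theorem Subordinate.errorBound_mono (H : Subordinate K F g k f ρ M) {s t : ℝ} (hs : 0 ≤ s)
    (hst : s ≤ t) : errorBound k f M μin s ≤ errorBound k f M μin t := by
  have h1 := H.massBound_mono μin hst
  have h2 := H.massBound_nonneg μin s
  have h3 := H.rateBound_mono μin hst
  have h4 := H.f_nonneg
  have h5 := hs.trans hst
  unfold errorBound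
  gcongr

/-- Since `φ` is Lipschitz and vanishes at `0`, each integrand against `ν` or `ν ⊗ ν` is bounded and
continuous, so weak convergence suffices even for the quadratic term. -/
theorem Subordinate.tendsto_rate (H : Subordinate K F g k f ρ M) {ν : ℕ → FiniteMeasure Size}
    {μ : FiniteMeasure Size} (h : Tendsto ν atTop (𝓝 μ)) {L : ℝ} {φ : ℝ → ℝ}
    (hφ : LipAtZero L φ) (t : ℝ≥0) :
    Tendsto (fun n => rate K F g t (ν n) φ) atTop (𝓝 (rate K F g t μ φ)) := by
  have hb : ∀ (w : Size → ℝ) (C : ℝ), Continuous w → (∀ x, |w x| ≤ C) →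
      Tendsto (fun n => ∫ x, w x ∂(ν n : Measure Size)) atTop
        (𝓝 (∫ x, w x ∂(μ : Measure Size))) := fun w C hw hC =>
    FiniteMeasure.tendsto_iff_forall_integral_tendsto.1 h
      (BoundedContinuousFunction.ofNormedAddCommGroup w hw C hC)
  have h1 := tendsto_integral_prod h (H.continuous_coagulation hφ.continuous)
    fun p => H.abs_K_mul_opA_le hφ p.1.2 p.2.2
  have h2 := hb _ _ (H.continuous_loss hφ.continuous t) (H.abs_lossG_mul_le_of_lip hφ t)
  have h3 := hb _ _ (H.continuous_opB hφ.continuous fun _ => hφ.abs_le_one)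
    fun x => H.abs_opB_le_of_bound (fun _ => hφ.abs_le_one) x.2
  simp only [fun κ => H.rate_eq (H.testable_of_lip κ hφ) t]
  exact (((h1.const_mul (1 / 2)).sub h2).sub h3).add_const _

namespace IsApproxSolution

variable {N : ℕ} {μ : ℝ≥0 → FiniteMeasure Size}

theorem abs_rate_le (H : Subordinate K F g k f ρ M) (hμ : IsApproxSolution K F g k f M μin N μ)
    {L : ℝ} {φ : ℝ → ℝ} (hφ : LipAtZero L φ) {s t : ℝ} (hs : 0 ≤ s) (hst : s ≤ t) (ht : t ≤ N) :
    |rate K F g s.toNNReal (μ s.toNNReal) φ| ≤ rateBound k f M μin t * L := by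
  have h1 := hμ.mass_le s.toNNReal (by
    rw [Real.toNNReal_le_iff_le_coe]; simpa using hst.trans ht)
  rw [Real.coe_toNNReal s hs] at h1
  exact H.abs_rate_le_of_lip hφ (h1.trans (H.massBound_mono μin hst)) _

/-- The approximations jump in time, so they are Lipschitz in time only up to an error that vanishes
as `N → ∞`. -/
theorem equicontinuous (H : Subordinate K F g k f ρ M)
    (hμ : IsApproxSolution K F g k f M μin N μ)
    {L : ℝ} {φ : ℝ → ℝ} (hφ : LipAtZero L φ) {s t T : ℝ≥0} (hs : s ≤ T) (ht : t ≤ T)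
    (hT : T ≤ N) : |(∫ x : Size, φ x ∂(μ t : Measure Size)) -
      ∫ x : Size, φ x ∂(μ s : Measure Size)| ≤
        (rateBound k f M μin T * |(t : ℝ) - s| + 2 * errorBound k f M μin T * (1 / (N + 1))) * L := by
  have hL := hφ.nonneg
  have e : ∀ r : ℝ≥0, r ≤ T → |(∫ x : Size, φ x ∂(μ r : Measure Size)) -
      (∫ x : Size, φ x ∂(μin : Measure Size)) -
      ∫ s in (0 : ℝ)..r, rate K F g s.toNNReal (μ s.toNNReal) φ| ≤
      errorBound k f M μin T * (L * (1 / (N + 1))) := fun r hr =>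
    (hμ.equation r (hr.trans hT) L φ hφ).trans (mul_le_mul_of_nonneg_right
      (H.errorBound_mono r.coe_nonneg hr) (by positivity))
  have e1 : (∫ r in (0 : ℝ)..s, rate K F g r.toNNReal (μ r.toNNReal) φ) +
      ∫ r in (s : ℝ)..t, rate K F g r.toNNReal (μ r.toNNReal) φ =
      ∫ r in (0 : ℝ)..t, rate K F g r.toNNReal (μ r.toNNReal) φ :=
    intervalIntegral.integral_add_adjacent_intervals (hμ.intervalIntegrable s L φ hφ)
      ((hμ.intervalIntegrable s L φ hφ).symm.trans (hμ.intervalIntegrable t L φ hφ))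
  have e2 : |∫ r in (s : ℝ)..t, rate K F g r.toNNReal (μ r.toNNReal) φ| ≤
      rateBound k f M μin T * L * |(t : ℝ) - s| := by
    rw [← Real.norm_eq_abs]
    refine intervalIntegral.norm_integral_le_of_norm_le_const fun r hr => ?_
    exact hμ.abs_rate_le H hφ ((le_min s.coe_nonneg t.coe_nonneg).trans hr.1.le)
      (hr.2.trans (max_le hs ht)) (by exact_mod_cast hT)
  have a1 := abs_le.1 (e s hs)
  have a2 := abs_le.1 (e t ht)
  have a3 := abs_le.1 e2
  rw [abs_le]
  constructor <;> linarith [a1.1, a1.2, a2.1, a2.2, a3.1, a3.2]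

theorem abs_moment_le (H : Subordinate K F g k f ρ M)
    (hμ : IsApproxSolution K F g k f M μin N μ) {t : ℝ≥0} (ht : t ≤ N) (m : ℕ) :
    |∫ x : Size, clampPow m x ∂(μ t : Measure Size)| ≤ massBound f M μin t := by
  have h1 := norm_integral_le_of_norm_le_const (μ := (μ t : Measure Size))
    (f := fun x : Size => clampPow m x) (C := 1) (Eventually.of_forall fun x => by
      rw [clampPow_eq, Real.norm_eq_abs, abs_of_nonneg (pow_nonneg x.2.1.le _)]
      exact pow_le_one₀ x.2.1.le x.2.2)
  rw [one_mul, Real.norm_eq_abs] at h1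
  linarith [hμ.mass_le t ht, H.M_nonneg]

end IsApproxSolution

/-- The family of approximate solutions has a subsequence that converges weakly at all times. -/
theorem exists_subseq_tendsto (H : Subordinate K F g k f ρ M)
    {μ : ℕ → ℝ≥0 → FiniteMeasure Size}
    (hμ : ∀ N, IsApproxSolution K F g k f M μin N (μ N)) :
    ∃ ψ : ℕ → ℕ, StrictMono ψ ∧ ∀ t, ∃ ν, Tendsto (fun n => μ (ψ n) t) atTop (𝓝 ν) := by
  classical
  set τ : ℕ → ℝ≥0 := TopologicalSpace.denseSeq ℝ≥0 with hτ
  -- `μ N` is controlled up to time `N` only; later times get the dummy value `0`. A fixed time is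
  -- affected for finitely many indices of the subsequence.
  set a : ℕ → ℕ × ℕ → ℝ := fun N j => if τ j.1 ≤ N then
    ∫ x : Size, clampPow j.2 x ∂(μ N (τ j.1) : Measure Size) else 0 with ha
  have hmem : ∀ N, a N ∈ Set.pi univ fun j : ℕ × ℕ =>
      Icc (-massBound f M μin (τ j.1)) (massBound f M μin (τ j.1)) := by
    intro N j _
    have h0 := H.massBound_nonneg μin (τ j.1)
    simp only [ha]
    split_ifs with h
    · exact abs_le.1 ((hμ N).abs_moment_le H h j.2)
    · exact ⟨by linarith, h0⟩
  -- Sequential compactness of a countable product of intervals replaces the diagonal argument over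
  -- moments and dense times.
  obtain ⟨b, -, ψ, hψ, hlim⟩ := (isCompact_univ_pi fun j : ℕ × ℕ =>
    isCompact_Icc (a := -massBound f M μin (τ j.1))
      (b := massBound f M μin (τ j.1))).tendsto_subseq hmem
  have hlarge : ∀ T : ℝ≥0, ∀ᶠ n in atTop, T ≤ (ψ n : ℝ≥0) := fun T => by
    obtain ⟨n₀, hn₀⟩ := exists_nat_ge T
    filter_upwards [eventually_ge_atTop n₀] with n hn
    exact hn₀.trans (by exact_mod_cast hn.trans (hψ.id_le n))
  have hrat : ∀ q m : ℕ, Tendsto (fun n => ∫ x : Size, clampPow m x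
      ∂(μ (ψ n) (τ q) : Measure Size)) atTop (𝓝 (b (q, m))) := by
    intro q m
    refine ((tendsto_pi_nhds.1 hlim) (q, m)).congr' ?_
    filter_upwards [hlarge (τ q)] with n hn
    simp only [Function.comp, ha, if_pos hn]
  refine ⟨ψ, hψ, fun t => exists_tendsto_of_moments μin (massBound f M μin t)
    (t * (f * massBound f M μin t)) ?_ ?_ fun m => ?_⟩
  · filter_upwards [hlarge t] with n hn
    linarith [(hμ (ψ n)).mass_le t hn, H.M_nonneg]
  · filter_upwards [hlarge t] with n hn
    exact (hμ (ψ n)).tail_le t hn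
  · simp only [← clampPow_eq]
    refine cauchySeq_tendsto_of_complete (Metric.cauchySeq_iff'.2 fun ε hε => ?_)
    set T : ℝ≥0 := t + 1 with hT
    set R := rateBound k f M μin T
    set E := errorBound k f M μin T
    have hR : 0 ≤ R := H.rateBound_nonneg μin T
    have hm : (0 : ℝ) < (m : ℝ) + 1 := by positivity
    -- With a dense time `τ q` within `δ` of `t`, the Lipschitz part of `equicontinuous` is at most
    -- `ε / 8`, and the error part is eventually below `ε / 8`. Four quarters of `ε` then give the
    -- Cauchy property at `t`. The `+ 1` after `R` excludes division by zero.
    set δ : ℝ := ε / (8 * (R + 1) * (m + 1)) with hδ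
    have hδ0 : 0 < δ := by positivity
    obtain ⟨_, ⟨q, rfl⟩, hq1, hq2⟩ := (TopologicalSpace.denseRange_denseSeq ℝ≥0).exists_between
      (show t < t + min 1 δ.toNNReal from lt_add_of_pos_right _
        (lt_min one_pos (Real.toNNReal_pos.2 hδ0)))
    change t < τ q at hq1
    change τ q < t + min 1 δ.toNNReal at hq2
    have hqT : τ q ≤ T := hq2.le.trans (add_le_add le_rfl (min_le_left _ _))
    have hqδ : |(t : ℝ) - τ q| ≤ δ := by
      have h1 : τ q ≤ t + δ.toNNReal := hq2.le.trans (add_le_add le_rfl (min_le_right _ _))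
      have h2 : (τ q : ℝ) ≤ t + δ := by
        have h3 : (τ q : ℝ) ≤ ((t + δ.toNNReal : ℝ≥0) : ℝ) := by exact_mod_cast h1
        rwa [NNReal.coe_add, Real.coe_toNNReal δ hδ0.le] at h3
      have h4 : (t : ℝ) ≤ τ q := by exact_mod_cast hq1.le
      rw [abs_sub_comm, abs_of_nonneg (by linarith)]
      linarith
    have hE : Tendsto (fun n => 2 * E * (1 / ((ψ n : ℝ) + 1)) * (m + 1)) atTop (𝓝 0) := by
      have := ((tendsto_one_div_add_atTop_nhds_zero_nat (𝕜 := ℝ)).comp hψ.tendsto_atTop)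
      simpa using (this.const_mul (2 * E)).mul_const ((m : ℝ) + 1)
    have hclose : ∀ᶠ n in atTop, |(∫ x : Size, clampPow m x ∂(μ (ψ n) t : Measure Size)) -
        ∫ x : Size, clampPow m x ∂(μ (ψ n) (τ q) : Measure Size)| < ε / 4 := by
      filter_upwards [hlarge T, hE.eventually (gt_mem_nhds (show (0 : ℝ) < ε / 8 by positivity))]
        with n hn hn'
      refine ((hμ (ψ n)).equicontinuous H (lipAtZero_clampPow m) hqT
        (le_add_of_nonneg_right zero_le_one) hn).trans_lt ?_
      have h1 : R * |(t : ℝ) - τ q| * (m + 1) ≤ ε / 8 := by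
        calc R * |(t : ℝ) - τ q| * (m + 1) ≤ (R + 1) * δ * (m + 1) := by
              gcongr
              linarith
          _ = ε / 8 := by rw [hδ]; field_simp
      rw [add_mul]
      linarith
    obtain ⟨n₁, hn₁⟩ := Metric.cauchySeq_iff'.1 (hrat q m).cauchySeq (ε / 4) (by positivity)
    obtain ⟨n₂, hn₂⟩ := eventually_atTop.1 hclose
    refine ⟨max n₁ n₂, fun n hn => ?_⟩
    have c1 := hn₁ n ((le_max_left _ _).trans hn)
    have c2 := hn₁ (max n₁ n₂) (le_max_left _ _)
    have c3 := hn₂ n ((le_max_right _ _).trans hn)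
    have c4 := hn₂ (max n₁ n₂) (le_max_right _ _)
    rw [Real.dist_eq] at c1 c2 ⊢
    rw [abs_lt] at c1 c2 c3 c4 ⊢
    constructor <;> linarith [c1.1, c1.2, c2.1, c2.2, c3.1, c3.2, c4.1, c4.2]

/-- A weak solution: the equation holds for globally Lipschitz functions vanishing at `0`. -/
theorem exists_weakSolution (H : Subordinate K F g k f ρ M) (μin : FiniteMeasure Size) :
    ∃ μ : ℝ≥0 → FiniteMeasure Size,
      (∀ t, (μ t : Measure Size).real univ + M ≤ massBound f M μin t) ∧
      ∀ (L : ℝ) (φ : ℝ → ℝ), LipAtZero L φ → ∀ t : ℝ≥0,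
        IntervalIntegrable (fun s : ℝ => rate K F g s.toNNReal (μ s.toNNReal) φ) volume 0 t ∧
        ∫ x : Size, φ x ∂(μ t : Measure Size) = (∫ x : Size, φ x ∂(μin : Measure Size)) +
          ∫ s in (0 : ℝ)..t, rate K F g s.toNNReal (μ s.toNNReal) φ := by
  choose μ' hμ' using H.exists_isApproxSolution μin
  obtain ⟨ψ, hψ, hlim⟩ := exists_subseq_tendsto H hμ'
  choose μ hμ using hlim
  have hlarge : ∀ T : ℝ≥0, ∀ᶠ n in atTop, T ≤ (ψ n : ℝ≥0) := fun T => by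
    obtain ⟨n₀, hn₀⟩ := exists_nat_ge T
    filter_upwards [eventually_ge_atTop n₀] with n hn
    exact hn₀.trans (by exact_mod_cast hn.trans (hψ.id_le n))
  refine ⟨μ, fun t => ?_, fun L φ hφ t => ?_⟩
  · have h1 : Tendsto (fun n => ((μ' (ψ n) t : FiniteMeasure Size) : Measure Size).real univ + M)
        atTop (𝓝 ((μ t : Measure Size).real univ + M)) :=
      ((NNReal.continuous_coe.tendsto _).comp
        ((FiniteMeasure.continuous_mass.tendsto (μ t)).comp (hμ t))).add_const M
    refine le_of_tendsto h1 ?_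
    filter_upwards [hlarge t] with n hn
    exact (hμ' (ψ n)).mass_le t hn
  · have hrate : ∀ s : ℝ, Tendsto (fun n => rate K F g s.toNNReal (μ' (ψ n) s.toNNReal) φ) atTop
        (𝓝 (rate K F g s.toNNReal (μ s.toNNReal) φ)) := fun s => H.tendsto_rate (hμ _) hφ _
    have hmeas : ∀ n, AEStronglyMeasurable
        (fun s : ℝ => rate K F g s.toNNReal (μ' (ψ n) s.toNNReal) φ)
        (volume.restrict (uIoc 0 (t : ℝ))) := fun n =>
      ((hμ' (ψ n)).intervalIntegrable t L φ hφ).def'.aestronglyMeasurable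
    have hbound : ∀ᶠ n in atTop, ∀ s ∈ uIoc 0 (t : ℝ),
        ‖rate K F g s.toNNReal (μ' (ψ n) s.toNNReal) φ‖ ≤ rateBound k f M μin t * L := by
      filter_upwards [hlarge t] with n hn s hs
      rw [uIoc_of_le t.coe_nonneg] at hs
      exact (hμ' (ψ n)).abs_rate_le H hφ hs.1.le hs.2 (by exact_mod_cast hn)
    -- Measurability in time of the limit rate is inherited from the approximations, of which it is
    -- the pointwise limit.
    have hint : IntervalIntegrable (fun s : ℝ => rate K F g s.toNNReal (μ s.toNNReal) φ)
        volume 0 t := by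
      refine (intervalIntegrable_const (c := rateBound k f M μin t * L)).mono_fun
        (aestronglyMeasurable_of_tendsto_ae atTop hmeas (Eventually.of_forall hrate)) ?_
      filter_upwards [ae_restrict_mem measurableSet_uIoc] with s hs
      refine (le_of_tendsto (hrate s).norm ?_).trans (le_abs_self _)
      filter_upwards [hbound] with n hn
      exact hn s hs
    have hintlim : Tendsto (fun n => ∫ s in (0 : ℝ)..t,
        rate K F g s.toNNReal (μ' (ψ n) s.toNNReal) φ) atTop
        (𝓝 (∫ s in (0 : ℝ)..t, rate K F g s.toNNReal (μ s.toNNReal) φ)) :=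
      intervalIntegral.tendsto_integral_filter_of_dominated_convergence _
        (Eventually.of_forall hmeas) (hbound.mono fun n hn => Eventually.of_forall hn)
        intervalIntegrable_const (Eventually.of_forall fun s _ => hrate s)
    have hφlim : Tendsto (fun n => ∫ x : Size, φ x ∂(μ' (ψ n) t : Measure Size)) atTop
        (𝓝 (∫ x : Size, φ x ∂(μ t : Measure Size))) :=
      FiniteMeasure.tendsto_iff_forall_integral_tendsto.1 (hμ t)
        (BoundedContinuousFunction.ofNormedAddCommGroup (fun x : Size => φ x)
          (hφ.continuous.comp continuous_subtype_val) L fun x => hφ.abs_le_one x.2)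
    refine ⟨hint, ?_⟩
    have h1 : Tendsto (fun n => (∫ x : Size, φ x ∂(μ' (ψ n) t : Measure Size)) -
        (∫ x : Size, φ x ∂(μin : Measure Size)) -
        ∫ s in (0 : ℝ)..t, rate K F g s.toNNReal (μ' (ψ n) s.toNNReal) φ) atTop (𝓝 0) := by
      refine squeeze_zero_norm' (a := fun n => errorBound k f M μin t *
        (L * (1 / ((ψ n : ℝ) + 1)))) ?_ ?_
      · filter_upwards [hlarge t] with n hn
        exact (hμ' (ψ n)).equation t hn L φ hφ
      · have := ((tendsto_one_div_add_atTop_nhds_zero_nat (𝕜 := ℝ)).comp hψ.tendsto_atTop)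
        simpa using (this.const_mul L).const_mul (errorBound k f M μin t)
    have h2 := tendsto_nhds_unique h1 ((hφlim.sub_const _).sub hintlim)
    linarith

end CoagFrag

/-! ### Ramp functions and a rate bound independent of the Lipschitz constant. -/

namespace CoagFrag

/-- `x ↦ min (n x) 1` on `[0, ∞)`, an approximation of the constant `1`. -/
def rampFn (n : ℕ) (x : ℝ) : ℝ := min (n * |x|) 1

theorem lipAtZero_rampFn (n : ℕ) : LipAtZero n (rampFn n) where
  zero := by simp [rampFn]
  lip x y := by
    have h1 := abs_min_sub_min_le_max (n * |x|) 1 (n * |y|) 1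
    rw [sub_self, abs_zero, max_eq_left (abs_nonneg (n * |x| - n * |y|)), ← mul_sub, abs_mul,
      Nat.abs_cast] at h1
    exact h1.trans (mul_le_mul_of_nonneg_left (abs_abs_sub_abs_le _ _) n.cast_nonneg)

theorem rampFn_mem (n : ℕ) (x : ℝ) : rampFn n x ∈ Icc (0 : ℝ) 1 :=
  ⟨le_min (by positivity) zero_le_one, min_le_right _ _⟩

theorem abs_rampFn_le (n : ℕ) (x : ℝ) : |rampFn n x| ≤ 1 := by
  rw [abs_of_nonneg (rampFn_mem n x).1]; exact (rampFn_mem n x).2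

theorem eventually_rampFn_eq_one {x : ℝ} (hx : 0 < x) : ∀ᶠ n in atTop, rampFn n x = 1 := by
  obtain ⟨n₀, hn₀⟩ := exists_nat_ge (1 / x)
  filter_upwards [eventually_ge_atTop n₀] with n hn
  refine min_eq_right ?_
  rw [abs_of_pos hx, ← div_le_iff₀ hx]
  exact hn₀.trans (by exact_mod_cast hn)

/-- On `[0, ∞)` the ramp is concave and vanishes at `0`, hence subadditive; it is also increasing,
so capping `x + y` at `1` only helps. -/
theorem opA_rampFn_nonpos (n : ℕ) {x y : ℝ} (hx : 0 < x) (hy : 0 < y) :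
    opA (rampFn n) x y ≤ 0 := by
  have hn : (0 : ℝ) ≤ n := n.cast_nonneg
  have hm : 0 < min (x + y) 1 := lt_min (add_pos hx hy) one_pos
  have h1 := mul_le_mul_of_nonneg_left (min_le_left (x + y) 1) hn
  have h2 : 0 ≤ n * x := by positivity
  have h3 : 0 ≤ n * y := by positivity
  simp only [opA, rampFn, abs_of_pos hx, abs_of_pos hy, abs_of_pos hm]
  rcases min_cases (n * x) (1 : ℝ) with h | h <;> rcases min_cases (n * y) (1 : ℝ) with h' | h' <;>
    rcases min_cases (n * min (x + y) 1) (1 : ℝ) with h'' | h'' <;> linarith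

variable {K F : ℝ → ℝ → ℝ} {g : ℝ≥0 → L1Large} {k f ρ M : ℝ} {ν : FiniteMeasure Size}

namespace Subordinate

/-- The part of `rate` that involves only bounded operators. -/
theorem abs_rate_sub_le (H : Subordinate K F g k f ρ M) {L : ℝ} {φ : ℝ → ℝ} (hφ : LipAtZero L φ)
    (h1 : ∀ x ∈ Ioc (0 : ℝ) 1, |φ x| ≤ 1) {D : ℝ}
    (hD : (ν : Measure Size).real univ + M ≤ D) (t : ℝ≥0) :
    |rate K F g t ν φ - ((1 / 2) * (∫ p : Size × Size, K p.1 p.2 * opA φ p.1 p.2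
      ∂((ν : Measure Size).prod (ν : Measure Size)))
      - ∫ x : Size, lossG K g t x * φ x ∂(ν : Measure Size))| ≤ 2 * f * D := by
  have := H.abs_fragmentation_le ν h1 hD t
  rw [mul_one] at this
  rw [H.rate_eq (H.testable_of_lip ν hφ)]
  convert this using 2
  ring

/-- Both terms on the left are nonnegative. The time integral of the right-hand side along a weak
solution is bounded uniformly in `n`, because the equation expresses it through integrals of
functions between `0` and `1`. -/
theorem ramp_le_rate (H : Subordinate K F g k f ρ M) {D : ℝ}
    (hD : (ν : Measure Size).real univ + M ≤ D) (t : ℝ≥0) (n : ℕ) :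
    (1 / 2) * (∫ p : Size × Size, K p.1 p.2 * -opA (rampFn n) p.1 p.2
      ∂((ν : Measure Size).prod (ν : Measure Size)))
      + ∫ x : Size, lossG K g t x * rampFn n x ∂(ν : Measure Size) ≤
    2 * f * D - rate K F g t ν (rampFn n) := by
  have := abs_le.1 (H.abs_rate_sub_le (ν := ν) (lipAtZero_rampFn n)
    (fun x _ => abs_rampFn_le n x) hD t)
  simp only [mul_neg, integral_neg]
  linarith [this.1, this.2]

theorem integral_ramp_nonneg (H : Subordinate K F g k f ρ M) (ν : FiniteMeasure Size) (n : ℕ) :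
    0 ≤ ∫ p : Size × Size, K p.1 p.2 * -opA (rampFn n) p.1 p.2
      ∂((ν : Measure Size).prod (ν : Measure Size)) :=
  integral_nonneg fun p => mul_nonneg (H.kernelK.nonneg _ _ p.1.2.1 p.2.2.1)
    (neg_nonneg.2 (opA_rampFn_nonpos n p.1.2.1 p.2.2.1))

theorem integral_loss_ramp_nonneg (H : Subordinate K F g k f ρ M) (ν : FiniteMeasure Size)
    (t : ℝ≥0) (n : ℕ) : 0 ≤ ∫ x : Size, lossG K g t x * rampFn n x ∂(ν : Measure Size) :=
  integral_nonneg fun x => mul_nonneg (H.lossG_nonneg t x.2) (rampFn_mem n x).1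

/-- Fatou's lemma: at each `(x, y)` the ramp eventually equals `1` at all three points, so `-𝒜` of
it equals `1 + 1 - 1 = 1`. -/
theorem lintegral_K_le (H : Subordinate K F g k f ρ M) {D : ℝ}
    (hD : (ν : Measure Size).real univ + M ≤ D) (t : ℝ≥0) :
    ∫⁻ p : Size × Size, ENNReal.ofReal (K p.1 p.2)
      ∂((ν : Measure Size).prod (ν : Measure Size)) ≤
    2 * liminf (fun n => ENNReal.ofReal (2 * f * D - rate K F g t ν (rampFn n))) atTop := by
  have hlip := fun n => H.testable_of_lip ν (lipAtZero_rampFn n)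
  have hint : ∀ n, Integrable (fun p : Size × Size => K p.1 p.2 * -opA (rampFn n) p.1 p.2)
      ((ν : Measure Size).prod (ν : Measure Size)) := fun n => by
    simp only [mul_neg]
    exact (hlip n).coagulation.neg
  have hpt : ∀ p : Size × Size, Tendsto
      (fun n => ENNReal.ofReal (K p.1 p.2 * -opA (rampFn n) p.1 p.2)) atTop
      (𝓝 (ENNReal.ofReal (K p.1 p.2))) := by
    intro p
    refine tendsto_const_nhds.congr' ?_
    filter_upwards [eventually_rampFn_eq_one p.1.2.1, eventually_rampFn_eq_one p.2.2.1,
      eventually_rampFn_eq_one (min_mem_Ioc p.1.2 p.2.2).1] with n h1 h2 h3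
    rw [opA, h1, h2, h3]
    norm_num
  have hhalf : ∀ n, ∫⁻ p : Size × Size, ENNReal.ofReal (K p.1 p.2 * -opA (rampFn n) p.1 p.2)
      ∂((ν : Measure Size).prod (ν : Measure Size)) ≤
      2 * ENNReal.ofReal (2 * f * D - rate K F g t ν (rampFn n)) := by
    intro n
    rw [← ofReal_integral_eq_lintegral_ofReal (hint n) (Eventually.of_forall fun p =>
      mul_nonneg (H.kernelK.nonneg _ _ p.1.2.1 p.2.2.1)
        (neg_nonneg.2 (opA_rampFn_nonpos n p.1.2.1 p.2.2.1))),
      show (2 : ℝ≥0∞) = ENNReal.ofReal 2 by simp, ← ENNReal.ofReal_mul zero_le_two]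
    refine ENNReal.ofReal_le_ofReal ?_
    linarith [H.ramp_le_rate hD t n, H.integral_loss_ramp_nonneg ν t n]
  calc ∫⁻ p : Size × Size, ENNReal.ofReal (K p.1 p.2)
        ∂((ν : Measure Size).prod (ν : Measure Size))
      = ∫⁻ p : Size × Size, liminf (fun n =>
          ENNReal.ofReal (K p.1 p.2 * -opA (rampFn n) p.1 p.2)) atTop
          ∂((ν : Measure Size).prod (ν : Measure Size)) :=
        lintegral_congr fun p => (hpt p).liminf_eq.symm
    _ ≤ liminf (fun n => ∫⁻ p : Size × Size, ENNReal.ofReal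
          (K p.1 p.2 * -opA (rampFn n) p.1 p.2)
          ∂((ν : Measure Size).prod (ν : Measure Size))) atTop :=
        lintegral_liminf_le' fun n => (hint n).aestronglyMeasurable.aemeasurable.ennreal_ofReal
    _ ≤ liminf (fun n => 2 * ENNReal.ofReal (2 * f * D - rate K F g t ν (rampFn n))) atTop :=
        liminf_le_liminf (Eventually.of_forall hhalf)
    _ = _ := ENNReal.liminf_const_mul_of_ne_top (by simp)

theorem lintegral_lossG_le (H : Subordinate K F g k f ρ M) {D : ℝ}
    (hD : (ν : Measure Size).real univ + M ≤ D) (t : ℝ≥0) :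
    ∫⁻ x : Size, ENNReal.ofReal (lossG K g t x) ∂(ν : Measure Size) ≤
    liminf (fun n => ENNReal.ofReal (2 * f * D - rate K F g t ν (rampFn n))) atTop := by
  have hint : ∀ n, Integrable (fun x : Size => lossG K g t x * rampFn n x) (ν : Measure Size) :=
    fun n => H.integrable_lossG_mul (H.testable_of_lip ν (lipAtZero_rampFn n)) t
  have hpt : ∀ x : Size, Tendsto (fun n => ENNReal.ofReal (lossG K g t x * rampFn n x)) atTop
      (𝓝 (ENNReal.ofReal (lossG K g t x))) := by
    intro x
    refine tendsto_const_nhds.congr' ?_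
    filter_upwards [eventually_rampFn_eq_one x.2.1] with n h1
    rw [h1, mul_one]
  calc ∫⁻ x : Size, ENNReal.ofReal (lossG K g t x) ∂(ν : Measure Size)
      = ∫⁻ x : Size, liminf (fun n => ENNReal.ofReal (lossG K g t x * rampFn n x)) atTop
          ∂(ν : Measure Size) := lintegral_congr fun x => (hpt x).liminf_eq.symm
    _ ≤ liminf (fun n => ∫⁻ x : Size, ENNReal.ofReal (lossG K g t x * rampFn n x)
          ∂(ν : Measure Size)) atTop :=
        lintegral_liminf_le' fun n => (hint n).aestronglyMeasurable.aemeasurable.ennreal_ofReal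
    _ ≤ _ := by
        refine liminf_le_liminf (Eventually.of_forall fun n => ?_)
        rw [← ofReal_integral_eq_lintegral_ofReal (hint n) (Eventually.of_forall fun x =>
          mul_nonneg (H.lossG_nonneg t x.2) (rampFn_mem n x).1)]
        refine ENNReal.ofReal_le_ofReal ?_
        linarith [H.ramp_le_rate hD t n, H.integral_ramp_nonneg ν n]

/-- For test functions bounded by `1` the rate is bounded independently of the Lipschitz
constant. -/
theorem enorm_rate_le (H : Subordinate K F g k f ρ M) {L : ℝ} {φ : ℝ → ℝ} (hφ : LipAtZero L φ)
    (h1 : ∀ x ∈ Ioc (0 : ℝ) 1, |φ x| ≤ 1) {D : ℝ}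
    (hD : (ν : Measure Size).real univ + M ≤ D) (t : ℝ≥0) :
    ‖rate K F g t ν φ‖ₑ ≤
      4 * liminf (fun n => ENNReal.ofReal (2 * f * D - rate K F g t ν (rampFn n))) atTop +
        ENNReal.ofReal (2 * f * D) := by
  set Φ := liminf (fun n => ENNReal.ofReal (2 * f * D - rate K F g t ν (rampFn n))) atTop
  set I := ∫ p : Size × Size, K p.1 p.2 * opA φ p.1 p.2
    ∂((ν : Measure Size).prod (ν : Measure Size)) with hI
  set J := ∫ x : Size, lossG K g t x * φ x ∂(ν : Measure Size) with hJ
  -- `|𝒜φ| ≤ 3` when `|φ| ≤ 1`, and `∫ K ≤ 2 Φ`. After the factor `1 / 2` this gives `3 Φ`, and the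
  -- loss term adds one more `Φ`: hence the `4`.
  have hIle : ‖I‖ₑ ≤ 3 * (2 * Φ) := by
    calc ‖I‖ₑ ≤ ∫⁻ p : Size × Size, ‖K p.1 p.2 * opA φ p.1 p.2‖ₑ
          ∂((ν : Measure Size).prod (ν : Measure Size)) := enorm_integral_le_lintegral_enorm _
      _ ≤ ∫⁻ p : Size × Size, 3 * ENNReal.ofReal (K p.1 p.2)
          ∂((ν : Measure Size).prod (ν : Measure Size)) := by
          refine lintegral_mono fun p => ?_
          have a0 := H.kernelK.nonneg _ _ p.1.2.1 p.2.2.1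
          have a1 := abs_le.1 (h1 _ p.1.2)
          have a2 := abs_le.1 (h1 _ p.2.2)
          have a3 := abs_le.1 (h1 _ (min_mem_Ioc p.1.2 p.2.2))
          rw [← ofReal_norm, Real.norm_eq_abs, show (3 : ℝ≥0∞) = ENNReal.ofReal 3 by simp,
            ← ENNReal.ofReal_mul (by norm_num), abs_mul, abs_of_nonneg a0, mul_comm]
          refine ENNReal.ofReal_le_ofReal (mul_le_mul_of_nonneg_right ?_ a0)
          rw [opA, abs_le]
          constructor <;> linarith [a1.1, a1.2, a2.1, a2.2, a3.1, a3.2]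
      _ = 3 * ∫⁻ p : Size × Size, ENNReal.ofReal (K p.1 p.2)
          ∂((ν : Measure Size).prod (ν : Measure Size)) :=
          lintegral_const_mul' _ _ (by simp)
      _ ≤ _ := by gcongr; exact H.lintegral_K_le hD t
  have hJle : ‖J‖ₑ ≤ Φ := by
    calc ‖J‖ₑ ≤ ∫⁻ x : Size, ‖lossG K g t x * φ x‖ₑ ∂(ν : Measure Size) :=
          enorm_integral_le_lintegral_enorm _
      _ ≤ ∫⁻ x : Size, ENNReal.ofReal (lossG K g t x) ∂(ν : Measure Size) := by
          refine lintegral_mono fun x => ?_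
          rw [← ofReal_norm, Real.norm_eq_abs, abs_mul, abs_of_nonneg (H.lossG_nonneg t x.2)]
          exact ENNReal.ofReal_le_ofReal
            (mul_le_of_le_one_right (H.lossG_nonneg t x.2) (h1 x x.2))
      _ ≤ Φ := H.lintegral_lossG_le hD t
  have hR := H.abs_rate_sub_le (ν := ν) hφ h1 hD t
  rw [← hI, ← hJ] at hR
  have hhalf : ‖(1 / 2 : ℝ) * I‖ₑ ≤ 3 * Φ := by
    have e : (2 : ℝ≥0∞) * ‖(1 / 2 : ℝ) * I‖ₑ = ‖I‖ₑ := by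
      have : (2 : ℝ≥0∞) = ‖(2 : ℝ)‖ₑ := by rw [← ofReal_norm]; simp
      rw [this, ← enorm_mul]
      congr 1
      ring
    refine (ENNReal.mul_le_mul_iff_right (a := 2) (by simp) (by simp)).1 ?_
    rw [e]
    exact hIle.trans_eq (by ring)
  have hdecomp : rate K F g t ν φ = ((1 / 2) * I - J) + (rate K F g t ν φ - ((1 / 2) * I - J)) := by
    ring
  calc ‖rate K F g t ν φ‖ₑ
      ≤ ‖(1 / 2) * I - J‖ₑ + ‖rate K F g t ν φ - ((1 / 2) * I - J)‖ₑ := by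
        conv_lhs => rw [hdecomp]
        exact enorm_add_le _ _
    _ ≤ (3 * Φ + Φ) + ENNReal.ofReal (2 * f * D) := by
        refine add_le_add (enorm_sub_le.trans (add_le_add hhalf hJle)) ?_
        rw [← ofReal_norm]
        exact ENNReal.ofReal_le_ofReal hR
    _ = 4 * Φ + ENNReal.ofReal (2 * f * D) := by ring

end Subordinate
end CoagFrag

/-! ### From Lipschitz test functions to total variation; conclusion. -/

namespace CoagFrag

/-- Lipschitz approximation from above of the indicator of a set. -/
noncomputable def bumpFn (s : Set ℝ) (n : ℕ) (x : ℝ) : ℝ := max 0 (1 - n * Metric.infDist x s)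

theorem bumpFn_mem (s : Set ℝ) (n : ℕ) (x : ℝ) : bumpFn s n x ∈ Icc (0 : ℝ) 1 := by
  have : (0 : ℝ) ≤ n * Metric.infDist x s := mul_nonneg n.cast_nonneg Metric.infDist_nonneg
  exact ⟨le_max_left _ _, max_le zero_le_one (by linarith)⟩

theorem eventually_bumpFn_eq_zero {s : Set ℝ} (hs : IsClosed s) (hne : s.Nonempty) {x : ℝ}
    (hx : x ∉ s) : ∀ᶠ n in atTop, bumpFn s n x = 0 := by
  have h0 : 0 < Metric.infDist x s := (hs.notMem_iff_infDist_pos hne).1 hx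
  obtain ⟨n₀, hn₀⟩ := exists_nat_ge (1 / Metric.infDist x s)
  filter_upwards [eventually_ge_atTop n₀] with n hn
  refine max_eq_left (sub_nonpos.2 ?_)
  rw [← div_le_iff₀ h0]
  exact hn₀.trans (by exact_mod_cast hn)

theorem bumpFn_eq_one {s : Set ℝ} {x : ℝ} (hx : x ∈ s) (n : ℕ) : bumpFn s n x = 1 := by
  simp [bumpFn, Metric.infDist_zero_of_mem hx]

theorem lipAtZero_bumpFn {s : Set ℝ} {n : ℕ} (h0 : bumpFn s n 0 = 0) :
    LipAtZero n (bumpFn s n) where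
  zero := h0
  lip x y := by
    have h1 := abs_max_sub_max_le_max 0 (1 - n * Metric.infDist x s) 0 (1 - n * Metric.infDist y s)
    have h2 : |Metric.infDist x s - Metric.infDist y s| ≤ |x - y| := by
      have := (Metric.lipschitz_infDist_pt s).dist_le_mul x y
      rwa [NNReal.coe_one, one_mul, Real.dist_eq, Real.dist_eq] at this
    rw [sub_self, abs_zero, max_eq_right (abs_nonneg ((1 - n * Metric.infDist x s) -
      (1 - n * Metric.infDist y s))), sub_sub_sub_cancel_left, ← mul_sub, abs_mul, Nat.abs_cast,
      abs_sub_comm (Metric.infDist y s)] at h1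
    exact h1.trans (mul_le_mul_of_nonneg_left h2 n.cast_nonneg)

/-- Bounds on `∫ φ d(μ - ν)` for Lipschitz `φ` bounded by `1` pass to measures of compact sets. -/
theorem ofReal_abs_sub_le_of_isCompact {μ ν : FiniteMeasure Size} {ω : ℝ≥0∞}
    (h : ∀ (L : ℝ) (φ : ℝ → ℝ), LipAtZero L φ → (∀ x ∈ Ioc (0 : ℝ) 1, |φ x| ≤ 1) →
      ENNReal.ofReal |(∫ x : Size, φ x ∂(μ : Measure Size)) -
        ∫ x : Size, φ x ∂(ν : Measure Size)| ≤ ω) {s : Set Size} (hs : IsCompact s) :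
    ENNReal.ofReal |(μ : Measure Size).real s - (ν : Measure Size).real s| ≤ ω := by
  rcases s.eq_empty_or_nonempty with rfl | hne
  · simp
  set s' : Set ℝ := (↑) '' s with hs'
  have hclosed : IsClosed s' := (hs.image continuous_subtype_val).isClosed
  have hne' : s'.Nonempty := hne.image _
  -- A compact subset of `(0, 1]` stays away from `0`, so for large `n` the bump vanishes at `0` and
  -- is an admissible test function.
  have h0 : (0 : ℝ) ∉ s' := by
    rintro ⟨x, -, hx⟩
    exact x.2.1.ne' hx
  have key : ∀ κ : FiniteMeasure Size, Tendsto (fun n : ℕ => ∫ x : Size, bumpFn s' n x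
      ∂(κ : Measure Size)) atTop (𝓝 ((κ : Measure Size).real s)) := by
    intro κ
    rw [← integral_indicator_one hs.measurableSet]
    have hcont : ∀ n : ℕ, Continuous (bumpFn s' n) := fun n => by
      have := Metric.continuous_infDist_pt s'
      unfold bumpFn
      fun_prop
    refine tendsto_integral_of_dominated_convergence (fun _ => 1)
      (fun n => ((hcont n).comp continuous_subtype_val).aestronglyMeasurable)
      (integrable_const _) (fun n => Eventually.of_forall fun x => ?_)
      (Eventually.of_forall fun x => ?_)
    · rw [Real.norm_eq_abs, abs_of_nonneg (bumpFn_mem _ _ _).1]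
      exact (bumpFn_mem _ _ _).2
    · refine tendsto_const_nhds.congr' ?_
      by_cases hx : x ∈ s
      · refine Eventually.of_forall fun n => ?_
        have hx' : (x : ℝ) ∈ s' := mem_image_of_mem _ hx
        simp only [indicator_of_mem hx, bumpFn_eq_one hx', Pi.one_apply]
      · have hx' : (x : ℝ) ∉ s' := by
          rintro ⟨y, hy, hyx⟩
          exact hx (Subtype.ext hyx ▸ hy)
        filter_upwards [eventually_bumpFn_eq_zero hclosed hne' hx'] with n hn
        rw [indicator_of_notMem hx, hn]
  refine le_of_tendsto ((ENNReal.continuous_ofReal.tendsto _).comp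
    ((key μ).sub (key ν)).abs) ?_
  filter_upwards [eventually_bumpFn_eq_zero hclosed hne' h0] with n hn
  refine h n _ (lipAtZero_bumpFn hn) fun x _ => ?_
  rw [abs_of_nonneg (bumpFn_mem _ _ _).1]
  exact (bumpFn_mem _ _ _).2

/-- Inner regularity of `μ + ν` yields one compact set that approximates `s` for both measures at
once. -/
theorem ofReal_abs_sub_le_of_measurableSet {μ ν : FiniteMeasure Size} {ω : ℝ≥0∞}
    (h : ∀ s : Set Size, IsCompact s →
      ENNReal.ofReal |(μ : Measure Size).real s - (ν : Measure Size).real s| ≤ ω)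
    {s : Set Size} (hs : MeasurableSet s) :
    ENNReal.ofReal |(μ : Measure Size).real s - (ν : Measure Size).real s| ≤ ω := by
  refine ENNReal.le_of_forall_pos_le_add fun ε hε _ => ?_
  have : LocallyCompactSpace Size :=
    (isLocallyClosed_Ioc (a := (0 : ℝ)) (b := 1)).locallyCompactSpace
  obtain ⟨c, hcs, hc, hlt⟩ := hs.exists_isCompact_lt_add
    (μ := (μ : Measure Size) + (ν : Measure Size)) (measure_ne_top _ _)
    (ε := ε) (by exact_mod_cast hε.ne')
  have hreal : (μ : Measure Size).real s + (ν : Measure Size).real s ≤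
      (μ : Measure Size).real c + (ν : Measure Size).real c + ε := by
    have := ENNReal.toReal_mono (by finiteness) hlt.le
    rw [ENNReal.toReal_add (by finiteness) (by finiteness)] at this
    simp only [Measure.add_apply, ENNReal.toReal_add (measure_ne_top (μ : Measure Size) _)
      (measure_ne_top (ν : Measure Size) _)] at this
    exact this
  have h1 : (μ : Measure Size).real c ≤ (μ : Measure Size).real s := measureReal_mono hcs
  have h2 : (ν : Measure Size).real c ≤ (ν : Measure Size).real s := measureReal_mono hcs
  have h3 : |(μ : Measure Size).real s - (ν : Measure Size).real s| ≤
      |(μ : Measure Size).real c - (ν : Measure Size).real c| + ε := by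
    rcases abs_cases ((μ : Measure Size).real c - (ν : Measure Size).real c) with h | h <;>
      rw [abs_le] <;> constructor <;> linarith
  calc ENNReal.ofReal |(μ : Measure Size).real s - (ν : Measure Size).real s|
      ≤ ENNReal.ofReal (|(μ : Measure Size).real c - (ν : Measure Size).real c| + ε) :=
        ENNReal.ofReal_le_ofReal h3
    _ = ENNReal.ofReal |(μ : Measure Size).real c - (ν : Measure Size).real c| + ε := by
        rw [ENNReal.ofReal_add (abs_nonneg _) ε.coe_nonneg, ENNReal.ofReal_coe_nnreal]
    _ ≤ ω + ε := by gcongr; exact h c hc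

/-- By the Hahn decomposition, the mass of each Jordan part is, up to sign, the value of `μ - ν` on
a single set; each of the two parts costs one `ω`. -/
theorem tvDist_le {μ ν : FiniteMeasure Size} {ω : ℝ≥0∞}
    (h : ∀ s : Set Size, MeasurableSet s →
      ENNReal.ofReal |(μ : Measure Size).real s - (ν : Measure Size).real s| ≤ ω) :
    tvDist μ ν ≤ 2 * ω := by
  set σ := (μ : Measure Size).toSignedMeasure - (ν : Measure Size).toSignedMeasure with hσ
  set j := σ.toJordanDecomposition with hj
  have happ : ∀ s, MeasurableSet s →
      σ s = (μ : Measure Size).real s - (ν : Measure Size).real s := fun s hs => by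
    rw [hσ, sub_apply, Measure.toSignedMeasure_apply_measurable hs,
      Measure.toSignedMeasure_apply_measurable hs]
  obtain ⟨s, hs, hp, hn⟩ := j.mutuallySingular
  have hdec : ∀ s, MeasurableSet s → σ s = j.posPart.real s - j.negPart.real s := fun s hs =>
    σ.apply_eq_posPart_real_sub_negPart_real hs
  have h1 : j.posPart univ ≤ ω := by
    have e1 : j.posPart univ = j.posPart sᶜ := by
      rw [← measure_add_measure_compl hs, hp, zero_add]
    have e2 : σ sᶜ = j.posPart.real sᶜ := by
      rw [hdec _ hs.compl, Measure.real, Measure.real, hn, ENNReal.toReal_zero, sub_zero]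
    rw [e1, ← ENNReal.ofReal_toReal (measure_ne_top j.posPart sᶜ)]
    refine le_trans (ENNReal.ofReal_le_ofReal ?_) (h sᶜ hs.compl)
    rw [← happ _ hs.compl, e2]
    exact le_abs_self _
  have h2 : j.negPart univ ≤ ω := by
    have e1 : j.negPart univ = j.negPart s := by
      rw [← measure_add_measure_compl hs, hn, add_zero]
    have e2 : σ s = -j.negPart.real s := by
      rw [hdec _ hs, Measure.real, Measure.real, hp, ENNReal.toReal_zero, zero_sub]
    rw [e1, ← ENNReal.ofReal_toReal (measure_ne_top j.negPart s)]
    refine le_trans (ENNReal.ofReal_le_ofReal ?_) (h s hs)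
    rw [← happ _ hs, e2, abs_neg]
    exact le_abs_self _
  calc tvDist μ ν = j.posPart univ + j.negPart univ := rfl
    _ ≤ ω + ω := add_le_add h1 h2
    _ = 2 * ω := (two_mul ω).symm

/-- A real Lipschitz function extends to the line with the same constant, and continuity of the
extension forces the value `0` at `0`. -/
theorem IsLipZero.exists_lipAtZero {φ : ℝ → ℝ} (hφ : IsLipZero φ) :
    ∃ (L : ℝ) (ψ : ℝ → ℝ), LipAtZero L ψ ∧ EqOn φ ψ (Ioc 0 1) := by
  obtain ⟨L, hL⟩ := hφ.lipschitz
  obtain ⟨ψ, hψ, heq⟩ := hL.extend_real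
  refine ⟨L, ψ, ⟨fun x y => ?_, ?_⟩, heq⟩
  · simpa only [Real.dist_eq] using hψ.dist_le_mul x y
  · have h1 : Tendsto ψ (𝓝[>] 0) (𝓝 (ψ 0)) := (hψ.continuous.tendsto 0).mono_left inf_le_left
    have h2 : Tendsto ψ (𝓝[>] 0) (𝓝 0) := hφ.tendsto_zero.congr' (by
      filter_upwards [Ioc_mem_nhdsGT one_pos] with x hx
      exact heq hx)
    exact tendsto_nhds_unique h1 h2

variable {K F : ℝ → ℝ → ℝ} {g : ℝ≥0 → L1Large} {k f ρ M : ℝ} {μin : FiniteMeasure Size}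

/-- Weak solutions are continuous in total variation. -/
theorem tvContinuous_of_weakSolution (H : Subordinate K F g k f ρ M)
    {μ : ℝ≥0 → FiniteMeasure Size}
    (hmass : ∀ t, (μ t : Measure Size).real univ + M ≤ massBound f M μin t)
    (hμ : ∀ (L : ℝ) (φ : ℝ → ℝ), LipAtZero L φ → ∀ t : ℝ≥0,
        IntervalIntegrable (fun s : ℝ => rate K F g s.toNNReal (μ s.toNNReal) φ) volume 0 t ∧
        ∫ x : Size, φ x ∂(μ t : Measure Size) = (∫ x : Size, φ x ∂(μin : Measure Size)) +
          ∫ s in (0 : ℝ)..t, rate K F g s.toNNReal (μ s.toNNReal) φ) :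
    TVContinuous μ := by
  intro t
  set T : ℝ≥0 := t + 1 with hT
  set D := massBound f M μin T with hD
  have hD0 : 0 ≤ D := H.massBound_nonneg μin T
  have hfD : 0 ≤ 2 * f * D := mul_nonneg (mul_nonneg zero_le_two H.f_nonneg) hD0
  have hmassT : ∀ s ∈ Ioc (0 : ℝ) T, (μ s.toNNReal : Measure Size).real univ + M ≤ D := by
    intro s hs
    refine (hmass _).trans (H.massBound_mono μin ?_)
    rw [Real.coe_toNNReal s hs.1.le]
    exact hs.2
  -- Using this liminf of rates as the dominating function avoids any question of measurability in
  -- time of the integrals of `K` and `𝒢`.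
  set φ : ℝ → ℝ≥0∞ := fun s => liminf (fun n => ENNReal.ofReal
    (2 * f * D - rate K F g s.toNNReal (μ s.toNNReal) (rampFn n))) atTop with hφ
  have hrint : ∀ n, IntegrableOn (fun s : ℝ => 2 * f * D -
      rate K F g s.toNNReal (μ s.toNNReal) (rampFn n)) (Ioc 0 T) := fun n =>
    (integrable_const _).sub ((intervalIntegrable_iff_integrableOn_Ioc_of_le T.coe_nonneg).1
      (hμ n _ (lipAtZero_rampFn n) T).1)
  have hrnn : ∀ n, ∀ s ∈ Ioc (0 : ℝ) T, 0 ≤ 2 * f * D -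
      rate K F g s.toNNReal (μ s.toNNReal) (rampFn n) := fun n s hs => by
    linarith [H.ramp_le_rate (hmassT s hs) s.toNNReal n,
      H.integral_ramp_nonneg (μ s.toNNReal) n,
      H.integral_loss_ramp_nonneg (μ s.toNNReal) s.toNNReal n]
  -- Fatou's lemma in time. By the equation, minus the integrated rate of a ramp is its
  -- `μin`-integral minus its `μ T`-integral, hence at most the mass of `μin`, whatever `n`.
  have hfin : ∫⁻ s in Ioc (0 : ℝ) T, φ s ≠ ∞ := by
    have h1 : ∀ n, ∫⁻ s in Ioc (0 : ℝ) T, ENNReal.ofReal (2 * f * D -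
        rate K F g s.toNNReal (μ s.toNNReal) (rampFn n)) ≤
        ENNReal.ofReal (T * (2 * f * D) + (μin : Measure Size).real univ) := by
      intro n
      rw [← ofReal_integral_eq_lintegral_ofReal (hrint n)
        ((ae_restrict_mem measurableSet_Ioc).mono (hrnn n))]
      refine ENNReal.ofReal_le_ofReal ?_
      obtain ⟨h2, h3⟩ := hμ n _ (lipAtZero_rampFn n) T
      rw [intervalIntegral.integral_of_le T.coe_nonneg] at h3
      rw [intervalIntegrable_iff_integrableOn_Ioc_of_le T.coe_nonneg] at h2
      rw [integral_sub (integrable_const _) h2, setIntegral_const, smul_eq_mul]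
      have h4 : ∫ x : Size, rampFn n x ∂(μin : Measure Size) ≤ (μin : Measure Size).real univ := by
        have := norm_integral_le_of_norm_le_const (μ := (μin : Measure Size))
          (f := fun x : Size => rampFn n x) (C := 1)
          (Eventually.of_forall fun x => abs_rampFn_le n x)
        rw [one_mul] at this
        exact (le_abs_self _).trans this
      have h5 : 0 ≤ ∫ x : Size, rampFn n x ∂(μ T : Measure Size) :=
        integral_nonneg fun x => (rampFn_mem n x).1
      have h6 : volume.real (Ioc (0 : ℝ) T) = T := by simp [Measure.real]
      rw [h6]
      linarith
    refine ne_top_of_le_ne_top (b := ENNReal.ofReal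
      (T * (2 * f * D) + (μin : Measure Size).real univ)) (by finiteness) ?_
    refine (lintegral_liminf_le' fun n =>
      (hrint n).aestronglyMeasurable.aemeasurable.ennreal_ofReal).trans ?_
    exact liminf_le_of_frequently_le' (Eventually.of_forall h1).frequently
  set w : ℝ → ℝ≥0∞ := fun s => 4 * φ s + ENNReal.ofReal (2 * f * D) with hw
  have hwfin : ∫⁻ s in Ioc (0 : ℝ) T, w s ≠ ∞ := by
    rw [lintegral_add_right _ measurable_const, lintegral_const_mul' _ _ (by simp)]
    simp only [lintegral_const, Measure.restrict_apply MeasurableSet.univ, univ_inter,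
      Real.volume_Ioc]
    finiteness
  have hsub : ∀ s : ℝ≥0, s ≤ T → uIoc (s : ℝ) t ⊆ Ioc (0 : ℝ) T := fun s hs r hr =>
    ⟨(le_min s.coe_nonneg t.coe_nonneg).trans_lt hr.1, hr.2.trans (max_le hs (by
      rw [hT]; push_cast; linarith))⟩
  have htv : ∀ s : ℝ≥0, s ≤ T →
      tvDist (μ s) (μ t) ≤ 2 * ∫⁻ r in uIoc (s : ℝ) t, w r ∂(volume.restrict (Ioc (0 : ℝ) T)) := by
    intro s hs
    refine tvDist_le fun A hA => ofReal_abs_sub_le_of_measurableSet (fun C hC =>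
      ofReal_abs_sub_le_of_isCompact (fun L χ hχ hχ1 => ?_) hC) hA
    obtain ⟨i1, e1⟩ := hμ L χ hχ s
    obtain ⟨i2, e2⟩ := hμ L χ hχ t
    have e3 := intervalIntegral.integral_add_adjacent_intervals i1 (i1.symm.trans i2)
    have e4 : (∫ x : Size, χ x ∂(μ s : Measure Size)) - ∫ x : Size, χ x ∂(μ t : Measure Size) =
        -∫ r in (s : ℝ)..t, rate K F g r.toNNReal (μ r.toNNReal) χ := by
      rw [e1, e2, ← e3]; ring
    rw [e4, abs_neg, ← Real.norm_eq_abs, intervalIntegral.norm_intervalIntegral_eq, ofReal_norm,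
      Measure.restrict_restrict measurableSet_uIoc, inter_eq_left.2 (hsub s hs)]
    refine (enorm_integral_le_lintegral_enorm _).trans
      (setLIntegral_mono' measurableSet_uIoc fun r hr => ?_)
    exact H.enorm_rate_le hχ hχ1 (hmassT r (hsub s hs hr)) _
  -- Absolute continuity of the integral of `w`, as the interval between `s` and `t` shrinks. The
  -- choice `T = t + 1` leaves room on the right of `t`.
  have hlim : Tendsto (fun s : ℝ≥0 =>
      2 * ∫⁻ r in uIoc (s : ℝ) t, w r ∂(volume.restrict (Ioc (0 : ℝ) T))) (𝓝 t) (𝓝 0) := by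
    have h1 : Tendsto (fun s : ℝ≥0 => volume.restrict (Ioc (0 : ℝ) T) (uIoc (s : ℝ) t)) (𝓝 t)
        (𝓝 0) := by
      refine tendsto_of_tendsto_of_tendsto_of_le_of_le tendsto_const_nhds
        (h := fun s : ℝ≥0 => ENNReal.ofReal |(t : ℝ) - s|) ?_ (fun _ => zero_le) fun s => ?_
      · have : Continuous fun s : ℝ≥0 => ENNReal.ofReal |(t : ℝ) - s| :=
          ENNReal.continuous_ofReal.comp (by fun_prop)
        simpa using this.tendsto t
      · exact (Measure.restrict_apply_le _ _).trans (by rw [Real.volume_uIoc])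
    have h2 := tendsto_setLIntegral_zero hwfin h1
    simpa using ENNReal.Tendsto.const_mul h2 (Or.inr (by simp : (2 : ℝ≥0∞) ≠ ∞))
  refine tendsto_of_tendsto_of_tendsto_of_le_of_le' tendsto_const_nhds hlim
    (Eventually.of_forall fun _ => zero_le) ?_
  filter_upwards [Iio_mem_nhds (show t < T from lt_add_one t)] with s hs
  exact htv s hs.le

theorem Subordinate.exists_isSolution (H : Subordinate K F g k f ρ M) (μin : FiniteMeasure Size) :
    ∃ μ : ℝ≥0 → FiniteMeasure Size, IsSolution K F μin g μ := by
  obtain ⟨μ, hmass, hμ⟩ := exists_weakSolution H μin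
  refine ⟨μ, tvContinuous_of_weakSolution H hmass hμ, fun φ hφ s => ?_, fun φ hφ t => ?_,
    fun φ hφ t => ?_⟩
  all_goals obtain ⟨L, ψ, hψ, heq⟩ := hφ.exists_lipAtZero
  · exact (H.rateConverges (H.testable_of_lip (μ s) hψ) s).congr heq.symm
  · simp only [rate_congr K F g _ _ heq]
    exact (hμ L ψ hψ t).1
  · have h1 : ∀ κ : FiniteMeasure Size, ∫ x : Size, φ x ∂(κ : Measure Size) =
        ∫ x : Size, ψ x ∂(κ : Measure Size) := fun κ =>
      integral_congr_ae (Eventually.of_forall fun x => heq x.2)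
    simp only [rate_congr K F g _ _ heq, h1]
    exact (hμ L ψ hψ t).2

end CoagFrag

theorem theorem1
    (K F : ℝ → ℝ → ℝ) (hK : CoagFrag.IsContinuousKernel K) (hF : CoagFrag.IsContinuousKernel F)
    (α β γ K₀ F₀ : ℝ)
    (hα : α ∈ Set.Icc (0 : ℝ) 1) (hβ : β ∈ Set.Icc (0 : ℝ) 1) (hγ : γ ∈ Set.Icc (0 : ℝ) 1)
    (hK₀ : 0 ≤ K₀) (hF₀ : 0 ≤ F₀)
    (hKbound : ∀ x y : ℝ, 0 < x → 0 < y →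
      K x y ≤ K₀ * (x ^ (-α) + y ^ (-α)) * (x ^ β + y ^ β))
    (hFbound : ∀ x y : ℝ, 0 < x → 0 < y → F x y ≤ F₀ * (x ^ γ + y ^ γ))
    (μin : MeasureTheory.FiniteMeasure CoagFrag.Size)
    (g : ℝ≥0 → CoagFrag.L1Large) (hg : CoagFrag.IsBoundaryDatum g)
    (hM : CoagFrag.boundaryMomentSup g (max β γ) < ⊤) :
    ∃ μ : ℝ≥0 → MeasureTheory.FiniteMeasure CoagFrag.Size,
      CoagFrag.IsSolution K F μin g μ :=
  (CoagFrag.subordinate_of_bounds hK hF hα hβ hγ hK₀ hF₀ hKbound hFbound hg hM).exists_isSolution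
    μin
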